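/- Let $(M,h)$ be a compact Hermitian manifold of complex dimension $m$ with fundamental form $\omega_h=\frac{\sqrt{-1}}{2}h_{\alpha\bar\beta}\,dz^\alpha\wedge d\bar z^\beta$, and assume that it is balanced, i.e. $d^*\omega_h=0$, where $d^*$ is the $L^2$-adjoint of $d$. (1) Let $(N,g)$ be a Kähler manifold, $f:M\to N$ a smooth map and $E=f^*(T^{1,0}N)$ with the connection pulled back from the Chern (= Levi-Civita) connection; let $\partial_E,\bar\partial_E$ be its $(1,0)$- and $(0,1)$-parts and $\partial_E^*,\bar\partial_E^*$ their $L^2$-adjoints. In local holomorphic coordinates $z^\alpha$ on $M$ and $w^i$ on $N$, with $f^i=w^i\circ f$ and $e_i=f^*\frac{\partial}{\partial w^i}$, put $\bar\partial f=\frac{\partial f^i}{\partial\bar z^\beta}d\bar z^\beta\otimes e_i$ and $\partial f=\frac{\partial f^i}{\partial z^\alpha}dz^\alpha\otimes e_i$, and let $$E''(f)=\int_M|\bar\partial f|^2\frac{\omega_h^m}{m!},\qquad E'(f)=\int_M|\partial f|^2\frac{\omega_h^m}{m!},\qquad E(f)=\int_M\left(|\bar\partial f|^2+|\partial f|^2\right)\frac{\omega_h^m}{m!}.$$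 Then the following are equivalent: (a) $f$ is $\bar\partial$-harmonic, i.e. a critical point of $E''$; (a') $\bar\partial_E^*\bar\partial f=0$; (b) $f$ is $\partial$-harmonic, i.e. a critical point of $E'$; (b') $\partial_E^*\partial f=0$; (c) $f$ is harmonic, i.e. a critical point of $E$; (c') $\bar\partial_E^*\bar\partial f+\partial_E^*\partial f=0$; (d) $f$ is Hermitian harmonic, i.e. for all $i$ $$-h^{\alpha\bar\beta}\left(\frac{\partial^2 f^i}{\partial z^\alpha\partial\bar z^\beta}+\Gamma^i_{jk}\frac{\partial f^j}{\partial\bar z^\beta}\frac{\partial f^k}{\partial z^\alpha}\right)=0,$$ where $\Gamma^i_{jk}=g^{i\bar l}\frac{\partial g_{k\bar l}}{\partial w^j}$ are the Christoffel symbols of $(N,g)$. (2) The same equivalences hold for a smooth map $f$ from $(M,h)$ to a Riemannian manifold $(N,g)$, with $E=f^*(TN)$ (complexified) carrying the connection pulled back from the Levi-Civita connection, with real local coordinates on $N$, and with the Levi-Civita Christoffel symbols $\Gamma^i_{jk}$ of $(N,g)$. -/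

import Mathlib

open scoped Manifold ContDiff
open MeasureTheory

namespace HarmonicMaps

noncomputable section

/-- The model space of a complex manifold of complex dimension `m`. -/
abbrev CSpace (m : ℕ) : Type := EuclideanSpace ℂ (Fin m)

/-- The model space of a real manifold of dimension `n`. -/
abbrev RSpace (n : ℕ) : Type := EuclideanSpace ℝ (Fin n)

/-- The coordinate direction of `x^α`, where `z^α = x^α + i y^α`; the coordinate direction of
`y^α` is `Complex.I • cBasis α`. -/
def cBasis {m : ℕ} (α : Fin m) : CSpace m := EuclideanSpace.single α (1 : ℂ)

/-- The coordinate direction of the real coordinate `x^i`. -/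
def rBasis {n : ℕ} (i : Fin n) : RSpace n := EuclideanSpace.single i (1 : ℝ)

/-- A complex manifold is in particular a smooth real manifold (with the same charts). -/
instance isManifold_real {m : ℕ} {M : Type*} [TopologicalSpace M] [ChartedSpace (CSpace m) M]
    [IsManifold 𝓘(ℂ, CSpace m) ω M] : IsManifold 𝓘(ℝ, CSpace m) ∞ M := by
  apply isManifold_of_contDiffOn
  intro e e' he he'
  have h := (contDiffGroupoid ω 𝓘(ℂ, CSpace m)).compatible he he'
  rw [contDiffGroupoid, mem_groupoid_of_pregroupoid] at h
  have h1 : ContDiffOn ℂ ω (e.symm ≫ₕ e') (e.symm ≫ₕ e').source := by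
    simpa [contDiffPregroupoid] using h.1
  simpa using (h1.restrict_scalars ℝ).of_le (m := ∞) le_top

/-! ### Real manifolds: metrics, coordinate fields, sections along a map, variations -/

/-- Smooth Riemannian metrics on the manifold `M` modelled on `V`. -/
abbrev RiemMetric (V : Type*) [NormedAddCommGroup V] [NormedSpace ℝ V]
    (M : Type*) [TopologicalSpace M] [ChartedSpace V M] [IsManifold 𝓘(ℝ, V) ∞ M] : Type _ :=
  Bundle.ContMDiffRiemannianMetric 𝓘(ℝ, V) ∞ V (fun p : M => TangentSpace 𝓘(ℝ, V) p)

/-- The tangent vector with components `w` in the chart centred at `b`, at the point which has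
coordinates `y` in that chart. -/
def coordVec {V : Type*} [NormedAddCommGroup V] [NormedSpace ℝ V]
    {M : Type*} [TopologicalSpace M] [ChartedSpace V M] (b : M) (y w : V) :
    TangentSpace 𝓘(ℝ, V) ((extChartAt 𝓘(ℝ, V) b).symm y) :=
  mfderiv 𝓘(ℝ, V) 𝓘(ℝ, V) (extChartAt 𝓘(ℝ, V) b).symm y w

/-- `X` is a smooth section of the pullback bundle `f^*(TN)`. -/
def IsSmoothAlong {W V : Type*} [NormedAddCommGroup W] [NormedSpace ℝ W]
    [NormedAddCommGroup V] [NormedSpace ℝ V]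
    {M : Type*} [TopologicalSpace M] [ChartedSpace W M]
    {N : Type*} [TopologicalSpace N] [ChartedSpace V N] [IsManifold 𝓘(ℝ, V) ∞ N]
    (f : M → N) (X : ∀ p : M, TangentSpace 𝓘(ℝ, V) (f p)) : Prop :=
  ContMDiff 𝓘(ℝ, W) 𝓘(ℝ, V).tangent ∞ (fun p => (⟨f p, X p⟩ : TangentBundle 𝓘(ℝ, V) N))

/-- The components of a section `X` of `f^*(TN)` near `p`, in the charts centred at `p` and
at `f p`. -/
def secLoc {W V : Type*} [NormedAddCommGroup W] [NormedSpace ℝ W]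
    [NormedAddCommGroup V] [NormedSpace ℝ V]
    {M : Type*} [TopologicalSpace M] [ChartedSpace W M]
    {N : Type*} [TopologicalSpace N] [ChartedSpace V N]
    (f : M → N) (X : ∀ p : M, TangentSpace 𝓘(ℝ, V) (f p)) (p : M) (x : W) : V :=
  mfderiv 𝓘(ℝ, V) 𝓘(ℝ, V) (extChartAt 𝓘(ℝ, V) (f p)) (f ((extChartAt 𝓘(ℝ, W) p).symm x))
    (X ((extChartAt 𝓘(ℝ, W) p).symm x))

/-- `f` is a critical point of the functional `En`: for every smooth variation `F(t, ·)` of `f`,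
the function `t ↦ En (F(t, ·))` has derivative `0` at `t = 0`. -/
def IsCritical {W V : Type*} [NormedAddCommGroup W] [NormedSpace ℝ W]
    [NormedAddCommGroup V] [NormedSpace ℝ V]
    {M : Type*} [TopologicalSpace M] [ChartedSpace W M]
    {N : Type*} [TopologicalSpace N] [ChartedSpace V N]
    (En : (M → N) → ℝ) (f : M → N) : Prop :=
  ∀ F : ℝ × M → N, ContMDiff (𝓘(ℝ, ℝ).prod 𝓘(ℝ, W)) 𝓘(ℝ, V) ∞ F → (∀ p, F (0, p) = f p) →
    HasDerivAt (fun t : ℝ => En (fun p => F (t, p))) 0 0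

/-! ### Hermitian metrics on complex manifolds -/

/-- The complex structure on the tangent spaces of a complex manifold. -/
def J {m : ℕ} {M : Type*} [TopologicalSpace M] [ChartedSpace (CSpace m) M] {p : M}
    (v : TangentSpace 𝓘(ℝ, CSpace m) p) : TangentSpace 𝓘(ℝ, CSpace m) p :=
  (Complex.I • (show CSpace m from v) : CSpace m)

section Hermitian

variable {m : ℕ} {M : Type*} [TopologicalSpace M] [ChartedSpace (CSpace m) M]
  [IsManifold 𝓘(ℂ, CSpace m) ω M]

/-- A Hermitian metric, given by its background Riemannian metric: a Riemannian metric invariant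
under the complex structure. -/
def IsHermitian (h : RiemMetric (CSpace m) M) : Prop :=
  ∀ (p : M) (v w : TangentSpace 𝓘(ℝ, CSpace m) p), h.inner p (J v) (J w) = h.inner p v w

/-- The Hermitian form (linear in `v`, conjugate linear in `w`) with real part the Riemannian
metric. -/
def hermForm (h : RiemMetric (CSpace m) M) (p : M) (v w : TangentSpace 𝓘(ℝ, CSpace m) p) : ℂ :=
  (h.inner p v w : ℂ) + Complex.I * (h.inner p v (J w) : ℂ)

/-- The fundamental form `ω_h (v, w) = h (J v, w)`; in coordinates it is
`(√-1 / 2) h_{αβ̄} dz^α ∧ dz̄^β`, with `h_{αβ̄}` as in `hermMatrix`. -/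
def fundForm (h : RiemMetric (CSpace m) M) (p : M) (v w : TangentSpace 𝓘(ℝ, CSpace m) p) : ℝ :=
  h.inner p (J v) w

/-- The matrix `h_{αβ̄}` in the holomorphic chart centred at `b`, at the point with
coordinates `y`. -/
def hermMatrix (h : RiemMetric (CSpace m) M) (b : M) (y : CSpace m) : Matrix (Fin m) (Fin m) ℂ :=
  Matrix.of fun α β => hermForm h _ (coordVec b y (cBasis α)) (coordVec b y (cBasis β))

/-- A Kähler metric: a Hermitian metric with closed fundamental form. (The exterior derivative
is taken at each point `b`, in the chart centred at `b`.) -/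
def IsKahler (h : RiemMetric (CSpace m) M) : Prop :=
  IsHermitian h ∧
  ∀ (b : M) (u v w : CSpace m),
    let y₀ := extChartAt 𝓘(ℝ, CSpace m) b b
    let Ω : CSpace m → CSpace m → CSpace m → ℝ :=
      fun y v w => fundForm h _ (coordVec b y v) (coordVec b y w)
    fderiv ℝ (fun y => Ω y v w) y₀ u - fderiv ℝ (fun y => Ω y u w) y₀ v
      + fderiv ℝ (fun y => Ω y u v) y₀ w = 0

/-- A smooth real `1`-form on `M`. -/
def IsSmoothOneForm (η : ∀ p : M, TangentSpace 𝓘(ℝ, CSpace m) p →L[ℝ] ℝ) : Prop :=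
  ContMDiff 𝓘(ℝ, CSpace m) (𝓘(ℝ, CSpace m).prod 𝓘(ℝ, CSpace m →L[ℝ] ℝ)) ∞
    (fun p => Bundle.TotalSpace.mk' (CSpace m →L[ℝ] ℝ)
      (E := fun p : M => TangentSpace 𝓘(ℝ, CSpace m) p →L[ℝ] ℝ) p (η p))

/-- The exterior derivative `dη` at the point `p`, computed in the chart centred at `p`. -/
def extDerivOne (η : ∀ p : M, TangentSpace 𝓘(ℝ, CSpace m) p →L[ℝ] ℝ) (p : M)
    (u w : TangentSpace 𝓘(ℝ, CSpace m) p) : ℝ :=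
  fderiv ℝ (fun y => η _ (coordVec p y (show CSpace m from w)))
      (extChartAt 𝓘(ℝ, CSpace m) p p) (show CSpace m from u)
    - fderiv ℝ (fun y => η _ (coordVec p y (show CSpace m from u)))
      (extChartAt 𝓘(ℝ, CSpace m) p p) (show CSpace m from w)

/-- The real frame `∂/∂x^1, …, ∂/∂x^m, ∂/∂y^1, …, ∂/∂y^m` of `T_p M`. -/
def realFrame (p : M) : Fin m ⊕ Fin m → TangentSpace 𝓘(ℝ, CSpace m) p :=
  Sum.elim (fun α => (cBasis α : CSpace m)) (fun α => (Complex.I • cBasis α : CSpace m))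

/-- The Gram matrix of the Riemannian metric in the real frame. -/
def gramMatrix (h : RiemMetric (CSpace m) M) (p : M) :
    Matrix (Fin m ⊕ Fin m) (Fin m ⊕ Fin m) ℝ :=
  Matrix.of fun i j => h.inner p (realFrame p i) (realFrame p j)

/-- The pointwise inner product `½ g^{ik} g^{jl} σ_{ij} τ_{kl}` of two real `2`-forms at `p`. -/
def twoFormInner (h : RiemMetric (CSpace m) M) (p : M)
    (σ τ : TangentSpace 𝓘(ℝ, CSpace m) p → TangentSpace 𝓘(ℝ, CSpace m) p → ℝ) : ℝ :=
  (1 / 2) * ∑ i, ∑ j, ∑ k, ∑ l, (gramMatrix h p)⁻¹ i k * (gramMatrix h p)⁻¹ j l *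
    σ (realFrame p i) (realFrame p j) * τ (realFrame p k) (realFrame p l)

section Volume

variable [CompactSpace M] [T2Space M] [MeasurableSpace M]

variable (m M) in
/-- A smooth partition of unity subordinate to the charts. -/
def partitionOfUnity : SmoothPartitionOfUnity M 𝓘(ℝ, CSpace m) M Set.univ :=
  Classical.choose
    (SmoothPartitionOfUnity.exists_isSubordinate_chartAt_source 𝓘(ℝ, CSpace m) M)

/-- The Riemannian volume measure `ω_h^m / m!`. In a holomorphic chart
`ω_h^m / m! = det (h_{αβ̄}) dx^1 dy^1 ⋯ dx^m dy^m`; the pieces are put together with a partition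
of unity (the result does not depend on its choice). -/
def volumeMeasure (h : RiemMetric (CSpace m) M) : Measure M :=
  Measure.sum fun b : M =>
    ((volume.restrict (extChartAt 𝓘(ℝ, CSpace m) b).target).withDensity fun y =>
      ENNReal.ofReal (partitionOfUnity m M b ((extChartAt 𝓘(ℝ, CSpace m) b).symm y) *
        (hermMatrix h b y).det.re)).map (extChartAt 𝓘(ℝ, CSpace m) b).symm

/-- `h` is balanced: `d^* ω_h = 0`, where `d^*` is the adjoint of `d` for the `L²` inner products,
that is, `(dη, ω_h) = (η, d^* ω_h)` vanishes for all smooth `1`-forms `η`. -/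
def IsBalanced (h : RiemMetric (CSpace m) M) : Prop :=
  ∀ η : ∀ p : M, TangentSpace 𝓘(ℝ, CSpace m) p →L[ℝ] ℝ, IsSmoothOneForm η →
    ∫ p, twoFormInner h p (extDerivOne η p) (fundForm h p) ∂(volumeMeasure h) = 0

end Volume

end Hermitian

/-! ### Calculus in coordinates -/

/-- `∂u/∂z^α = ½ (∂u/∂x^α - √-1 ∂u/∂y^α)`. -/
def dz {m : ℕ} (α : Fin m) (u : CSpace m → ℂ) (x : CSpace m) : ℂ :=
  (1 / 2) * (fderiv ℝ u x (cBasis α) - Complex.I * fderiv ℝ u x (Complex.I • cBasis α))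

/-- `∂u/∂z̄^α = ½ (∂u/∂x^α + √-1 ∂u/∂y^α)`. -/
def dzbar {m : ℕ} (α : Fin m) (u : CSpace m → ℂ) (x : CSpace m) : ℂ :=
  (1 / 2) * (fderiv ℝ u x (cBasis α) + Complex.I * fderiv ℝ u x (Complex.I • cBasis α))

/-- The raised components `h^{αβ̄}` of a matrix `h_{αβ̄}`, i.e. `∑ β, h^{αβ̄} h_{γβ̄} = δ^α_γ`. -/
def raise {m : ℕ} (H : Matrix (Fin m) (Fin m) ℂ) (α β : Fin m) : ℂ := H⁻¹ β α

/-- The local expression near a point of `M` of a map `f : M → N` into a Kähler or Riemannian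
manifold, with respect to the local frame `e_i` of `E = f^*(T^{1,0}N)`, resp. of (the
complexification of) `E = f^*(TN)`: the coordinates `pt` of the point, the domain metric
`h_{αβ̄}` there, the components `f^i` of the map near the point, the target metric
`g_{ij̄}` (resp. `g_{ij}`) and the Christoffel symbols `Γ^i_{jk}` of the target at the
image point. -/
structure LocalData (m n : ℕ) where
  pt : CSpace m
  h : Matrix (Fin m) (Fin m) ℂ
  f : Fin n → CSpace m → ℂ
  g : Matrix (Fin n) (Fin n) ℂ
  Γ : Fin n → Fin n → Fin n → ℂ

namespace LocalData

variable {m n : ℕ} (D : LocalData m n)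

/-- Components `∂f^i/∂z^α` of `∂f`. -/
def del (α : Fin m) (i : Fin n) : ℂ := dz α (D.f i) D.pt

/-- Components `∂f^i/∂z̄^β` of `∂̄f`. -/
def dbar (β : Fin m) (i : Fin n) : ℂ := dzbar β (D.f i) D.pt

/-- Components `∂s^i/∂z^α + Γ^i_{jk} (∂f^j/∂z^α) s^k` of `∂_E s`, for a section `s` of `E` and
the pulled back connection. -/
def delE (s : Fin n → CSpace m → ℂ) (α : Fin m) (i : Fin n) : ℂ :=
  dz α (s i) D.pt + ∑ j, ∑ k, D.Γ i j k * D.del α j * s k D.pt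

/-- Components `∂s^i/∂z̄^β + Γ^i_{jk} (∂f^j/∂z̄^β) s^k` of `∂̄_E s`. -/
def dbarE (s : Fin n → CSpace m → ℂ) (β : Fin m) (i : Fin n) : ℂ :=
  dzbar β (s i) D.pt + ∑ j, ∑ k, D.Γ i j k * D.dbar β j * s k D.pt

/-- The Hermitian inner product of two `E`-valued `(1,0)`-forms `a^i_α dz^α ⊗ e_i` and
`b^i_α dz^α ⊗ e_i`. -/
def inner10 (a b : Fin m → Fin n → ℂ) : ℂ :=
  ∑ α, ∑ β, ∑ i, ∑ j, raise D.h α β * D.g i j * a α i * (starRingEnd ℂ) (b β j)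

/-- The Hermitian inner product of two `E`-valued `(0,1)`-forms `a^i_β dz̄^β ⊗ e_i` and
`b^i_β dz̄^β ⊗ e_i`. -/
def inner01 (a b : Fin m → Fin n → ℂ) : ℂ :=
  ∑ α, ∑ β, ∑ i, ∑ j, raise D.h α β * D.g i j * a β i * (starRingEnd ℂ) (b α j)

/-- The energy density `|∂f|²`. -/
def delNormSq : ℝ := (D.inner10 D.del D.del).re

/-- The energy density `|∂̄f|²`. -/
def dbarNormSq : ℝ := (D.inner01 D.dbar D.dbar).re

/-- The pointwise inner product `⟨∂_E s, ∂f⟩`. -/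
def delPair (s : Fin n → CSpace m → ℂ) : ℂ := D.inner10 (D.delE s) D.del

/-- The pointwise inner product `⟨∂̄_E s, ∂̄f⟩`. -/
def dbarPair (s : Fin n → CSpace m → ℂ) : ℂ := D.inner01 (D.dbarE s) D.dbar

/-- The Hermitian harmonic map equation
`-h^{αβ̄} (∂²f^i/∂z^α∂z̄^β + Γ^i_{jk} (∂f^j/∂z̄^β) (∂f^k/∂z^α)) = 0` at the given point. -/
def HermitianHarmonicEq : Prop :=
  ∀ i, -∑ α, ∑ β, raise D.h α β *
    (dz α (dzbar β (D.f i)) D.pt + ∑ j, ∑ k, D.Γ i j k * D.dbar β j * D.del α k) = 0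

end LocalData

/-! ### Maps from a Hermitian manifold to a Kähler manifold -/

namespace KahlerTarget

variable {m : ℕ} {M : Type*} [TopologicalSpace M] [ChartedSpace (CSpace m) M]
  [IsManifold 𝓘(ℂ, CSpace m) ω M]
  {n : ℕ} {N : Type*} [TopologicalSpace N] [ChartedSpace (CSpace n) N]
  [IsManifold 𝓘(ℂ, CSpace n) ω N]

/-- The Christoffel symbols `Γ^i_{jk} = g^{il̄} ∂g_{kl̄}/∂w^j` at `b` of the Chern connection
(which is the complexified Levi-Civita connection if `g` is Kähler), in the holomorphic chart
centred at `b`. -/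
def christoffel (g : RiemMetric (CSpace n) N) (b : N) (i j k : Fin n) : ℂ :=
  ∑ l, raise (hermMatrix g b (extChartAt 𝓘(ℝ, CSpace n) b b)) i l *
    dz j (fun y => hermMatrix g b y k l) (extChartAt 𝓘(ℝ, CSpace n) b b)

/-- The local expression of `f` at `p` in the holomorphic charts centred at `p` and `f p`. -/
def localData (h : RiemMetric (CSpace m) M) (g : RiemMetric (CSpace n) N) (f : M → N) (p : M) :
    LocalData m n where
  pt := extChartAt 𝓘(ℝ, CSpace m) p p
  h := hermMatrix h p (extChartAt 𝓘(ℝ, CSpace m) p p)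
  f i x := writtenInExtChartAt 𝓘(ℝ, CSpace m) 𝓘(ℝ, CSpace n) p f x i
  g := hermMatrix g (f p) (extChartAt 𝓘(ℝ, CSpace n) (f p) (f p))
  Γ := christoffel g (f p)

/-- `f` satisfies the Hermitian harmonic map equation. -/
def IsHermitianHarmonic (h : RiemMetric (CSpace m) M) (g : RiemMetric (CSpace n) N)
    (f : M → N) : Prop :=
  ∀ p, (localData h g f p).HermitianHarmonicEq

variable [CompactSpace M] [T2Space M] [MeasurableSpace M]

/-- The `∂̄`-energy `E''(f) = ∫ |∂̄f|² ω_h^m / m!`. -/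
def dbarEnergy (h : RiemMetric (CSpace m) M) (g : RiemMetric (CSpace n) N) (f : M → N) : ℝ :=
  ∫ p, (localData h g f p).dbarNormSq ∂(volumeMeasure h)

/-- The `∂`-energy `E'(f) = ∫ |∂f|² ω_h^m / m!`. -/
def delEnergy (h : RiemMetric (CSpace m) M) (g : RiemMetric (CSpace n) N) (f : M → N) : ℝ :=
  ∫ p, (localData h g f p).delNormSq ∂(volumeMeasure h)

/-- The total energy `E(f) = ∫ |df|² ω_h^m / m!`, where `df = ∂̄f + ∂f` and
`|df|² = |∂̄f|² + |∂f|²`. -/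
def energy (h : RiemMetric (CSpace m) M) (g : RiemMetric (CSpace n) N) (f : M → N) : ℝ :=
  ∫ p, ((localData h g f p).dbarNormSq + (localData h g f p).delNormSq) ∂(volumeMeasure h)

/-- `∂̄`-harmonic: critical point of the `∂̄`-energy. -/
def IsDbarHarmonic (h : RiemMetric (CSpace m) M) (g : RiemMetric (CSpace n) N)
    (f : M → N) : Prop :=
  IsCritical (W := CSpace m) (V := CSpace n) (dbarEnergy h g) f

/-- `∂`-harmonic: critical point of the `∂`-energy. -/
def IsDelHarmonic (h : RiemMetric (CSpace m) M) (g : RiemMetric (CSpace n) N)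
    (f : M → N) : Prop :=
  IsCritical (W := CSpace m) (V := CSpace n) (delEnergy h g) f

/-- Harmonic: critical point of the total energy. -/
def IsHarmonic (h : RiemMetric (CSpace m) M) (g : RiemMetric (CSpace n) N)
    (f : M → N) : Prop :=
  IsCritical (W := CSpace m) (V := CSpace n) (energy h g) f

/-- The components in the local frame of a section of `f^*(T^{1,0}N)`, the bundle `T^{1,0}N`
being identified with `TN`, with the complex structure `J`. -/
def secComp (f : M → N) (X : ∀ p : M, TangentSpace 𝓘(ℝ, CSpace n) (f p)) (p : M)
    (i : Fin n) (x : CSpace m) : ℂ :=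
  secLoc f X p x i

/-- `∂̄_E^* ∂̄f = 0`, i.e. `(∂̄_E s, ∂̄f) = (s, ∂̄_E^* ∂̄f) = 0` for all smooth sections `s`
of `E = f^*(T^{1,0}N)`. -/
def DbarEulerLagrange (h : RiemMetric (CSpace m) M) (g : RiemMetric (CSpace n) N)
    (f : M → N) : Prop :=
  ∀ X : ∀ p : M, TangentSpace 𝓘(ℝ, CSpace n) (f p), IsSmoothAlong (W := CSpace m) f X →
    ∫ p, (localData h g f p).dbarPair (secComp f X p) ∂(volumeMeasure h) = 0

/-- `∂_E^* ∂f = 0`, i.e. `(∂_E s, ∂f) = 0` for all smooth sections `s` of `E`. -/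
def DelEulerLagrange (h : RiemMetric (CSpace m) M) (g : RiemMetric (CSpace n) N)
    (f : M → N) : Prop :=
  ∀ X : ∀ p : M, TangentSpace 𝓘(ℝ, CSpace n) (f p), IsSmoothAlong (W := CSpace m) f X →
    ∫ p, (localData h g f p).delPair (secComp f X p) ∂(volumeMeasure h) = 0

/-- `∂̄_E^* ∂̄f + ∂_E^* ∂f = 0`, i.e. `(∂̄_E s, ∂̄f) + (∂_E s, ∂f) = 0` for all smooth sections
`s` of `E`. -/
def EulerLagrange (h : RiemMetric (CSpace m) M) (g : RiemMetric (CSpace n) N)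
    (f : M → N) : Prop :=
  ∀ X : ∀ p : M, TangentSpace 𝓘(ℝ, CSpace n) (f p), IsSmoothAlong (W := CSpace m) f X →
    ∫ p, ((localData h g f p).dbarPair (secComp f X p) +
      (localData h g f p).delPair (secComp f X p)) ∂(volumeMeasure h) = 0

end KahlerTarget

/-! ### Maps from a Hermitian manifold to a Riemannian manifold -/

namespace RiemannianTarget

variable {m : ℕ} {M : Type*} [TopologicalSpace M] [ChartedSpace (CSpace m) M]
  [IsManifold 𝓘(ℂ, CSpace m) ω M]
  {n : ℕ} {N : Type*} [TopologicalSpace N] [ChartedSpace (RSpace n) N]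
  [IsManifold 𝓘(ℝ, RSpace n) ∞ N]

/-- The matrix `g_{ij}` in the chart centred at `b`, at the point with coordinates `y`. -/
def metricMatrix (g : RiemMetric (RSpace n) N) (b : N) (y : RSpace n) :
    Matrix (Fin n) (Fin n) ℝ :=
  Matrix.of fun i j => g.inner _ (coordVec b y (rBasis i)) (coordVec b y (rBasis j))

/-- The Christoffel symbols `Γ^i_{jk} = ½ g^{il} (∂_j g_{kl} + ∂_k g_{jl} - ∂_l g_{jk})` at `b` of
the Levi-Civita connection, in the chart centred at `b`. -/
def christoffel (g : RiemMetric (RSpace n) N) (b : N) (i j k : Fin n) : ℝ :=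
  let y₀ := extChartAt 𝓘(ℝ, RSpace n) b b
  (1 / 2) * ∑ l, (metricMatrix g b y₀)⁻¹ i l *
    (fderiv ℝ (fun y => metricMatrix g b y k l) y₀ (rBasis j)
      + fderiv ℝ (fun y => metricMatrix g b y j l) y₀ (rBasis k)
      - fderiv ℝ (fun y => metricMatrix g b y j k) y₀ (rBasis l))

/-- The local expression of `f` at `p` in the charts centred at `p` and `f p`. -/
def localData (h : RiemMetric (CSpace m) M) (g : RiemMetric (RSpace n) N) (f : M → N) (p : M) :
    LocalData m n where
  pt := extChartAt 𝓘(ℝ, CSpace m) p p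
  h := hermMatrix h p (extChartAt 𝓘(ℝ, CSpace m) p p)
  f i x := (writtenInExtChartAt 𝓘(ℝ, CSpace m) 𝓘(ℝ, RSpace n) p f x i : ℝ)
  g := (metricMatrix g (f p) (extChartAt 𝓘(ℝ, RSpace n) (f p) (f p))).map Complex.ofReal
  Γ i j k := (christoffel g (f p) i j k : ℝ)

/-- `f` satisfies the Hermitian harmonic map equation. -/
def IsHermitianHarmonic (h : RiemMetric (CSpace m) M) (g : RiemMetric (RSpace n) N)
    (f : M → N) : Prop :=
  ∀ p, (localData h g f p).HermitianHarmonicEq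

variable [CompactSpace M] [T2Space M] [MeasurableSpace M]

/-- The `∂̄`-energy `E''(f) = ∫ |∂̄f|² ω_h^m / m!`. -/
def dbarEnergy (h : RiemMetric (CSpace m) M) (g : RiemMetric (RSpace n) N) (f : M → N) : ℝ :=
  ∫ p, (localData h g f p).dbarNormSq ∂(volumeMeasure h)

/-- The `∂`-energy `E'(f) = ∫ |∂f|² ω_h^m / m!`. -/
def delEnergy (h : RiemMetric (CSpace m) M) (g : RiemMetric (RSpace n) N) (f : M → N) : ℝ :=
  ∫ p, (localData h g f p).delNormSq ∂(volumeMeasure h)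

/-- The total energy `E(f) = ∫ |df|² ω_h^m / m!`, where `df = ∂̄f + ∂f` and
`|df|² = |∂̄f|² + |∂f|²`. -/
def energy (h : RiemMetric (CSpace m) M) (g : RiemMetric (RSpace n) N) (f : M → N) : ℝ :=
  ∫ p, ((localData h g f p).dbarNormSq + (localData h g f p).delNormSq) ∂(volumeMeasure h)

/-- `∂̄`-harmonic: critical point of the `∂̄`-energy. -/
def IsDbarHarmonic (h : RiemMetric (CSpace m) M) (g : RiemMetric (RSpace n) N)
    (f : M → N) : Prop :=
  IsCritical (W := CSpace m) (V := RSpace n) (dbarEnergy h g) f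

/-- `∂`-harmonic: critical point of the `∂`-energy. -/
def IsDelHarmonic (h : RiemMetric (CSpace m) M) (g : RiemMetric (RSpace n) N)
    (f : M → N) : Prop :=
  IsCritical (W := CSpace m) (V := RSpace n) (delEnergy h g) f

/-- Harmonic: critical point of the total energy. -/
def IsHarmonic (h : RiemMetric (CSpace m) M) (g : RiemMetric (RSpace n) N)
    (f : M → N) : Prop :=
  IsCritical (W := CSpace m) (V := RSpace n) (energy h g) f

/-- The components in the local frame of the section `X + √-1 Y` of the complexification of
`f^*(TN)`. -/
def secComp (f : M → N) (X Y : ∀ p : M, TangentSpace 𝓘(ℝ, RSpace n) (f p)) (p : M)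
    (i : Fin n) (x : CSpace m) : ℂ :=
  (secLoc f X p x i : ℂ) + Complex.I * (secLoc f Y p x i : ℂ)

/-- `∂̄_E^* ∂̄f = 0`, i.e. `(∂̄_E s, ∂̄f) = (s, ∂̄_E^* ∂̄f) = 0` for all smooth sections
`s = X + √-1 Y` of the complexification of `E = f^*(TN)`. -/
def DbarEulerLagrange (h : RiemMetric (CSpace m) M) (g : RiemMetric (RSpace n) N)
    (f : M → N) : Prop :=
  ∀ X Y : ∀ p : M, TangentSpace 𝓘(ℝ, RSpace n) (f p),
    IsSmoothAlong (W := CSpace m) f X → IsSmoothAlong (W := CSpace m) f Y →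
    ∫ p, (localData h g f p).dbarPair (secComp f X Y p) ∂(volumeMeasure h) = 0

/-- `∂_E^* ∂f = 0`, i.e. `(∂_E s, ∂f) = 0` for all smooth complex sections `s` of `E`. -/
def DelEulerLagrange (h : RiemMetric (CSpace m) M) (g : RiemMetric (RSpace n) N)
    (f : M → N) : Prop :=
  ∀ X Y : ∀ p : M, TangentSpace 𝓘(ℝ, RSpace n) (f p),
    IsSmoothAlong (W := CSpace m) f X → IsSmoothAlong (W := CSpace m) f Y →
    ∫ p, (localData h g f p).delPair (secComp f X Y p) ∂(volumeMeasure h) = 0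

/-- `∂̄_E^* ∂̄f + ∂_E^* ∂f = 0`, i.e. `(∂̄_E s, ∂̄f) + (∂_E s, ∂f) = 0` for all smooth complex
sections `s` of `E`. -/
def EulerLagrange (h : RiemMetric (CSpace m) M) (g : RiemMetric (RSpace n) N)
    (f : M → N) : Prop :=
  ∀ X Y : ∀ p : M, TangentSpace 𝓘(ℝ, RSpace n) (f p),
    IsSmoothAlong (W := CSpace m) f X → IsSmoothAlong (W := CSpace m) f Y →
    ∫ p, ((localData h g f p).dbarPair (secComp f X Y p) +
      (localData h g f p).delPair (secComp f X Y p)) ∂(volumeMeasure h) = 0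

end RiemannianTarget

end

end HarmonicMaps

set_option linter.unusedSectionVars false

/-! Let `X` be a smooth section of `E` along `f`. The inner products of `X` with the differential
form a complex one-form ζ(w) = ⟨X, df(w)⟩ on `M` (`zeta`). A metric connection gives u(ζ(w)) = ⟨∇_u
X, df(w)⟩ + ⟨X, ∇df(u, w)⟩, in coordinates with constant u and w, and contracting the (1,1)-part
with h gives a pointwise integration by parts (`divForm_zeta`): div_ε ζ = ⟨∇^ε X, d^ε f⟩ + ⟨X, τ⟩.
The sign ε = 1 selects the ∂̄-part and ε = -1 the ∂-part, and τ is minus the left side of equation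
(d). The point is that τ is the same for both signs: it is a trace of the Hessian ∇df, which is
symmetric because the connection of the target is torsion-free. For a complex target this is where
the Kähler condition enters (`IsKahler.christoffel_symm`).

For a real one-form η the divergence is -¼(⟨d(η∘J), ω_h⟩ + εi⟨dη, ω_h⟩) (`divForm_eq`). So a
balanced metric is exactly what makes both divergences integrate to zero (`integral_divForm`), and
the integrals of ⟨∂̄_E X, ∂̄f⟩ and of ⟨∂_E X, ∂f⟩ both equal minus the integral of ⟨X, τ⟩.

For a variation F of `f` with variation field X, metric compatibility and ∇_t dF = ∇(∂_t F) give
d/dt |d^ε F|² = 2 Re ⟨∇^ε X, d^ε f⟩ (`deriv_densE`). Hence τ = 0 makes `f` critical for all three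
energies and gives all three weak equations. Conversely, each of these six conditions yields that
the integral of Re ⟨X, τ⟩ vanishes for localized fields X, and a bump field pointing in the
direction of τ(p₀) forces τ(p₀) = 0 (`tension_eq_zero_of_test`). All cases are handled at once with
weights a, b and a + b > 0: the choices (1,0), (0,1), (1,1) give E'', E' and E.

The two kinds of target are instances of one structure `TargetFrame`: components of tangent vectors,
a Hermitian matrix, and Christoffel symbols that are symmetric and compatible with the metric.

A technical theme runs through the argument. Quantities at a point p are defined in the charts
centred at p, and these charts jump with p, so continuity and smoothness are never automatic. They
are recovered by rewriting each quantity as a contraction that does not depend on the complex basis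
(`contr_eq`, `contr_center_eq`) and evaluating it in one fixed chart. -/

namespace HarmonicMaps

noncomputable section

open Set Filter Topology

/-! ### Charts, coordinate vectors and coordinate expressions of maps. -/

section Charts

variable {W V : Type*} [NormedAddCommGroup W] [NormedSpace ℝ W]
  [NormedAddCommGroup V] [NormedSpace ℝ V]
  {M : Type*} [TopologicalSpace M] [ChartedSpace W M]
  {N : Type*} [TopologicalSpace N] [ChartedSpace V N]

/-- The coordinate vectors of the chart centred at `b`, as a linear map on the model space. -/
def coordVecL (b : N) (y : V) : V →L[ℝ] V :=
  mfderiv 𝓘(ℝ, V) 𝓘(ℝ, V) (extChartAt 𝓘(ℝ, V) b).symm y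

/-- The differential of the chart centred at `b`, as a linear map on the model space. -/
def chartDeriv (b : N) (q : N) : V →L[ℝ] V :=
  mfderiv 𝓘(ℝ, V) 𝓘(ℝ, V) (extChartAt 𝓘(ℝ, V) b) q

/-- The differential of a map, as a linear map between the model spaces. -/
def mapDeriv (f : M → N) (q : M) : W →L[ℝ] V :=
  mfderiv 𝓘(ℝ, W) 𝓘(ℝ, V) f q

/-- The coordinate expression of a map in the charts centred at `b` and `c`. -/
def locMap (b : M) (c : N) (f : M → N) (y : W) : V :=
  extChartAt 𝓘(ℝ, V) c (f ((extChartAt 𝓘(ℝ, W) b).symm y))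

theorem target_mem_nhds (b : N) {y : V} (hy : y ∈ (extChartAt 𝓘(ℝ, V) b).target) :
    (extChartAt 𝓘(ℝ, V) b).target ∈ 𝓝 y :=
  (isOpen_extChartAt_target b).mem_nhds hy

variable [IsManifold 𝓘(ℝ, W) ∞ M] [IsManifold 𝓘(ℝ, V) ∞ N]

theorem mdifferentiableAt_extChartAt_symm (b : N) {y : V}
    (hy : y ∈ (extChartAt 𝓘(ℝ, V) b).target) :
    MDifferentiableAt 𝓘(ℝ, V) 𝓘(ℝ, V) (extChartAt 𝓘(ℝ, V) b).symm y := by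
  have : IsManifold 𝓘(ℝ, V) 1 N := .of_le (n := ∞) (by simp)
  have := mdifferentiableWithinAt_extChartAt_symm (I := 𝓘(ℝ, V)) (x := b) hy
  rwa [modelWithCornersSelf_coe, range_id, mdifferentiableWithinAt_univ] at this

theorem chartDeriv_coordVecL (b : N) {y : V} (hy : y ∈ (extChartAt 𝓘(ℝ, V) b).target) (w : V) :
    chartDeriv b ((extChartAt 𝓘(ℝ, V) b).symm y) (coordVecL b y w) = w := by
  have : IsManifold 𝓘(ℝ, V) 1 N := .of_le (n := ∞) (by simp)
  have := mfderiv_extChartAt_comp_mfderivWithin_extChartAt_symm (I := 𝓘(ℝ, V)) (x := b) hy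
  simp only [modelWithCornersSelf_coe, range_id, mfderivWithin_univ] at this
  exact congrArg (fun A : V →L[ℝ] V => A w) this

theorem coordVecL_chartDeriv (b : N) {y : V} (hy : y ∈ (extChartAt 𝓘(ℝ, V) b).target) (w : V) :
    coordVecL b y (chartDeriv b ((extChartAt 𝓘(ℝ, V) b).symm y) w) = w := by
  have : IsManifold 𝓘(ℝ, V) 1 N := .of_le (n := ∞) (by simp)
  have := mfderivWithin_extChartAt_symm_comp_mfderiv_extChartAt (I := 𝓘(ℝ, V)) (x := b) hy
  simp only [modelWithCornersSelf_coe, range_id, mfderivWithin_univ] at this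
  exact congrArg (fun A : V →L[ℝ] V => A w) this

theorem coordVecL_chartDeriv' (b : N) {q : N} (hq : q ∈ (extChartAt 𝓘(ℝ, V) b).source) (w : V) :
    coordVecL b (extChartAt 𝓘(ℝ, V) b q) (chartDeriv b q w) = w := by
  have := coordVecL_chartDeriv b ((extChartAt 𝓘(ℝ, V) b).map_source hq) w
  rwa [(extChartAt 𝓘(ℝ, V) b).left_inv hq] at this

theorem chartDeriv_center (b : N) (w : V) : chartDeriv b b w = w := by
  have : IsManifold 𝓘(ℝ, V) 1 N := .of_le (n := ∞) (by simp)
  have := mfderiv_extChartAt_self (I := 𝓘(ℝ, V)) (x := b)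
  exact congrArg (fun A : V →L[ℝ] V => A w) this

/-- The tangent space at `b` is the model space, identified through the chart centred at `b`, so in
that chart the coordinate frame at `b` is the identity. This is what allows tensors at a point to be
compared with their components in the centred chart. -/
theorem coordVecL_center (b : N) (w : V) : coordVecL b (extChartAt 𝓘(ℝ, V) b b) w = w := by
  have := coordVecL_chartDeriv' b (mem_extChartAt_source (I := 𝓘(ℝ, V)) b) w
  rwa [chartDeriv_center] at this

theorem mfderiv_coordVecL (b : M) (c : N) (f : M → N) {y : W}
    (hy : y ∈ (extChartAt 𝓘(ℝ, W) b).target)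
    (hf : MDifferentiableAt 𝓘(ℝ, W) 𝓘(ℝ, V) f ((extChartAt 𝓘(ℝ, W) b).symm y))
    (hc : f ((extChartAt 𝓘(ℝ, W) b).symm y) ∈ (extChartAt 𝓘(ℝ, V) c).source) (u : W) :
    mapDeriv (W := W) (V := V) f ((extChartAt 𝓘(ℝ, W) b).symm y) (coordVecL b y u) =
      coordVecL c (locMap b c f y) (fderiv ℝ (locMap b c f) y u) := by
  have : IsManifold 𝓘(ℝ, V) 1 N := .of_le (n := ∞) (by simp)
  have h1 := mdifferentiableAt_extChartAt_symm b hy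
  have h2 : MDifferentiableAt 𝓘(ℝ, V) 𝓘(ℝ, V) (extChartAt 𝓘(ℝ, V) c)
      (f ((extChartAt 𝓘(ℝ, W) b).symm y)) :=
    mdifferentiableAt_extChartAt (by rwa [extChartAt_source] at hc)
  have h3 : mfderiv 𝓘(ℝ, W) 𝓘(ℝ, V) (locMap b c f) y =
      (mfderiv 𝓘(ℝ, V) 𝓘(ℝ, V) (extChartAt 𝓘(ℝ, V) c) (f ((extChartAt 𝓘(ℝ, W) b).symm y))).comp
      ((mfderiv 𝓘(ℝ, W) 𝓘(ℝ, V) f ((extChartAt 𝓘(ℝ, W) b).symm y)).comp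
        (mfderiv 𝓘(ℝ, W) 𝓘(ℝ, W) (extChartAt 𝓘(ℝ, W) b).symm y)) := by
    have h4 := mfderiv_comp y hf h1
    have h5 := mfderiv_comp y (g := extChartAt 𝓘(ℝ, V) c)
      (f := f ∘ (extChartAt 𝓘(ℝ, W) b).symm) h2 (hf.comp y h1)
    rw [h4] at h5
    exact h5
  rw [mfderiv_eq_fderiv] at h3
  have h6 : fderiv ℝ (locMap b c f) y u = chartDeriv c (f ((extChartAt 𝓘(ℝ, W) b).symm y))
      (mapDeriv (W := W) (V := V) f ((extChartAt 𝓘(ℝ, W) b).symm y) (coordVecL b y u)) :=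
    congrArg (fun A : W →L[ℝ] V => A u) h3
  rw [h6, locMap, coordVecL_chartDeriv' c hc]

/-- Change of coordinates for coordinate vectors. -/
theorem coordVecL_change (b c : N) {y : V} (hy : y ∈ (extChartAt 𝓘(ℝ, V) b).target)
    (hc : (extChartAt 𝓘(ℝ, V) b).symm y ∈ (extChartAt 𝓘(ℝ, V) c).source) (u : V) :
    coordVecL b y u = coordVecL c (locMap b c id y) (fderiv ℝ (locMap b c (id : N → N)) y u) := by
  have := mfderiv_coordVecL b c (id : N → N) hy mdifferentiableAt_id hc u
  rw [mapDeriv, mfderiv_id] at this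
  exact this

/-- The Riemannian metric as a bilinear form on the model space. -/
def metricAt (g : RiemMetric V N) (q : N) : V →L[ℝ] V →L[ℝ] ℝ := g.inner q

theorem metricAt_symm (g : RiemMetric V N) (q : N) (v w : V) :
    metricAt g q v w = metricAt g q w v := g.symm q v w

theorem metricAt_pos (g : RiemMetric V N) (q : N) {v : V} (hv : v ≠ 0) :
    0 < metricAt g q v v := g.pos q v hv

/-- The coordinate vector fields of a chart are smooth. -/
theorem contMDiffOn_coordVec (b : N) (v : V) :
    ContMDiffOn 𝓘(ℝ, V) 𝓘(ℝ, V).tangent ∞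
      (fun y => (⟨(extChartAt 𝓘(ℝ, V) b).symm y, coordVec b y v⟩ : TangentBundle 𝓘(ℝ, V) N))
      (extChartAt 𝓘(ℝ, V) b).target := by
  have hs := contMDiffOn_extChartAt_symm (I := 𝓘(ℝ, V)) (n := ∞) b
  have ho := isOpen_extChartAt_target (I := 𝓘(ℝ, V)) b
  have h1 := hs.contMDiffOn_tangentMapWithin (m := ∞) (by simp) ho.uniqueMDiffOn
  have h2 : ContMDiffOn 𝓘(ℝ, V) 𝓘(ℝ, V).tangent ∞
      (fun y => (⟨y, v⟩ : TangentBundle 𝓘(ℝ, V) V)) (extChartAt 𝓘(ℝ, V) b).target :=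
    contMDiffOn_vectorSpace_iff_contDiffOn.2 contDiffOn_const
  refine (h1.comp h2 (fun y hy => hy)).congr fun y hy => ?_
  simp only [Function.comp, tangentMapWithin, coordVec]
  rw [mfderivWithin_of_isOpen ho hy]

theorem contDiffOn_metricAt (g : RiemMetric V N) (b : N) (v w : V) :
    ContDiffOn ℝ ∞ (fun y => metricAt g ((extChartAt 𝓘(ℝ, V) b).symm y)
      (coordVecL b y v) (coordVecL b y w)) (extChartAt 𝓘(ℝ, V) b).target := by
  have hs := contMDiffOn_extChartAt_symm (I := 𝓘(ℝ, V)) (n := ∞) b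
  have hg := g.contMDiff.comp_contMDiffOn hs
  have := ContMDiffOn.clm_bundle_apply₂ (F₁ := V) (F₂ := V) (F₃ := ℝ)
    (E₃ := Bundle.Trivial N ℝ) hg (contMDiffOn_coordVec b v) (contMDiffOn_coordVec b w)
  intro y hy
  exact ((Bundle.contMDiffWithinAt_totalSpace.1 (this y hy)).2).contDiffWithinAt

end Charts

/-! ### Hermitian linear algebra: contractions that do not depend on the basis. -/

section LinearAlgebra

variable {m : ℕ}

/-- The Hermitian form associated with a real bilinear form. -/
def hermOf (g : CSpace m →L[ℝ] CSpace m →L[ℝ] ℝ) (v w : CSpace m) : ℂ :=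
  (g v w : ℂ) + Complex.I * (g v (Complex.I • w) : ℂ)

/-- The inner products on `ℂ^m` for which multiplication by `√-1` is an isometry. -/
structure IsHermitianInner (g : CSpace m →L[ℝ] CSpace m →L[ℝ] ℝ) : Prop where
  symm : ∀ v w, g v w = g w v
  pos : ∀ v, v ≠ 0 → 0 < g v v
  smul_I : ∀ v w, g (Complex.I • v) (Complex.I • w) = g v w

variable {g : CSpace m →L[ℝ] CSpace m →L[ℝ] ℝ}

theorem I_smul_I_smul (v : CSpace m) : Complex.I • Complex.I • v = -v := by
  rw [smul_smul, Complex.I_mul_I, neg_one_smul]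

theorem complex_smul_eq (c : ℂ) (v : CSpace m) : c • v = c.re • v + c.im • (Complex.I • v) := by
  ext i
  simp only [PiLp.add_apply, PiLp.smul_apply, smul_eq_mul, Complex.real_smul]
  conv_lhs => rw [← Complex.re_add_im c]
  ring

namespace IsHermitianInner

theorem I_left (hg : IsHermitianInner g) (v w : CSpace m) :
    g (Complex.I • v) w = -g v (Complex.I • w) := by
  rw [← hg.smul_I v, I_smul_I_smul, map_neg, neg_neg]

theorem I_self (hg : IsHermitianInner g) (v : CSpace m) : g v (Complex.I • v) = 0 := by
  have := hg.I_left v v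
  rw [hg.symm] at this
  linarith

theorem hermOf_conj (hg : IsHermitianInner g) (v w : CSpace m) :
    (starRingEnd ℂ) (hermOf g v w) = hermOf g w v := by
  simp only [hermOf, map_add, map_mul, Complex.conj_I, Complex.conj_ofReal]
  rw [hg.symm v w, hg.symm v, hg.I_left w v]
  push_cast; ring

theorem hermOf_smul_left (hg : IsHermitianInner g) (c : ℂ) (v w : CSpace m) :
    hermOf g (c • v) w = c * hermOf g v w := by
  rw [complex_smul_eq]
  simp only [hermOf, map_add, map_smul, add_apply, smul_apply, smul_eq_mul, hg.I_left,
    I_smul_I_smul, map_neg]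
  push_cast
  conv_rhs => rw [← Complex.re_add_im c]
  linear_combination -(c.im : ℂ) * (g v (Complex.I • w) : ℂ) * Complex.I_sq

theorem hermOf_add_left (v v' w : CSpace m) :
    hermOf g (v + v') w = hermOf g v w + hermOf g v' w := by
  simp only [hermOf, map_add, add_apply]
  push_cast; ring

theorem hermOf_sum_left (hg : IsHermitianInner g) {ι : Type*} (s : Finset ι) (c : ι → ℂ)
    (x : ι → CSpace m) (w : CSpace m) :
    hermOf g (∑ i ∈ s, c i • x i) w = ∑ i ∈ s, c i * hermOf g (x i) w := by
  classical
  induction s using Finset.induction_on with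
  | empty => simp [hermOf]
  | insert a s ha ih => rw [Finset.sum_insert ha, Finset.sum_insert ha, hermOf_add_left, ih,
      hg.hermOf_smul_left]

theorem hermOf_sum_right (hg : IsHermitianInner g) {ι : Type*} (s : Finset ι) (c : ι → ℂ)
    (x : ι → CSpace m) (w : CSpace m) :
    hermOf g w (∑ i ∈ s, c i • x i) = ∑ i ∈ s, (starRingEnd ℂ) (c i) * hermOf g w (x i) := by
  rw [← hg.hermOf_conj, hg.hermOf_sum_left, map_sum]
  simp only [map_mul, hg.hermOf_conj]

theorem hermOf_self (hg : IsHermitianInner g) (v : CSpace m) :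
    hermOf g v v = (g v v : ℝ) := by
  simp [hermOf, hg.I_self]

/-- The Gram matrix of a complex basis for the Hermitian form. -/
def gram (g : CSpace m →L[ℝ] CSpace m →L[ℝ] ℝ) (x : Fin m → CSpace m) :
    Matrix (Fin m) (Fin m) ℂ :=
  Matrix.of fun α β => hermOf g (x α) (x β)

theorem gram_conj (hg : IsHermitianInner g) (x : Fin m → CSpace m) (α β : Fin m) :
    (starRingEnd ℂ) (gram g x α β) = gram g x β α := hg.hermOf_conj _ _

open scoped ComplexOrder in
theorem gram_posDef (hg : IsHermitianInner g) (x : Module.Basis (Fin m) ℂ (CSpace m)) :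
    (gram g x).PosDef := by
  refine Matrix.PosDef.of_dotProduct_mulVec_pos (Matrix.IsHermitian.ext fun i j => hg.gram_conj x j i)
    fun c hc => ?_
  -- The Gram matrix is linear in its row vector, so the quadratic form of `c` is the squared length
  -- of the combination with conjugated coefficients.
  have h : star c ⬝ᵥ (gram g x).mulVec c =
      hermOf g (∑ i, (starRingEnd ℂ) (c i) • x i) (∑ i, (starRingEnd ℂ) (c i) • x i) := by
    rw [hg.hermOf_sum_left]
    simp only [hg.hermOf_sum_right, dotProduct, Matrix.mulVec, gram, Pi.star_apply,
      Matrix.of_apply, Complex.conj_conj]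
    refine Finset.sum_congr rfl fun i _ => ?_
    refine congrArg₂ _ rfl (Finset.sum_congr rfl fun j _ => mul_comm _ _)
  rw [h, hg.hermOf_self, Complex.zero_lt_real]
  refine hg.pos _ fun h0 => hc ?_
  have := Fintype.linearIndependent_iff.1 x.linearIndependent _ h0
  ext i
  simpa using this i

open scoped ComplexOrder in
theorem gram_det_pos (hg : IsHermitianInner g) (x : Module.Basis (Fin m) ℂ (CSpace m)) :
    0 < (gram g x).det.re := by
  have := (hg.gram_posDef x).det_pos
  exact (Complex.lt_def.1 this).1

theorem isUnit_gram_det (hg : IsHermitianInner g) (x : Module.Basis (Fin m) ℂ (CSpace m)) :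
    IsUnit (gram g x).det := by
  rw [isUnit_iff_ne_zero]
  intro h
  have := hg.gram_det_pos x
  simp [h] at this

/-- A resolution of the identity. The vector of the `hermOf g (x β) w` is the Gram matrix applied to
the conjugated coordinates of `w`; the inverse matrix recovers these coordinates, and pairing them
with `u` rebuilds the form. -/
theorem sum_inv_gram (hg : IsHermitianInner g) (x : Module.Basis (Fin m) ℂ (CSpace m))
    (u w : CSpace m) :
    ∑ α, ∑ β, (gram g x)⁻¹ α β * (hermOf g u (x α) * hermOf g (x β) w) = hermOf g u w := by
  have hu := hg.hermOf_sum_left Finset.univ (x.repr u) x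
  rw [x.sum_repr u] at hu
  have hw := hg.hermOf_sum_right Finset.univ (x.repr w) x
  rw [x.sum_repr w] at hw
  set d : Fin m → ℂ := fun i => (starRingEnd ℂ) (x.repr w i) with hd
  have h1 : ∀ β, hermOf g (x β) w = (gram g x).mulVec d β := fun β => by
    rw [hw]; exact Finset.sum_congr rfl fun j _ => mul_comm _ _
  have h2 : ∀ α, ∑ β, (gram g x)⁻¹ α β * hermOf g (x β) w = d α := fun α => by
    simp only [h1]
    have := Matrix.mulVec_mulVec d (gram g x)⁻¹ (gram g x)
    rw [Matrix.nonsing_inv_mul _ (hg.isUnit_gram_det x), Matrix.one_mulVec] at this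
    exact congrFun this α
  calc _ = ∑ α, hermOf g u (x α) * ∑ β, (gram g x)⁻¹ α β * hermOf g (x β) w := by
        refine Finset.sum_congr rfl fun α _ => ?_
        rw [Finset.mul_sum]
        exact Finset.sum_congr rfl fun β _ => by ring
    _ = hermOf g u w := by
        simp only [h2]
        rw [hw]
        exact Finset.sum_congr rfl fun β _ => mul_comm _ _

end IsHermitianInner

/-- The coefficients of the inner products of forms of type `(0,1)` (`ε = 1`) and of type
`(1,0)` (`ε = -1`). -/
def kmat (ε : ℂ) (H : Matrix (Fin m) (Fin m) ℂ) : Matrix (Fin m) (Fin m) ℂ :=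
  if ε = 1 then H⁻¹ else H⁻¹.transpose

theorem kmat_one (H : Matrix (Fin m) (Fin m) ℂ) : kmat 1 H = H⁻¹ := if_pos rfl

theorem kmat_neg_one (H : Matrix (Fin m) (Fin m) ℂ) : kmat (-1) H = H⁻¹.transpose :=
  if_neg (by norm_num)

/-- The polarization `¼ (B(u, w) + B(Iu, Iw) + ε I (B(Iu, w) - B(u, Iw)))`. -/
def polar (ε : ℂ) (B : CSpace m →ₗ[ℝ] CSpace m →ₗ[ℝ] ℂ) (u w : CSpace m) : ℂ :=
  (1 / 4) * (B u w + B (Complex.I • u) (Complex.I • w)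
    + ε * Complex.I * (B (Complex.I • u) w - B u (Complex.I • w)))

/-- The contraction of a real bilinear form with the metric, in terms of a complex basis. -/
def contr (ε : ℂ) (K : Matrix (Fin m) (Fin m) ℂ) (x : Fin m → CSpace m)
    (B : CSpace m →ₗ[ℝ] CSpace m →ₗ[ℝ] ℂ) : ℂ :=
  ∑ α, ∑ β, K α β * polar ε B (x α) (x β)

/-- The product of two linear forms. -/
def rankOne (g : CSpace m →L[ℝ] CSpace m →L[ℝ] ℝ) (u w : CSpace m) :
    CSpace m →ₗ[ℝ] CSpace m →ₗ[ℝ] ℂ :=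
  LinearMap.mk₂ ℝ (fun a b => ((g u a * g w b : ℝ) : ℂ))
    (fun a a' b => by simp only [map_add]; push_cast; ring)
    (fun c a b => by simp only [map_smul, smul_eq_mul, Complex.real_smul]; push_cast; ring)
    (fun a a' b => by simp only [map_add]; push_cast; ring)
    (fun c a b => by simp only [map_smul, smul_eq_mul, Complex.real_smul]; push_cast; ring)

-- On a product of two linear forms the polarization factors: for `ε = 1` it is ¼ of the Hermitian
-- product of `u` with the first vector times that of the second vector with `w`, and for `ε = -1`
-- the roles are exchanged. The resolution of the identity then sums the products to a value free of
-- the basis.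
open IsHermitianInner in
theorem contr_rankOne (hg : IsHermitianInner g) {ε : ℂ} (hε : ε = 1 ∨ ε = -1)
    (x : Module.Basis (Fin m) ℂ (CSpace m)) (u w : CSpace m) :
    contr ε (kmat ε (gram g x)) x (rankOne g u w) =
      (1 / 4) * ((g u w : ℂ) - ε * Complex.I * (g (Complex.I • u) w : ℂ)) := by
  rcases hε with rfl | rfl
  · have h := hg.sum_inv_gram x u w
    have e : (1 / 4) * hermOf g u w =
        (1 / 4) * ((g u w : ℂ) - 1 * Complex.I * (g (Complex.I • u) w : ℂ)) := by
      rw [hg.I_left, hermOf]; push_cast; ring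
    rw [← e, ← h, kmat_one, contr, Finset.mul_sum]
    refine Finset.sum_congr rfl fun α _ => ?_
    rw [Finset.mul_sum]
    refine Finset.sum_congr rfl fun β _ => ?_
    rw [← hg.hermOf_conj w]
    simp only [polar, rankOne, LinearMap.mk₂_apply, hermOf, map_add, map_mul, Complex.conj_I,
      Complex.conj_ofReal]
    push_cast
    linear_combination (-(1 / 4) * (gram g x)⁻¹ α β * g u (Complex.I • x α) * g w (Complex.I • x β)) *
      (-Complex.I_sq)
  · have h := hg.sum_inv_gram x w u
    have e : (1 / 4) * hermOf g w u =
        (1 / 4) * ((g u w : ℂ) - (-1) * Complex.I * (g (Complex.I • u) w : ℂ)) := by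
      rw [hg.symm (Complex.I • u), hermOf, hg.symm w u]; ring
    rw [← e, ← h, kmat_neg_one, contr, Finset.mul_sum, Finset.sum_comm]
    refine Finset.sum_congr rfl fun α _ => ?_
    rw [Finset.mul_sum]
    refine Finset.sum_congr rfl fun β _ => ?_
    rw [← hg.hermOf_conj u]
    simp only [polar, rankOne, LinearMap.mk₂_apply, hermOf, map_add, map_mul, Complex.conj_I,
      Complex.conj_ofReal, Matrix.transpose_apply]
    push_cast
    linear_combination (-(1 / 4) * (gram g x)⁻¹ α β * g w (Complex.I • x α) * g u (Complex.I • x β)) *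
      (-Complex.I_sq)

theorem sum_comm_four {ι₁ ι₂ ι₃ ι₄ : Type*} [Fintype ι₁] [Fintype ι₂] [Fintype ι₃] [Fintype ι₄]
    (F : ι₁ → ι₂ → ι₃ → ι₄ → ℂ) :
    ∑ a, ∑ b, ∑ c, ∑ d, F a b c d = ∑ c, ∑ d, ∑ a, ∑ b, F a b c d := by
  calc _ = ∑ a, ∑ c, ∑ b, ∑ d, F a b c d := Finset.sum_congr rfl fun _ _ => Finset.sum_comm
    _ = ∑ c, ∑ a, ∑ b, ∑ d, F a b c d := Finset.sum_comm
    _ = ∑ c, ∑ a, ∑ d, ∑ b, F a b c d :=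
      Finset.sum_congr rfl fun _ _ => Finset.sum_congr rfl fun _ _ => Finset.sum_comm
    _ = _ := Finset.sum_congr rfl fun _ _ => Finset.sum_comm

/-- A real frame of `ℂ^m` together with its metrically dual frame. -/
structure IsDualFrame {ι : Type*} [Fintype ι] (g : CSpace m →L[ℝ] CSpace m →L[ℝ] ℝ)
    (e d : ι → CSpace m) : Prop where
  sum_left : ∀ a, ∑ i, g (d i) a • e i = a
  sum_right : ∀ a, ∑ i, g (e i) a • d i = a

open IsHermitianInner in
/-- The contraction does not depend on the complex basis. -/
theorem contr_eq (hg : IsHermitianInner g) {ε : ℂ} (hε : ε = 1 ∨ ε = -1)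
    (x : Module.Basis (Fin m) ℂ (CSpace m)) {ι : Type*} [Fintype ι] {e d : ι → CSpace m}
    (hd : IsDualFrame g e d) (B : CSpace m →ₗ[ℝ] CSpace m →ₗ[ℝ] ℂ) :
    contr ε (kmat ε (gram g x)) x B = ∑ i, ∑ j, B (e i) (e j) *
      ((1 / 4) * ((g (d i) (d j) : ℂ) - ε * Complex.I * (g (Complex.I • d i) (d j) : ℂ))) := by
  -- Every bilinear form is a combination of products of linear forms, by expansion in the real
  -- frame; this reduces the claim to `contr_rankOne`.
  have hB : ∀ a b, B a b = ∑ i, ∑ j, B (e i) (e j) * rankOne g (d i) (d j) a b := by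
    intro a b
    conv_lhs => rw [← hd.sum_left a, ← hd.sum_left b]
    simp only [map_sum, map_smul, LinearMap.sum_apply, LinearMap.smul_apply, rankOne,
      LinearMap.mk₂_apply, Complex.real_smul, Finset.smul_sum, Complex.ofReal_mul]
    rw [Finset.sum_comm]
    refine Finset.sum_congr rfl fun i _ => Finset.sum_congr rfl fun j _ => by
      ring
  have hP : ∀ a b, polar ε B a b =
      ∑ i, ∑ j, B (e i) (e j) * polar ε (rankOne g (d i) (d j)) a b := by
    intro a b
    simp only [polar]
    rw [hB a b, hB (Complex.I • a), hB (Complex.I • a) b, hB a (Complex.I • b)]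
    simp only [← Finset.sum_add_distrib, ← Finset.sum_sub_distrib, Finset.mul_sum]
    refine Finset.sum_congr rfl fun i _ => Finset.sum_congr rfl fun j _ => by ring
  simp only [← contr_rankOne hg hε x, contr, hP, Finset.mul_sum]
  rw [sum_comm_four]
  refine Finset.sum_congr rfl fun i _ => Finset.sum_congr rfl fun j _ =>
    Finset.sum_congr rfl fun α _ => Finset.sum_congr rfl fun β _ => by ring

end LinearAlgebra

/-! ### Holomorphic charts, the metric matrix, and the dual real frame. -/

section

variable {m : ℕ} {M : Type*} [TopologicalSpace M] [ChartedSpace (CSpace m) M]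
  [IsManifold 𝓘(ℂ, CSpace m) ω M]

theorem isHermitianInner_metricAt {h : RiemMetric (CSpace m) M} (hh : IsHermitian h) (q : M) :
    IsHermitianInner (metricAt h q) :=
  ⟨metricAt_symm h q, fun _ => metricAt_pos h q, hh q⟩

theorem differentiableAt_chart_change (b c : M) {y : CSpace m}
    (hy : y ∈ (extChartAt 𝓘(ℝ, CSpace m) b).target)
    (hc : (extChartAt 𝓘(ℝ, CSpace m) b).symm y ∈ (extChartAt 𝓘(ℝ, CSpace m) c).source) :
    DifferentiableAt ℂ (locMap (W := CSpace m) (V := CSpace m) b c (id : M → M)) y := by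
  have h := (contDiffGroupoid ω 𝓘(ℂ, CSpace m)).compatible (chart_mem_atlas (CSpace m) b)
    (chart_mem_atlas (CSpace m) c)
  rw [contDiffGroupoid, mem_groupoid_of_pregroupoid] at h
  have h1 : ContDiffOn ℂ ω ((chartAt (CSpace m) b).symm ≫ₕ chartAt (CSpace m) c)
      ((chartAt (CSpace m) b).symm ≫ₕ chartAt (CSpace m) c).source := by
    simpa [contDiffPregroupoid] using h.1
  have hm : y ∈ ((chartAt (CSpace m) b).symm ≫ₕ chartAt (CSpace m) c).source := by
    simpa using And.intro (by simpa using hy) (by simpa using hc)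
  exact ((h1 y hm).contDiffAt (((chartAt (CSpace m) b).symm ≫ₕ
    chartAt (CSpace m) c).open_source.mem_nhds hm)).differentiableAt (by simp)

/-- Relative to the chart centred at the image point, the coordinate frame of the chart at `b` is
the derivative of a holomorphic transition map, hence complex linear. Coordinate vectors therefore
form a complex basis, and type decompositions agree in all charts. -/
theorem coordVecL_I (b : M) {y : CSpace m} (hy : y ∈ (extChartAt 𝓘(ℝ, CSpace m) b).target)
    (w : CSpace m) : coordVecL b y (Complex.I • w) = Complex.I • coordVecL b y w := by
  set q := (extChartAt 𝓘(ℝ, CSpace m) b).symm y with hq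
  have hc : q ∈ (extChartAt 𝓘(ℝ, CSpace m) q).source := mem_extChartAt_source _
  have hd := differentiableAt_chart_change b q hy hc
  have hr := hd.fderiv_restrictScalars ℝ
  have hl : locMap (W := CSpace m) (V := CSpace m) b q (id : M → M) y = extChartAt 𝓘(ℝ, CSpace m) q q := rfl
  rw [coordVecL_change b q hy hc, coordVecL_change b q hy hc, hl, coordVecL_center,
    coordVecL_center, hr]
  simp

/-- The coordinate vectors of a holomorphic chart, as a complex linear map. -/
def coordVecC (b : M) {y : CSpace m} (hy : y ∈ (extChartAt 𝓘(ℝ, CSpace m) b).target) :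
    CSpace m →ₗ[ℂ] CSpace m where
  toFun := coordVecL b y
  map_add' := map_add _
  map_smul' c w := by
    rw [complex_smul_eq c w, map_add, map_smul, map_smul, coordVecL_I b hy, RingHom.id_apply,
      ← complex_smul_eq]

/-- The standard basis of `ℂ^m`. -/
def stdBasis (m : ℕ) : Module.Basis (Fin m) ℂ (CSpace m) :=
  (EuclideanSpace.basisFun (Fin m) ℂ).toBasis

theorem stdBasis_apply (α : Fin m) : stdBasis m α = cBasis α := by
  simp [stdBasis, cBasis]

/-- The complex basis given by the coordinate vectors of a holomorphic chart. -/
def chartBasis (b : M) {y : CSpace m} (hy : y ∈ (extChartAt 𝓘(ℝ, CSpace m) b).target) :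
    Module.Basis (Fin m) ℂ (CSpace m) :=
  (stdBasis m).map (LinearEquiv.ofInjectiveEndo (coordVecC b hy) (by
    intro v w hvw
    have := congrArg (chartDeriv b ((extChartAt 𝓘(ℝ, CSpace m) b).symm y)) hvw
    simpa only [coordVecC, LinearMap.coe_mk, AddHom.coe_mk, chartDeriv_coordVecL b hy] using this))

theorem chartBasis_apply (b : M) {y : CSpace m}
    (hy : y ∈ (extChartAt 𝓘(ℝ, CSpace m) b).target) (α : Fin m) :
    chartBasis b hy α = coordVecL b y (cBasis α) := by
  simp [chartBasis, stdBasis_apply, coordVecC]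

theorem hermMatrix_eq_gram (h : RiemMetric (CSpace m) M) (b : M) {y : CSpace m}
    (hy : y ∈ (extChartAt 𝓘(ℝ, CSpace m) b).target) :
    hermMatrix h b y =
      IsHermitianInner.gram (metricAt h ((extChartAt 𝓘(ℝ, CSpace m) b).symm y))
        (chartBasis b hy) := by
  ext α β
  simp only [IsHermitianInner.gram, Matrix.of_apply, chartBasis_apply]
  rfl

theorem hermMatrix_center (h : RiemMetric (CSpace m) M) (b : M) :
    hermMatrix h b (extChartAt 𝓘(ℝ, CSpace m) b b) =
      IsHermitianInner.gram (metricAt h b) (stdBasis m) := by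
  rw [hermMatrix_eq_gram h b (mem_extChartAt_target b)]
  ext α β
  simp only [IsHermitianInner.gram, Matrix.of_apply, chartBasis_apply, coordVecL_center,
    stdBasis_apply]
  rw [extChartAt_to_inv]

theorem contDiffOn_hermMatrix (h : RiemMetric (CSpace m) M) (b : M) (α β : Fin m) :
    ContDiffOn ℝ ∞ (fun y => hermMatrix h b y α β) (extChartAt 𝓘(ℝ, CSpace m) b).target := by
  have h1 := contDiffOn_metricAt h b (cBasis α) (cBasis β)
  have h2 := contDiffOn_metricAt h b (cBasis α) (Complex.I • cBasis β)
  have h3 := (Complex.ofRealCLM.contDiff.comp_contDiffOn h1).add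
    (contDiffOn_const (c := Complex.I) |>.mul (Complex.ofRealCLM.contDiff.comp_contDiffOn h2))
  refine h3.congr fun y hy => ?_
  rw [hermMatrix_eq_gram h b hy]
  simp only [IsHermitianInner.gram, Matrix.of_apply, chartBasis_apply, hermOf, ← coordVecL_I b hy]
  rfl

theorem hermMatrix_det_pos {h : RiemMetric (CSpace m) M} (hh : IsHermitian h) (b : M)
    {y : CSpace m} (hy : y ∈ (extChartAt 𝓘(ℝ, CSpace m) b).target) :
    0 < (hermMatrix h b y).det.re := by
  rw [hermMatrix_eq_gram h b hy]
  exact (isHermitianInner_metricAt hh _).gram_det_pos _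

theorem contDiffOn_det {E : Type*} [NormedAddCommGroup E] [NormedSpace ℝ E] {k : ℕ}
    {A : E → Matrix (Fin k) (Fin k) ℂ} {s : Set E}
    (hA : ∀ i j, ContDiffOn ℝ ∞ (fun y => A y i j) s) :
    ContDiffOn ℝ ∞ (fun y => (A y).det) s := by
  simp only [Matrix.det_apply']
  exact ContDiffOn.sum fun σ _ => contDiffOn_const.mul (contDiffOn_prod fun i _ => hA _ _)

/-- Cramer's rule: the entries of the inverse are polynomials in the entries divided by the
determinant. -/
theorem contDiffOn_inv {E : Type*} [NormedAddCommGroup E] [NormedSpace ℝ E] {k : ℕ}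
    {A : E → Matrix (Fin k) (Fin k) ℂ} {s : Set E}
    (hA : ∀ i j, ContDiffOn ℝ ∞ (fun y => A y i j) s) (hd : ∀ y ∈ s, (A y).det ≠ 0)
    (i j : Fin k) :
    ContDiffOn ℝ ∞ (fun y => (A y)⁻¹ i j) s := by
  have h1 : ContDiffOn ℝ ∞ (fun y => (A y).det⁻¹ * (A y).adjugate i j) s := by
    refine ((contDiffOn_det hA).inv hd).mul ?_
    simp only [Matrix.adjugate_apply]
    refine contDiffOn_det fun a b => ?_
    by_cases ha : a = j
    · subst ha; simpa using contDiffOn_const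
    · simpa [Matrix.updateRow_ne ha] using hA a b
  refine h1.congr fun y hy => ?_
  rw [Matrix.inv_def, Ring.inverse_eq_inv']
  rfl

theorem contDiffOn_kmat {h : RiemMetric (CSpace m) M} (hh : IsHermitian h) (b : M) {ε : ℂ}
    (hε : ε = 1 ∨ ε = -1) (α β : Fin m) :
    ContDiffOn ℝ ∞ (fun y => kmat ε (hermMatrix h b y) α β)
      (extChartAt 𝓘(ℝ, CSpace m) b).target := by
  have hd : ∀ y ∈ (extChartAt 𝓘(ℝ, CSpace m) b).target, (hermMatrix h b y).det ≠ 0 := by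
    intro y hy h0
    have := hermMatrix_det_pos hh b hy
    simp [h0] at this
  rcases hε with rfl | rfl
  · simpa only [kmat_one] using contDiffOn_inv (contDiffOn_hermMatrix h b) hd α β
  · simpa only [kmat_neg_one, Matrix.transpose_apply] using contDiffOn_inv (contDiffOn_hermMatrix h b) hd β α

/-- The real frame `∂/∂x^1, …, ∂/∂y^m` as a family of vectors of the model space. -/
def vecFrame : Fin m ⊕ Fin m → CSpace m :=
  Sum.elim cBasis (fun α => Complex.I • cBasis α)

/-- The real frame, dual to `vecFrame` for the metric. -/
def dualFrame (h : RiemMetric (CSpace m) M) (p : M) (i : Fin m ⊕ Fin m) : CSpace m :=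
  ∑ j, (gramMatrix h p)⁻¹ i j • vecFrame j

theorem gramMatrix_apply (h : RiemMetric (CSpace m) M) (p : M) (i j : Fin m ⊕ Fin m) :
    gramMatrix h p i j = metricAt h p (vecFrame i) (vecFrame j) := rfl

theorem sum_vecFrame (a : CSpace m) :
    ∑ i, (Sum.elim (fun α => (a α).re) (fun α => (a α).im) i) •
      vecFrame i = a := by
  simp only [Fintype.sum_sum_type, Sum.elim_inl, Sum.elim_inr, vecFrame, ← Finset.sum_add_distrib]
  have := (stdBasis m).sum_repr a
  conv_rhs => rw [← this]
  refine Finset.sum_congr rfl fun α _ => ?_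
  rw [stdBasis_apply, complex_smul_eq ((stdBasis m).repr a α)]
  simp [stdBasis]

theorem isUnit_gramMatrix_det (h : RiemMetric (CSpace m) M) (p : M) :
    IsUnit (gramMatrix h p).det := by
  rw [isUnit_iff_ne_zero]
  intro h0
  obtain ⟨c, hc, hc0⟩ := Matrix.exists_mulVec_eq_zero_iff.2 h0
  set v : CSpace m := ∑ i, c i • vecFrame i with hv
  -- A kernel vector `c` of the Gram matrix would give a tangent vector of length zero; real
  -- independence of the frame then forces `c` to vanish.
  have h1 : metricAt h p v v = c ⬝ᵥ (gramMatrix h p).mulVec c := by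
    simp only [hv, map_sum, map_smul, sum_apply, smul_apply, smul_eq_mul, dotProduct,
      Matrix.mulVec, gramMatrix_apply, Finset.mul_sum]
    rw [Finset.sum_comm]
    refine Finset.sum_congr rfl fun i _ => Finset.sum_congr rfl fun j _ => ?_
    rw [mul_comm]; ring
  rw [hc0, dotProduct_zero] at h1
  have h2 : v = 0 := by
    by_contra hne
    exact (metricAt_pos h p hne).ne' h1
  refine hc (funext fun i => ?_)
  have h3 : ∀ α, (c (Sum.inl α) : ℂ) + c (Sum.inr α) * Complex.I = 0 := by
    intro α
    have := congrArg (fun w : CSpace m => w α) h2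
    simpa [hv, vecFrame, Fintype.sum_sum_type, cBasis, PiLp.single_apply, Pi.single_apply,
      Finset.sum_ite_eq] using this
  rcases i with α | α
  · simpa using congrArg Complex.re (h3 α)
  · simpa using congrArg Complex.im (h3 α)

theorem inv_gramMatrix_symm (h : RiemMetric (CSpace m) M) (p : M) (i j : Fin m ⊕ Fin m) :
    (gramMatrix h p)⁻¹ i j = (gramMatrix h p)⁻¹ j i := by
  have h1 : (gramMatrix h p).transpose = gramMatrix h p := by
    ext i j; exact metricAt_symm h p _ _
  have := Matrix.transpose_nonsing_inv (gramMatrix h p)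
  rw [h1] at this
  exact congrFun (congrFun this j) i

theorem isDualFrame_dualFrame (h : RiemMetric (CSpace m) M) (p : M) :
    IsDualFrame (metricAt h p) (vecFrame) (dualFrame h p) := by
  have hu := isUnit_gramMatrix_det h p
  have h1 : ∀ i (c : Fin m ⊕ Fin m → ℝ), metricAt h p (dualFrame h p i)
      (∑ j, c j • vecFrame j) = c i := by
    intro i c
    have h2 := congrFun (Matrix.mulVec_mulVec c (gramMatrix h p)⁻¹ (gramMatrix h p)) i
    rw [Matrix.nonsing_inv_mul _ hu, Matrix.one_mulVec] at h2
    rw [← h2]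
    simp only [dualFrame, map_sum, map_smul, sum_apply, smul_apply, smul_eq_mul,
      Matrix.mulVec, dotProduct, gramMatrix_apply, Finset.mul_sum]
    rw [Finset.sum_comm]
    refine Finset.sum_congr rfl fun i _ => Finset.sum_congr rfl fun j _ => by ring
  have hl : ∀ a, ∑ i, metricAt h p (dualFrame h p i) a • vecFrame i = a := by
    intro a
    conv_rhs => rw [← sum_vecFrame a]
    refine Finset.sum_congr rfl fun i _ => ?_
    conv_lhs => rw [← sum_vecFrame a]
    rw [h1]
  refine ⟨hl, fun a => ?_⟩
  conv_rhs => rw [← hl a]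
  simp only [dualFrame, Finset.smul_sum, map_sum, map_smul, sum_apply, smul_apply,
    smul_eq_mul, Finset.sum_smul, smul_smul]
  rw [Finset.sum_comm]
  refine Finset.sum_congr rfl fun i _ => Finset.sum_congr rfl fun j _ => ?_
  rw [inv_gramMatrix_symm h p i j, mul_comm]

/-- The dual frame absorbs the two inverse Gram matrices: raising both indices of ω_h evaluates it
on dual frame vectors. This puts the balanced condition in the form produced by `contr_eq`. -/
theorem twoFormInner_fundForm (h : RiemMetric (CSpace m) M) (p : M)
    (σ : CSpace m → CSpace m → ℝ) :
    twoFormInner h p σ (fundForm h p) =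
      (1 / 2) * ∑ i, ∑ j, σ (realFrame p i) (realFrame p j) *
        metricAt h p (Complex.I • dualFrame h p i) (dualFrame h p j) := by
  unfold twoFormInner
  congr 1
  refine Finset.sum_congr rfl fun i _ => Finset.sum_congr rfl fun j _ => ?_
  simp only [dualFrame, Finset.smul_sum, map_sum, sum_apply, map_smul, smul_apply, smul_eq_mul,
    Finset.mul_sum, smul_comm Complex.I]
  rw [Finset.sum_comm]
  refine Finset.sum_congr rfl fun k _ => Finset.sum_congr rfl fun l _ => ?_
  have : fundForm h p (realFrame p l) (realFrame p k) =
    metricAt h p (Complex.I • vecFrame l) (vecFrame k) := rfl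
  rw [this]
  ring

end

/-! ### The volume measure is finite and charges every nonempty open set. -/

section

variable {m : ℕ} {M : Type*} [TopologicalSpace M] [ChartedSpace (CSpace m) M]
  [IsManifold 𝓘(ℂ, CSpace m) ω M] [CompactSpace M] [T2Space M]

theorem partitionOfUnity_subordinate (b : M) :
    tsupport (partitionOfUnity m M b) ⊆ (chartAt (CSpace m) b).source :=
  Classical.choose_spec
    (SmoothPartitionOfUnity.exists_isSubordinate_chartAt_source 𝓘(ℝ, CSpace m) M) b

theorem finite_support_partitionOfUnity :
    {b : M | (Function.support (partitionOfUnity m M b)).Nonempty}.Finite :=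
  (partitionOfUnity m M).locallyFinite.finite_nonempty_of_compact

/-- The density, in the chart centred at `b`, of the part of the volume measure carried by this
chart. -/
def volDensity (h : RiemMetric (CSpace m) M) (b : M) (y : CSpace m) : ℝ :=
  partitionOfUnity m M b ((extChartAt 𝓘(ℝ, CSpace m) b).symm y) * (hermMatrix h b y).det.re

theorem continuousOn_volDensity (h : RiemMetric (CSpace m) M) (b : M) :
    ContinuousOn (volDensity h b) (extChartAt 𝓘(ℝ, CSpace m) b).target := by
  refine ContinuousOn.mul ?_ ?_
  · exact (partitionOfUnity m M b).contMDiff.continuous.comp_continuousOn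
      (continuousOn_extChartAt_symm b)
  · exact Complex.continuous_re.comp_continuousOn
      (contDiffOn_det (contDiffOn_hermMatrix h b)).continuousOn

/-- The part of the volume measure carried by the chart centred at `b`. -/
def volPiece (h : RiemMetric (CSpace m) M) (b : M) : Measure (CSpace m) :=
  (volume.restrict (extChartAt 𝓘(ℝ, CSpace m) b).target).withDensity fun y =>
      ENNReal.ofReal (volDensity h b y)

theorem volPiece_eq_zero (h : RiemMetric (CSpace m) M) {b : M}
    (hb : ¬ (Function.support (partitionOfUnity m M b)).Nonempty) : volPiece h b = 0 := by
  have h0 : ∀ p, partitionOfUnity m M b p = 0 := by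
    intro p
    by_contra hp
    exact hb ⟨p, hp⟩
  simp [volPiece, volDensity, h0]

/-- The density is bounded on the compact image of the support of the partition function, and
vanishes on the rest of the chart. -/
theorem volPiece_lt_top (h : RiemMetric (CSpace m) M) (b : M) : volPiece h b univ < ⊤ := by
  set φ := extChartAt 𝓘(ℝ, CSpace m) b with hφ
  set K := φ '' tsupport (partitionOfUnity m M b) with hK
  have hsub : tsupport (partitionOfUnity m M b) ⊆ φ.source := by
    rw [hφ, extChartAt_source]; exact partitionOfUnity_subordinate b
  have hKc : IsCompact K :=
    (isClosed_tsupport _).isCompact.image_of_continuousOn ((continuousOn_extChartAt b).mono hsub)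
  have hKt : K ⊆ φ.target := by
    rintro _ ⟨p, hp, rfl⟩
    exact φ.map_source (hsub hp)
  obtain ⟨C, hC⟩ := hKc.exists_bound_of_continuousOn ((continuousOn_volDensity h b).mono hKt)
  have hle : ∀ y ∈ φ.target, ENNReal.ofReal (volDensity h b y) ≤
      K.indicator (fun _ => ENNReal.ofReal C) y := by
    intro y hy
    by_cases hyK : y ∈ K
    · rw [indicator_of_mem hyK]
      exact ENNReal.ofReal_le_ofReal ((le_abs_self _).trans (hC y hyK))
    · have : partitionOfUnity m M b (φ.symm y) = 0 := by
        by_contra hne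
        exact hyK ⟨φ.symm y, subset_tsupport _ hne, φ.right_inv hy⟩
      simp only [volDensity]
      rw [this, zero_mul, ENNReal.ofReal_zero]
      exact zero_le
  rw [volPiece, withDensity_apply _ MeasurableSet.univ, Measure.restrict_univ]
  calc _ ≤ ∫⁻ y in φ.target, K.indicator (fun _ => ENNReal.ofReal C) y :=
        setLIntegral_mono' (isOpen_extChartAt_target b).measurableSet hle
    _ ≤ ∫⁻ y, K.indicator (fun _ => ENNReal.ofReal C) y := setLIntegral_le_lintegral _ _
    _ = ENNReal.ofReal C * volume K := lintegral_indicator_const hKc.measurableSet _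
    _ < ⊤ := ENNReal.mul_lt_top ENNReal.ofReal_lt_top hKc.measure_lt_top

variable [MeasurableSpace M]

theorem volumeMeasure_eq (h : RiemMetric (CSpace m) M) :
    volumeMeasure h = Measure.sum fun b : M =>
      (volPiece h b).map (extChartAt 𝓘(ℝ, CSpace m) b).symm := rfl

instance isFiniteMeasure_volumeMeasure (h : RiemMetric (CSpace m) M) :
    IsFiniteMeasure (volumeMeasure h) := by
  refine ⟨?_⟩
  rw [volumeMeasure_eq, Measure.sum_apply _ MeasurableSet.univ,
    tsum_eq_sum (s := (finite_support_partitionOfUnity (m := m) (M := M)).toFinset)]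
  · refine ENNReal.sum_lt_top.2 fun b _ => ?_
    by_cases hm : AEMeasurable (extChartAt 𝓘(ℝ, CSpace m) b).symm (volPiece h b)
    · rw [Measure.map_apply_of_aemeasurable hm MeasurableSet.univ, preimage_univ]
      exact volPiece_lt_top h b
    · rw [Measure.map_of_not_aemeasurable hm]
      simp
  · intro b hb
    rw [volPiece_eq_zero h (by simpa using hb)]
    simp

variable [BorelSpace M]

/-- At any point some partition function is positive. The corresponding piece has a positive density
near that point, since the determinant of a Hermitian metric is positive. This is what turns
vanishing integrals into vanishing functions. -/
theorem isOpenPosMeasure_volumeMeasure {h : RiemMetric (CSpace m) M} (hh : IsHermitian h) :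
    (volumeMeasure h).IsOpenPosMeasure := by
  refine ⟨fun U hU ⟨p, hp⟩ h0 => ?_⟩
  obtain ⟨b, hb⟩ : ∃ b, 0 < partitionOfUnity m M b p :=
    (partitionOfUnity m M).exists_pos_of_mem (mem_univ p)
  set φ := extChartAt 𝓘(ℝ, CSpace m) b with hφ
  have hps : p ∈ φ.source := by
    rw [hφ, extChartAt_source]
    exact partitionOfUnity_subordinate b (subset_tsupport _ hb.ne')
  have hcs : ContinuousOn φ.symm φ.target := continuousOn_extChartAt_symm b
  have hto : IsOpen φ.target := isOpen_extChartAt_target b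
  set A := U ∩ {q | 0 < partitionOfUnity m M b q} with hA
  have hAo : IsOpen A := hU.inter
    (isOpen_lt continuous_const (partitionOfUnity m M b).contMDiff.continuous)
  set O := φ.target ∩ φ.symm ⁻¹' A with hO
  have hOo : IsOpen O := hcs.isOpen_inter_preimage hto hAo
  have hOne : O.Nonempty := ⟨φ p, φ.map_source hps, by
    rw [mem_preimage, φ.left_inv hps]; exact ⟨hp, hb⟩⟩
  have hpos : 0 < volume O := hOo.measure_pos volume hOne
  have hmeas : AEMeasurable φ.symm (volPiece h b) :=
    (hcs.aemeasurable hto.measurableSet).mono_ac (withDensity_absolutelyContinuous _ _)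
  rw [volumeMeasure_eq, Measure.sum_apply _ hU.measurableSet, ENNReal.tsum_eq_zero] at h0
  have h1 := h0 b
  rw [Measure.map_apply_of_aemeasurable hmeas hU.measurableSet] at h1
  have hd : AEMeasurable (fun y => ENNReal.ofReal (volDensity h b y))
      (volume.restrict φ.target) :=
    ((continuousOn_volDensity h b).aemeasurable hto.measurableSet).ennreal_ofReal
  rw [volPiece, withDensity_apply_eq_zero' hd, Measure.restrict_apply' hto.measurableSet] at h1
  refine hpos.ne' (measure_mono_null ?_ h1)
  rintro y ⟨hyt, hyA⟩
  refine ⟨⟨?_, hyA.1⟩, hyt⟩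
  have : 0 < volDensity h b y := mul_pos hyA.2 (hermMatrix_det_pos hh b hyt)
  simpa using this

theorem integrable_of_continuous {E : Type*} [NormedAddCommGroup E]
    (h : RiemMetric (CSpace m) M) {f : M → E} (hf : Continuous f)
    [SecondCountableTopologyEither M E] :
    Integrable f (volumeMeasure h) :=
  hf.integrable_of_hasCompactSupport (HasCompactSupport.of_compactSpace f)

/-- A continuous nonnegative function whose integral vanishes is zero. -/
theorem eq_zero_of_integral_eq_zero {h : RiemMetric (CSpace m) M} (hh : IsHermitian h)
    {f : M → ℝ} (hf : Continuous f) (h0 : ∀ p, 0 ≤ f p) (hi : ∫ p, f p ∂(volumeMeasure h) = 0)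
    (p : M) : f p = 0 := by
  have := isOpenPosMeasure_volumeMeasure hh
  by_contra hp
  have := hf.integral_pos_of_hasCompactSupport_nonneg_nonzero (μ := volumeMeasure h)
    (HasCompactSupport.of_compactSpace f) h0 hp
  linarith

end

/-! ### One-forms, exterior derivatives and divergences. -/

section

theorem two_le_infty : (2 : WithTop ℕ∞) ≤ ∞ := by
  norm_cast

variable {m : ℕ} {M : Type*} [TopologicalSpace M] [ChartedSpace (CSpace m) M]
  [IsManifold 𝓘(ℂ, CSpace m) ω M]

/-- The value of a `1`-form at a point, as a linear form on the model space. -/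
def covAt (η : ∀ p : M, TangentSpace 𝓘(ℝ, CSpace m) p →L[ℝ] ℝ) (q : M) : CSpace m →L[ℝ] ℝ :=
  η q

/-- The components of a real `1`-form in the chart centred at `b`. -/
def formLoc (η : ∀ p : M, TangentSpace 𝓘(ℝ, CSpace m) p →L[ℝ] ℝ) (b : M) (y : CSpace m) :
    CSpace m →L[ℝ] ℝ :=
  (covAt η ((extChartAt 𝓘(ℝ, CSpace m) b).symm y)).comp (coordVecL b y)

theorem isSmoothOneForm_of_formLoc (η : ∀ p : M, TangentSpace 𝓘(ℝ, CSpace m) p →L[ℝ] ℝ)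
    (hη : ∀ b, ∃ U ∈ 𝓝 (extChartAt 𝓘(ℝ, CSpace m) b b), ∀ w,
      ContDiffOn ℝ ∞ (fun y => formLoc η b y w) U) :
    IsSmoothOneForm η := by
  intro b
  rw [contMDiffAt_hom_bundle]
  refine ⟨contMDiffAt_id, ?_⟩
  have h1 : ContDiffAt ℝ ∞ (formLoc η b) (extChartAt 𝓘(ℝ, CSpace m) b b) := by
    obtain ⟨U, hU, h⟩ := hη b
    exact (contDiffOn_clm_apply.2 h).contDiffAt hU
  have h2 : ContMDiffAt 𝓘(ℝ, CSpace m) 𝓘(ℝ, CSpace m →L[ℝ] ℝ) ∞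
      (fun q => formLoc η b (extChartAt 𝓘(ℝ, CSpace m) b q)) b :=
    h1.contMDiffAt.comp b (contMDiffAt_extChartAt (I := 𝓘(ℝ, CSpace m)) (n := ∞))
  refine h2.congr_of_eventuallyEq ?_
  filter_upwards [extChartAt_source_mem_nhds (I := 𝓘(ℝ, CSpace m)) b] with q hq
  have hq' : q ∈ (chartAt (CSpace m) b).source := by rwa [extChartAt_source] at hq
  have : IsManifold 𝓘(ℝ, CSpace m) 1 M := .of_le (n := ∞) (by simp)
  ext w
  simp only [ContinuousLinearMap.inCoordinates, ContinuousLinearMap.comp_apply]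
  rw [TangentBundle.symmL_trivializationAt hq']
  rw [modelWithCornersSelf_coe, range_id, mfderivWithin_univ]
  have h3 := Bundle.Trivial.continuousLinearMapAt_trivialization ℝ M ℝ q
  simp only [formLoc, ContinuousLinearMap.comp_apply]
  rw [(extChartAt 𝓘(ℝ, CSpace m) b).left_inv hq]
  exact congrArg (fun A : ℝ →L[ℝ] ℝ => A (covAt η q (coordVecL b (extChartAt 𝓘(ℝ, CSpace m) b q) w)))
    h3

theorem IsSmoothOneForm.contDiffOn_formLoc
    {η : ∀ p : M, TangentSpace 𝓘(ℝ, CSpace m) p →L[ℝ] ℝ} (hη : IsSmoothOneForm η) (b : M) :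
    ContDiffOn ℝ ∞ (formLoc η b) (extChartAt 𝓘(ℝ, CSpace m) b).target := by
  refine contDiffOn_clm_apply.2 fun w => ?_
  have hs := contMDiffOn_extChartAt_symm (I := 𝓘(ℝ, CSpace m)) (n := ∞) b
  have hg := ContMDiff.comp_contMDiffOn hη hs
  have := ContMDiffOn.clm_bundle_apply (F₁ := CSpace m) (F₂ := ℝ)
    (E₂ := Bundle.Trivial M ℝ) hg (contMDiffOn_coordVec b w)
  intro y hy
  exact ((Bundle.contMDiffWithinAt_totalSpace.1 (this y hy)).2).contDiffWithinAt

theorem IsSmoothOneForm.contDiffAt_formLoc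
    {η : ∀ p : M, TangentSpace 𝓘(ℝ, CSpace m) p →L[ℝ] ℝ} (hη : IsSmoothOneForm η) (b : M)
    {y : CSpace m} (hy : y ∈ (extChartAt 𝓘(ℝ, CSpace m) b).target) :
    ContDiffAt ℝ ∞ (formLoc η b) y :=
  (hη.contDiffOn_formLoc b).contDiffAt (target_mem_nhds b hy)

/-- The derivatives of the components of a `1`-form, in the chart centred at `b`. -/
def formDeriv (η : ∀ p : M, TangentSpace 𝓘(ℝ, CSpace m) p →L[ℝ] ℝ) (b : M) (y : CSpace m) :
    CSpace m →L[ℝ] CSpace m →L[ℝ] ℝ :=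
  fderiv ℝ (formLoc η b) y

theorem IsSmoothOneForm.fderiv_formLoc
    {η : ∀ p : M, TangentSpace 𝓘(ℝ, CSpace m) p →L[ℝ] ℝ} (hη : IsSmoothOneForm η) (b : M)
    {y : CSpace m} (hy : y ∈ (extChartAt 𝓘(ℝ, CSpace m) b).target) (u w : CSpace m) :
    fderiv ℝ (fun y => formLoc η b y w) y u = formDeriv η b y u w := by
  have hd : DifferentiableAt ℝ (formLoc η b) y :=
    (hη.contDiffAt_formLoc b hy).differentiableAt (by simp)
  rw [fderiv_clm_apply hd (differentiableAt_const w)]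
  simp [formDeriv]

theorem IsSmoothOneForm.extDerivOne_eq
    {η : ∀ p : M, TangentSpace 𝓘(ℝ, CSpace m) p →L[ℝ] ℝ} (hη : IsSmoothOneForm η) (p : M)
    (u w : CSpace m) :
    extDerivOne η p u w = formDeriv η p (extChartAt 𝓘(ℝ, CSpace m) p p) u w -
      formDeriv η p (extChartAt 𝓘(ℝ, CSpace m) p p) w u := by
  rw [← hη.fderiv_formLoc p (mem_extChartAt_target p), ← hη.fderiv_formLoc p (mem_extChartAt_target p)]
  rfl

/-- The exterior derivative of a `1`-form may be computed in any chart. -/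
theorem IsSmoothOneForm.extDerivOne_coordVecL
    {η : ∀ p : M, TangentSpace 𝓘(ℝ, CSpace m) p →L[ℝ] ℝ} (hη : IsSmoothOneForm η) (b : M)
    {y : CSpace m} (hy : y ∈ (extChartAt 𝓘(ℝ, CSpace m) b).target) (u w : CSpace m) :
    extDerivOne η ((extChartAt 𝓘(ℝ, CSpace m) b).symm y) (coordVecL b y u) (coordVecL b y w) =
      formDeriv η b y u w - formDeriv η b y w u := by
  set q := (extChartAt 𝓘(ℝ, CSpace m) b).symm y with hq
  set Ψ : CSpace m → CSpace m := locMap b q (id : M → M) with hΨ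
  have hc : q ∈ (extChartAt 𝓘(ℝ, CSpace m) q).source := mem_extChartAt_source _
  have hΨy : Ψ y = extChartAt 𝓘(ℝ, CSpace m) q q := rfl
  have hcv : ∀ v, coordVecL b y v = fderiv ℝ Ψ y v := by
    intro v
    rw [coordVecL_change b q hy hc]
    exact coordVecL_center q _
  have hΨs : ContDiffAt ℝ ∞ Ψ y := by
    have hm : y ∈ ((extChartAt 𝓘(ℝ, CSpace m) b).symm ≫ extChartAt 𝓘(ℝ, CSpace m) q).source :=
      ⟨hy, hc⟩
    have h1 := contDiffWithinAt_ext_coord_change (I := 𝓘(ℝ, CSpace m)) (n := ∞) q b hm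
    rwa [modelWithCornersSelf_coe, range_id, contDiffWithinAt_univ] at h1
  have hA : DifferentiableAt ℝ (formLoc η q) (Ψ y) :=
    (hη.contDiffAt_formLoc q (mem_extChartAt_target q)).differentiableAt (by simp)
  have hDΨ : DifferentiableAt ℝ (fderiv ℝ Ψ) y :=
    (hΨs.fderiv_right (m := ∞) (by simp)).differentiableAt (by simp)
  have hloc : ∀ᶠ y' in 𝓝 y, formLoc η b y' = (formLoc η q (Ψ y')).comp (fderiv ℝ Ψ y') := by
    have hcont : ContinuousAt (extChartAt 𝓘(ℝ, CSpace m) b).symm y :=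
      (continuousOn_extChartAt_symm b).continuousAt (target_mem_nhds b hy)
    filter_upwards [target_mem_nhds b hy,
      hcont.preimage_mem_nhds (extChartAt_source_mem_nhds (I := 𝓘(ℝ, CSpace m)) q)] with y' hy' hq'
    ext v
    simp only [formLoc, ContinuousLinearMap.comp_apply]
    rw [coordVecL_change b q hy' hq']
    have : (extChartAt 𝓘(ℝ, CSpace m) q).symm (Ψ y') = (extChartAt 𝓘(ℝ, CSpace m) b).symm y' :=
      (extChartAt 𝓘(ℝ, CSpace m) q).left_inv hq'
    rw [this]
  -- The derivative of the components is not a tensor: a change of chart adds a term with the second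
  -- derivative of the transition map. That term is symmetric, so it drops out of the exterior
  -- derivative.
  have hfd : ∀ v w, formDeriv η b y v w =
      formDeriv η q (Ψ y) (fderiv ℝ Ψ y v) (fderiv ℝ Ψ y w) +
        formLoc η q (Ψ y) (fderiv ℝ (fderiv ℝ Ψ) y v w) := by
    intro v w
    have hAΨ : DifferentiableAt ℝ (fun y' => formLoc η q (Ψ y')) y :=
      hA.comp y (hΨs.differentiableAt (by simp))
    rw [formDeriv, Filter.EventuallyEq.fderiv_eq hloc, fderiv_clm_comp hAΨ hDΨ]
    have : fderiv ℝ (fun y' => formLoc η q (Ψ y')) y =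
        (formDeriv η q (Ψ y)).comp (fderiv ℝ Ψ y) :=
      fderiv_comp y hA (hΨs.differentiableAt (by simp))
    rw [this]
    simp [add_comm]
  have hsym : fderiv ℝ (fderiv ℝ Ψ) y u w = fderiv ℝ (fderiv ℝ Ψ) y w u :=
    (hΨs.isSymmSndFDerivAt (by simpa using two_le_infty)) u w
  rw [hη.extDerivOne_eq, hfd, hfd, hcv, hcv, hsym, hΨy]
  ring

/-- The composition of a `1`-form with the complex structure. -/
def compJ (η : ∀ p : M, TangentSpace 𝓘(ℝ, CSpace m) p →L[ℝ] ℝ) (p : M) :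
    TangentSpace 𝓘(ℝ, CSpace m) p →L[ℝ] ℝ :=
  (covAt η p).comp ((Complex.I • ContinuousLinearMap.id ℂ (CSpace m)).restrictScalars ℝ)

theorem formLoc_compJ (η : ∀ p : M, TangentSpace 𝓘(ℝ, CSpace m) p →L[ℝ] ℝ) (b : M)
    {y : CSpace m} (hy : y ∈ (extChartAt 𝓘(ℝ, CSpace m) b).target) (w : CSpace m) :
    formLoc (compJ η) b y w = formLoc η b y (Complex.I • w) := by
  simp only [formLoc, ContinuousLinearMap.comp_apply, coordVecL_I b hy]
  rfl

theorem IsSmoothOneForm.compJ {η : ∀ p : M, TangentSpace 𝓘(ℝ, CSpace m) p →L[ℝ] ℝ}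
    (hη : IsSmoothOneForm η) : IsSmoothOneForm (compJ η) := by
  refine isSmoothOneForm_of_formLoc _ fun b => ⟨_, extChartAt_target_mem_nhds b, fun w => ?_⟩
  refine ContDiffOn.congr ?_ fun y hy => formLoc_compJ η b hy w
  exact (hη.contDiffOn_formLoc b).clm_apply contDiffOn_const

theorem IsSmoothOneForm.formDeriv_compJ {η : ∀ p : M, TangentSpace 𝓘(ℝ, CSpace m) p →L[ℝ] ℝ}
    (hη : IsSmoothOneForm η) (b : M) {y : CSpace m}
    (hy : y ∈ (extChartAt 𝓘(ℝ, CSpace m) b).target) (u w : CSpace m) :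
    formDeriv (HarmonicMaps.compJ η) b y u w = formDeriv η b y u (Complex.I • w) := by
  rw [← hη.compJ.fderiv_formLoc b hy, ← hη.fderiv_formLoc b hy]
  refine congrArg (fun A : CSpace m →L[ℝ] ℝ => A u) (Filter.EventuallyEq.fderiv_eq ?_)
  filter_upwards [target_mem_nhds b hy] with y' hy'
  exact formLoc_compJ η b hy' w

/-- A real bilinear form as a complex valued bilinear form. -/
def toBilin (B : CSpace m →L[ℝ] CSpace m →L[ℝ] ℝ) : CSpace m →ₗ[ℝ] CSpace m →ₗ[ℝ] ℂ :=
  LinearMap.mk₂ ℝ (fun u w => ((B u w : ℝ) : ℂ))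
    (fun a a' b => by simp)
    (fun c a b => by simp)
    (fun a a' b => by simp)
    (fun c a b => by simp)

theorem toBilin_apply (B : CSpace m →L[ℝ] CSpace m →L[ℝ] ℝ) (u w : CSpace m) :
    toBilin B u w = (B u w : ℂ) := rfl

/-- The contraction with the metric of the derivatives of the components of a `1`-form `η` in the
chart centred at `p`. It is the divergence of the part of type `(1,0)` (if `ε = 1`) or `(0,1)`
(if `ε = -1`) of `η`. -/
def divForm (ε : ℂ) (h : RiemMetric (CSpace m) M)
    (η : ∀ p : M, TangentSpace 𝓘(ℝ, CSpace m) p →L[ℝ] ℝ) (p : M) : ℂ :=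
  contr ε (kmat ε (hermMatrix h p (extChartAt 𝓘(ℝ, CSpace m) p p))) cBasis
    (toBilin (formDeriv η p (extChartAt 𝓘(ℝ, CSpace m) p p)))

theorem cBasis_eq : (cBasis : Fin m → CSpace m) = stdBasis m :=
  funext fun α => (stdBasis_apply α).symm

theorem IsHermitianInner.I_antisymm {g : CSpace m →L[ℝ] CSpace m →L[ℝ] ℝ}
    (hg : IsHermitianInner g) (v w : CSpace m) :
    g (Complex.I • v) w = -g (Complex.I • w) v := by
  rw [hg.I_left, hg.symm]

/-- The coefficient built from J is antisymmetric, so antisymmetrizing the derivative of the form is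
redundant and cancels the factor ½. -/
theorem twoFormInner_extDerivOne {h : RiemMetric (CSpace m) M} (hh : IsHermitian h)
    {η : ∀ p : M, TangentSpace 𝓘(ℝ, CSpace m) p →L[ℝ] ℝ} (hη : IsSmoothOneForm η) (p : M) :
    twoFormInner h p (extDerivOne η p) (fundForm h p) =
      ∑ i, ∑ j, formDeriv η p (extChartAt 𝓘(ℝ, CSpace m) p p) (vecFrame i) (vecFrame j) *
        metricAt h p (Complex.I • dualFrame h p i) (dualFrame h p j) := by
  have hg := isHermitianInner_metricAt hh p
  rw [twoFormInner_fundForm h p (extDerivOne η p)]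
  have h1 : ∀ i j, extDerivOne η p (realFrame p i) (realFrame p j) =
      formDeriv η p (extChartAt 𝓘(ℝ, CSpace m) p p) (vecFrame i) (vecFrame j) -
      formDeriv η p (extChartAt 𝓘(ℝ, CSpace m) p p) (vecFrame j) (vecFrame i) :=
    fun i j => hη.extDerivOne_eq p _ _
  simp only [h1, sub_mul, Finset.sum_sub_distrib]
  have h2 : ∑ i, ∑ j, formDeriv η p (extChartAt 𝓘(ℝ, CSpace m) p p) (vecFrame j) (vecFrame i) *
        metricAt h p (Complex.I • dualFrame h p i) (dualFrame h p j) =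
      -∑ i, ∑ j, formDeriv η p (extChartAt 𝓘(ℝ, CSpace m) p p) (vecFrame i) (vecFrame j) *
        metricAt h p (Complex.I • dualFrame h p i) (dualFrame h p j) := by
    rw [Finset.sum_comm, ← Finset.sum_neg_distrib]
    refine Finset.sum_congr rfl fun i _ => ?_
    rw [← Finset.sum_neg_distrib]
    refine Finset.sum_congr rfl fun j _ => ?_
    rw [hg.I_antisymm (dualFrame h p j)]
    ring
  rw [h2]
  ring

/-- The divergence in terms of inner products with the fundamental form. -/
theorem divForm_eq {ε : ℂ} (hε : ε = 1 ∨ ε = -1) {h : RiemMetric (CSpace m) M}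
    (hh : IsHermitian h) {η : ∀ p : M, TangentSpace 𝓘(ℝ, CSpace m) p →L[ℝ] ℝ}
    (hη : IsSmoothOneForm η) (p : M) :
    divForm ε h η p = -(1 / 4) *
      ((twoFormInner h p (extDerivOne (compJ η) p) (fundForm h p) : ℂ) +
        ε * Complex.I * (twoFormInner h p (extDerivOne η p) (fundForm h p) : ℂ)) := by
  have hg := isHermitianInner_metricAt hh p
  have hd := isDualFrame_dualFrame h p
  rw [divForm, hermMatrix_center, cBasis_eq, contr_eq hg hε (stdBasis m) hd,
    twoFormInner_extDerivOne hh hη, twoFormInner_extDerivOne hh hη.compJ]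
  set T := formDeriv η p (extChartAt 𝓘(ℝ, CSpace m) p p) with hT
  have h1 : ∑ i, ∑ j, formDeriv (compJ η) p (extChartAt 𝓘(ℝ, CSpace m) p p)
      (vecFrame i) (vecFrame j) * metricAt h p (Complex.I • dualFrame h p i) (dualFrame h p j) =
      -∑ i, ∑ j, T (vecFrame i) (vecFrame j) *
        metricAt h p (dualFrame h p i) (dualFrame h p j) := by
    rw [← Finset.sum_neg_distrib]
    refine Finset.sum_congr rfl fun i _ => ?_
    have h2 : ∀ j, formDeriv (compJ η) p (extChartAt 𝓘(ℝ, CSpace m) p p)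
        (vecFrame i) (vecFrame j) = T (vecFrame i) (Complex.I • vecFrame j) :=
      fun j => hη.formDeriv_compJ p (mem_extChartAt_target p) _ _
    -- The contraction of η∘J with ω_h applies J twice to a dual vector, and J² = -1. So ⟨d(η∘J),
    -- ω_h⟩ is minus the metric trace of the derivative of η, which supplies the symmetric part of
    -- the divergence.
    have h3 : ∑ j, metricAt h p (Complex.I • dualFrame h p i) (dualFrame h p j) •
        (Complex.I • (vecFrame j : CSpace m)) = -dualFrame h p i := by
      have h4 := hd.sum_left (Complex.I • dualFrame h p i)
      rw [← I_smul_I_smul]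
      conv_rhs => rw [← h4, Finset.smul_sum]
      refine Finset.sum_congr rfl fun j _ => ?_
      rw [smul_comm, hg.symm]
    have h5 := hd.sum_left (dualFrame h p i)
    have h6 := congrArg (T (vecFrame i)) h3
    conv_rhs at h6 => rw [← h5]
    simp only [map_sum, map_neg, map_smul, smul_eq_mul] at h6
    simp only [h2]
    refine Eq.trans (Finset.sum_congr rfl fun j _ => mul_comm _ _) (h6.trans ?_)
    refine congrArg Neg.neg (Finset.sum_congr rfl fun j _ => ?_)
    rw [mul_comm, hg.symm]
  rw [h1]
  push_cast
  simp only [toBilin_apply, Finset.mul_sum, ← Finset.sum_neg_distrib, ← Finset.sum_add_distrib]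
  refine Finset.sum_congr rfl fun i _ => Finset.sum_congr rfl fun j _ => ?_
  ring

end

/-! ### Tensoriality, continuity, and vanishing of the integrated divergence. -/

section

variable {m : ℕ} {M : Type*} [TopologicalSpace M] [ChartedSpace (CSpace m) M]
  [IsManifold 𝓘(ℂ, CSpace m) ω M]

/-- The antisymmetrized derivatives of the components of a `1`-form. -/
def formCurl (η : ∀ p : M, TangentSpace 𝓘(ℝ, CSpace m) p →L[ℝ] ℝ) (b : M) (y : CSpace m) :
    CSpace m →L[ℝ] CSpace m →L[ℝ] ℝ :=
  formDeriv η b y - (formDeriv η b y).flip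

theorem polar_pullback {ε : ℂ} (b : M) {y : CSpace m}
    (hy : y ∈ (extChartAt 𝓘(ℝ, CSpace m) b).target)
    (B B' : CSpace m →ₗ[ℝ] CSpace m →ₗ[ℝ] ℂ)
    (hB : ∀ u w, B (coordVecL b y u) (coordVecL b y w) = B' u w) (u w : CSpace m) :
    polar ε B (coordVecL b y u) (coordVecL b y w) = polar ε B' u w := by
  simp only [polar, ← coordVecL_I b hy, hB]

theorem contr_pullback {ε : ℂ} (h : RiemMetric (CSpace m) M) (b : M) {y : CSpace m}
    (hy : y ∈ (extChartAt 𝓘(ℝ, CSpace m) b).target)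
    (B B' : CSpace m →ₗ[ℝ] CSpace m →ₗ[ℝ] ℂ)
    (hB : ∀ u w, B (coordVecL b y u) (coordVecL b y w) = B' u w) :
    contr ε (kmat ε (IsHermitianInner.gram (metricAt h ((extChartAt 𝓘(ℝ, CSpace m) b).symm y))
      (chartBasis b hy))) (chartBasis b hy) B =
    contr ε (kmat ε (hermMatrix h b y)) cBasis B' := by
  rw [hermMatrix_eq_gram h b hy, contr, contr]
  refine Finset.sum_congr rfl fun α _ => Finset.sum_congr rfl fun β _ => ?_
  rw [chartBasis_apply, chartBasis_apply, polar_pullback b hy B B' hB]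

/-- The contraction of a bilinear form computed in the centred chart and in another chart. -/
theorem contr_center_eq {ε : ℂ} (hε : ε = 1 ∨ ε = -1) {h : RiemMetric (CSpace m) M}
    (hh : IsHermitian h) (b : M) {y : CSpace m}
    (hy : y ∈ (extChartAt 𝓘(ℝ, CSpace m) b).target)
    (B B' : CSpace m →ₗ[ℝ] CSpace m →ₗ[ℝ] ℂ)
    (hB : ∀ u w, B (coordVecL b y u) (coordVecL b y w) = B' u w) {q : M}
    (hq : (extChartAt 𝓘(ℝ, CSpace m) b).symm y = q) :
    contr ε (kmat ε (hermMatrix h q (extChartAt 𝓘(ℝ, CSpace m) q q))) cBasis B =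
    contr ε (kmat ε (hermMatrix h b y)) cBasis B' := by
  subst hq
  have hg := isHermitianInner_metricAt hh ((extChartAt 𝓘(ℝ, CSpace m) b).symm y)
  have hd := isDualFrame_dualFrame h ((extChartAt 𝓘(ℝ, CSpace m) b).symm y)
  rw [← contr_pullback h b hy B B' hB, contr_eq hg hε _ hd, hermMatrix_center, cBasis_eq,
    contr_eq hg hε _ hd]

/-- An antisymmetric form has zero metric trace, so its contraction retains only the ω_h-part, with
coefficient -i/4. The factor 2i turns this into the ½ of the inner product of two-forms. -/
theorem twoFormInner_eq_contr {h : RiemMetric (CSpace m) M} (hh : IsHermitian h)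
    {η : ∀ p : M, TangentSpace 𝓘(ℝ, CSpace m) p →L[ℝ] ℝ} (hη : IsSmoothOneForm η) (p : M) :
    (twoFormInner h p (extDerivOne η p) (fundForm h p) : ℂ) =
      2 * Complex.I * contr 1 (kmat 1 (hermMatrix h p (extChartAt 𝓘(ℝ, CSpace m) p p))) cBasis
        (toBilin (formCurl η p (extChartAt 𝓘(ℝ, CSpace m) p p))) := by
  have hg := isHermitianInner_metricAt hh p
  have hd := isDualFrame_dualFrame h p
  rw [hermMatrix_center, cBasis_eq, contr_eq hg (Or.inl rfl) _ hd,
    twoFormInner_fundForm h p (extDerivOne η p)]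
  set S := formCurl η p (extChartAt 𝓘(ℝ, CSpace m) p p) with hS
  have h1 : ∀ i j, extDerivOne η p (realFrame p i) (realFrame p j) =
      S (vecFrame i) (vecFrame j) := fun i j => hη.extDerivOne_eq p _ _
  have h2 : ∀ u w, S u w = -S w u := fun u w => by simp [hS, formCurl]
  have h3 : ∑ i, ∑ j, (S (vecFrame i) (vecFrame j) : ℂ) *
      (metricAt h p (dualFrame h p i) (dualFrame h p j) : ℂ) = 0 := by
    have h4 : ∑ i, ∑ j, (S (vecFrame i) (vecFrame j) : ℂ) *
        (metricAt h p (dualFrame h p i) (dualFrame h p j) : ℂ) =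
        -∑ i, ∑ j, (S (vecFrame i) (vecFrame j) : ℂ) *
        (metricAt h p (dualFrame h p i) (dualFrame h p j) : ℂ) := by
      conv_lhs => rw [Finset.sum_comm]
      rw [← Finset.sum_neg_distrib]
      refine Finset.sum_congr rfl fun i _ => ?_
      rw [← Finset.sum_neg_distrib]
      refine Finset.sum_congr rfl fun j _ => ?_
      rw [h2, metricAt_symm]
      push_cast; ring
    have h5 := eq_neg_iff_add_eq_zero.1 h4
    rw [← two_mul] at h5
    exact (mul_eq_zero.1 h5).resolve_left two_ne_zero
  have h6 : ∑ i, ∑ j, toBilin S (vecFrame i) (vecFrame j) *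
      ((1 / 4) * ((metricAt h p (dualFrame h p i) (dualFrame h p j) : ℂ) - 1 * Complex.I *
        (metricAt h p (Complex.I • dualFrame h p i) (dualFrame h p j) : ℂ))) =
      (1 / 4) * (∑ i, ∑ j, (S (vecFrame i) (vecFrame j) : ℂ) *
        (metricAt h p (dualFrame h p i) (dualFrame h p j) : ℂ)) - (1 / 4) * Complex.I *
      ∑ i, ∑ j, (S (vecFrame i) (vecFrame j) : ℂ) *
        (metricAt h p (Complex.I • dualFrame h p i) (dualFrame h p j) : ℂ) := by
    simp only [toBilin_apply, Finset.mul_sum, ← Finset.sum_sub_distrib]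
    refine Finset.sum_congr rfl fun i _ => Finset.sum_congr rfl fun j _ => ?_
    ring
  rw [h6, h3]
  simp only [h1]
  push_cast
  linear_combination (1 / 2) * (∑ i, ∑ j, (S (vecFrame i) (vecFrame j) : ℂ) *
        (metricAt h p (Complex.I • dualFrame h p i) (dualFrame h p j) : ℂ)) * Complex.I_sq

theorem continuousAt_kmat {h : RiemMetric (CSpace m) M} (hh : IsHermitian h) (b : M) {ε : ℂ}
    (hε : ε = 1 ∨ ε = -1) (α β : Fin m) {y : CSpace m}
    (hy : y ∈ (extChartAt 𝓘(ℝ, CSpace m) b).target) :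
    ContinuousAt (fun y => kmat ε (hermMatrix h b y) α β) y :=
  (contDiffOn_kmat hh b hε α β).continuousOn.continuousAt (target_mem_nhds b hy)

/-- The antisymmetrized derivative is a tensor and the contraction does not depend on the basis, so
near `b` the function can be computed in the single chart at `b`, where all ingredients are smooth.
-/
theorem continuous_twoFormInner {h : RiemMetric (CSpace m) M} (hh : IsHermitian h)
    {η : ∀ p : M, TangentSpace 𝓘(ℝ, CSpace m) p →L[ℝ] ℝ} (hη : IsSmoothOneForm η) :
    Continuous fun p => twoFormInner h p (extDerivOne η p) (fundForm h p) := by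
  refine Complex.isometry_ofReal.isEmbedding.continuous_iff.2 (continuous_iff_continuousAt.2 fun b => ?_)
  have hb := mem_extChartAt_target (I := 𝓘(ℝ, CSpace m)) b
  have h1 : ContinuousAt (formDeriv η b) (extChartAt 𝓘(ℝ, CSpace m) b b) :=
    ((hη.contDiffAt_formLoc b hb).fderiv_right (m := ∞) (by simp)).continuousAt
  have h1' : ∀ u w : CSpace m, ContinuousAt (fun y => formDeriv η b y u w)
      (extChartAt 𝓘(ℝ, CSpace m) b b) := fun u w =>
    (h1.clm_apply continuousAt_const).clm_apply continuousAt_const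
  have h2 : ContinuousAt (fun y => 2 * Complex.I * contr 1 (kmat 1 (hermMatrix h b y)) cBasis
        (toBilin (formCurl η b y))) (extChartAt 𝓘(ℝ, CSpace m) b b) := by
    have h3 : ∀ u w : CSpace m, ContinuousAt (fun y => (formCurl η b y u w : ℂ))
        (extChartAt 𝓘(ℝ, CSpace m) b b) := fun u w =>
      Complex.continuous_ofReal.continuousAt.comp
        ((h1' u w).sub (h1' w u))
    simp only [contr, polar, toBilin_apply]
    refine continuousAt_const.mul (tendsto_finsetSum _ fun α _ => tendsto_finsetSum _ fun β _ => ?_)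
    exact (continuousAt_kmat hh b (Or.inl rfl) α β hb).mul (continuousAt_const.mul
      (((h3 _ _).add (h3 _ _)).add (continuousAt_const.mul ((h3 _ _).sub (h3 _ _)))))
  have h4 := ContinuousAt.comp (f := extChartAt 𝓘(ℝ, CSpace m) b) h2 (continuousAt_extChartAt b)
  refine h4.congr ?_
  filter_upwards [extChartAt_source_mem_nhds (I := 𝓘(ℝ, CSpace m)) b] with q hq
  have hy := (extChartAt 𝓘(ℝ, CSpace m) b).map_source hq
  have hq' := (extChartAt 𝓘(ℝ, CSpace m) b).left_inv hq
  simp only [Function.comp]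
  rw [twoFormInner_eq_contr hh hη q]
  congr 1
  refine (contr_center_eq (Or.inl rfl) hh b hy _ _ (fun u w => ?_) hq').symm
  rw [toBilin_apply, toBilin_apply]
  have h5 := hη.extDerivOne_coordVecL b hy u w
  rw [hq', hη.extDerivOne_eq] at h5
  exact congrArg Complex.ofReal h5

/-- The definition of `divForm` uses the untensorial derivative in moving charts, so continuity is
read off from its expression by exterior derivatives. -/
theorem continuous_divForm {ε : ℂ} (hε : ε = 1 ∨ ε = -1) {h : RiemMetric (CSpace m) M}
    (hh : IsHermitian h) {η : ∀ p : M, TangentSpace 𝓘(ℝ, CSpace m) p →L[ℝ] ℝ}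
    (hη : IsSmoothOneForm η) : Continuous (divForm ε h η) := by
  rw [funext (divForm_eq hε hh hη)]
  exact continuous_const.mul ((Complex.continuous_ofReal.comp (continuous_twoFormInner hh hη.compJ)).add
    (continuous_const.mul (Complex.continuous_ofReal.comp (continuous_twoFormInner hh hη))))

/-- On a balanced manifold the integral of a divergence vanishes. -/
theorem integral_divForm [CompactSpace M] [T2Space M] [MeasurableSpace M] [BorelSpace M]
    {ε : ℂ} (hε : ε = 1 ∨ ε = -1)
    {h : RiemMetric (CSpace m) M}
    (hh : IsHermitian h) (hb : IsBalanced h)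
    {η : ∀ p : M, TangentSpace 𝓘(ℝ, CSpace m) p →L[ℝ] ℝ}
    (hη : IsSmoothOneForm η) : ∫ p, divForm ε h η p ∂(volumeMeasure h) = 0 := by
  have h1 : Integrable (fun p => (twoFormInner h p (extDerivOne (compJ η) p) (fundForm h p) : ℂ))
    (volumeMeasure h) := integrable_of_continuous h
    (Complex.continuous_ofReal.comp (continuous_twoFormInner hh hη.compJ))
  have h2 : Integrable (fun p => (twoFormInner h p (extDerivOne η p) (fundForm h p) : ℂ))
    (volumeMeasure h) := integrable_of_continuous h
    (Complex.continuous_ofReal.comp (continuous_twoFormInner hh hη))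
  simp only [divForm_eq hε hh hη]
  rw [integral_const_mul, integral_add h1 (h2.const_mul _), integral_const_mul]
  have h3 : ∫ p, (twoFormInner h p (extDerivOne (compJ η) p) (fundForm h p) : ℂ)
    ∂(volumeMeasure h) = 0 := by
    rw [integral_complex_ofReal, hb _ hη.compJ, Complex.ofReal_zero]
  have h4 : ∫ p, (twoFormInner h p (extDerivOne η p) (fundForm h p) : ℂ)
    ∂(volumeMeasure h) = 0 := by
    rw [integral_complex_ofReal, hb _ hη, Complex.ofReal_zero]
  rw [h3, h4]
  simp

end

/-! ### Sesquilinear forms on components. -/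

section Sesquilinear

variable {n : ℕ}

/-- The sesquilinear form with matrix `A`. -/
def formG (A : Matrix (Fin n) (Fin n) ℂ) (a b : Fin n → ℂ) : ℂ :=
  ∑ i, ∑ j, A i j * a i * (starRingEnd ℂ) (b j)

theorem formG_add_left (A : Matrix (Fin n) (Fin n) ℂ) (a a' b : Fin n → ℂ) :
    formG A (a + a') b = formG A a b + formG A a' b := by
  simp only [formG, Pi.add_apply, ← Finset.sum_add_distrib]
  exact Finset.sum_congr rfl fun i _ => Finset.sum_congr rfl fun j _ => by ring

theorem formG_add_right (A : Matrix (Fin n) (Fin n) ℂ) (a b b' : Fin n → ℂ) :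
    formG A a (b + b') = formG A a b + formG A a b' := by
  simp only [formG, Pi.add_apply, map_add, ← Finset.sum_add_distrib]
  exact Finset.sum_congr rfl fun i _ => Finset.sum_congr rfl fun j _ => by ring

theorem formG_smul_left (A : Matrix (Fin n) (Fin n) ℂ) (c : ℂ) (a b : Fin n → ℂ) :
    formG A (c • a) b = c * formG A a b := by
  simp only [formG, Pi.smul_apply, smul_eq_mul, Finset.mul_sum]
  exact Finset.sum_congr rfl fun i _ => Finset.sum_congr rfl fun j _ => by ring

theorem formG_smul_right (A : Matrix (Fin n) (Fin n) ℂ) (c : ℂ) (a b : Fin n → ℂ) :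
    formG A a (c • b) = (starRingEnd ℂ) c * formG A a b := by
  simp only [formG, Pi.smul_apply, smul_eq_mul, map_mul, Finset.mul_sum]
  exact Finset.sum_congr rfl fun i _ => Finset.sum_congr rfl fun j _ => by ring

theorem formG_conj {A : Matrix (Fin n) (Fin n) ℂ}
    (hA : ∀ i j, (starRingEnd ℂ) (A i j) = A j i) (a b : Fin n → ℂ) :
    (starRingEnd ℂ) (formG A a b) = formG A b a := by
  simp only [formG, map_sum, map_mul, hA, Complex.conj_conj]
  rw [Finset.sum_comm]
  exact Finset.sum_congr rfl fun i _ => Finset.sum_congr rfl fun j _ => by ring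

/-- The sesquilinear form, as a real linear form in its second argument. -/
def formGR (A : Matrix (Fin n) (Fin n) ℂ) (a : Fin n → ℂ) : (Fin n → ℂ) →L[ℝ] ℂ :=
  LinearMap.toContinuousLinearMap
    { toFun := formG A a
      map_add' := formG_add_right A a
      map_smul' := fun c b => by
        have := formG_smul_right A (c : ℂ) a b
        rw [Complex.conj_ofReal] at this
        simpa using this }

theorem formGR_apply (A : Matrix (Fin n) (Fin n) ℂ) (a b : Fin n → ℂ) :
    formGR A a b = formG A a b := rfl

end Sesquilinear

/-! ### Uniform treatment of ∂ and ∂̄ by a sign. -/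

section Wirtinger

variable {m : ℕ}

/-- `∂/∂z̄^α` if `ε = 1` and `∂/∂z^α` if `ε = -1`. -/
def dE (ε : ℂ) (α : Fin m) (u : CSpace m → ℂ) (x : CSpace m) : ℂ :=
  (1 / 2) * (fderiv ℝ u x (cBasis α) + ε * Complex.I * fderiv ℝ u x (Complex.I • cBasis α))

theorem dE_one (α : Fin m) (u : CSpace m → ℂ) : dE 1 α u = dzbar α u := by
  funext x; simp [dE, dzbar]

theorem dE_neg_one (α : Fin m) (u : CSpace m → ℂ) : dE (-1) α u = dz α u := by
  funext x; simp only [dE, dz]; ring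

theorem conj_sign {ε : ℂ} (hε : ε = 1 ∨ ε = -1) : (starRingEnd ℂ) ε = ε := by
  rcases hε with rfl | rfl <;> simp

theorem sign_sq {ε : ℂ} (hε : ε = 1 ∨ ε = -1) : ε * ε = 1 := by
  rcases hε with rfl | rfl <;> norm_num

theorem kmat_conj {H : Matrix (Fin m) (Fin m) ℂ} (hH : H.IsHermitian) {ε : ℂ}
    (hε : ε = 1 ∨ ε = -1) (α β : Fin m) :
    (starRingEnd ℂ) (kmat ε H α β) = kmat ε H β α := by
  have h1 : ∀ α β, (starRingEnd ℂ) (H⁻¹ α β) = H⁻¹ β α := fun α β => hH.inv.apply β α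
  rcases hε with rfl | rfl
  · simp only [kmat_one, h1]
  · simp only [kmat_neg_one, Matrix.transpose_apply, h1]

namespace LocalData

variable {n : ℕ} (D : LocalData m n)

/-- The inner product of `E`-valued forms of type `(0,1)` (`ε = 1`) or `(1,0)` (`ε = -1`). -/
def innerE (ε : ℂ) (a b : Fin m → Fin n → ℂ) : ℂ :=
  ∑ α, ∑ β, kmat ε D.h α β * formG D.g (a α) (b β)

/-- Components of the `(0,1)`-part (`ε = 1`) or the `(1,0)`-part (`ε = -1`) of the differential. -/
def dfE (ε : ℂ) (α : Fin m) (i : Fin n) : ℂ := dE ε α (D.f i) D.pt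

/-- Components of the `(0,1)`-part or the `(1,0)`-part of the covariant derivative. -/
def covE (ε : ℂ) (s : Fin n → CSpace m → ℂ) (α : Fin m) (i : Fin n) : ℂ :=
  dE ε α (s i) D.pt + ∑ j, ∑ k, D.Γ i j k * D.dfE ε α j * s k D.pt

/-- The energy density of the `(0,1)`-part or the `(1,0)`-part of the differential. -/
def densE (ε : ℂ) : ℝ := (D.innerE ε (D.dfE ε) (D.dfE ε)).re

/-- The pairing of the covariant derivative of a section with the differential. -/
def pairE (ε : ℂ) (s : Fin n → CSpace m → ℂ) : ℂ := D.innerE ε (D.covE ε s) (D.dfE ε)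

/-- The tension field of the Hermitian harmonic map equation. -/
def tension (i : Fin n) : ℂ :=
  ∑ α, ∑ β, raise D.h α β *
    (dz α (dzbar β (D.f i)) D.pt + ∑ j, ∑ k, D.Γ i j k * D.dbar β j * D.del α k)

theorem hermitianHarmonicEq_iff : D.HermitianHarmonicEq ↔ D.tension = 0 := by
  simp only [HermitianHarmonicEq, neg_eq_zero, funext_iff, tension, Pi.zero_apply]

/-- `raise` transposes the inverse matrix, and the (0,1)-product contracts with its indices crossed.
The two transpositions cancel for ε = 1, while a transpose remains for ε = -1; `kmat` records this.
-/
theorem inner01_eq (a b : Fin m → Fin n → ℂ) : D.inner01 a b = D.innerE 1 a b := by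
  rw [inner01, innerE, Finset.sum_comm]
  refine Finset.sum_congr rfl fun α _ => Finset.sum_congr rfl fun β _ => ?_
  simp only [kmat_one, formG, raise, Finset.mul_sum]
  exact Finset.sum_congr rfl fun i _ => Finset.sum_congr rfl fun j _ => by ring

theorem inner10_eq (a b : Fin m → Fin n → ℂ) : D.inner10 a b = D.innerE (-1) a b := by
  rw [inner10, innerE]
  refine Finset.sum_congr rfl fun α _ => Finset.sum_congr rfl fun β _ => ?_
  simp only [kmat_neg_one, formG, raise, Finset.mul_sum, Matrix.transpose_apply]
  exact Finset.sum_congr rfl fun i _ => Finset.sum_congr rfl fun j _ => by ring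

theorem dbar_eq : D.dbar = D.dfE 1 := by
  funext α i; simp only [dbar, dfE, dE_one]

theorem del_eq : D.del = D.dfE (-1) := by
  funext α i; simp only [del, dfE, dE_neg_one]

theorem dbarE_eq (s : Fin n → CSpace m → ℂ) : D.dbarE s = D.covE 1 s := by
  funext α i; simp only [dbarE, covE, dE_one, dbar_eq]

theorem delE_eq (s : Fin n → CSpace m → ℂ) : D.delE s = D.covE (-1) s := by
  funext α i; simp only [delE, covE, dE_neg_one, del_eq]

theorem dbarNormSq_eq : D.dbarNormSq = D.densE 1 := by
  rw [dbarNormSq, inner01_eq, dbar_eq, densE]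

theorem delNormSq_eq : D.delNormSq = D.densE (-1) := by
  rw [delNormSq, inner10_eq, del_eq, densE]

theorem dbarPair_eq (s : Fin n → CSpace m → ℂ) : D.dbarPair s = D.pairE 1 s := by
  rw [dbarPair, inner01_eq, dbar_eq, dbarE_eq, pairE]

theorem delPair_eq (s : Fin n → CSpace m → ℂ) : D.delPair s = D.pairE (-1) s := by
  rw [delPair, inner10_eq, del_eq, delE_eq, pairE]

end LocalData

end Wirtinger

/-! ### Targets with a symmetric metric connection. -/

section Target

/-- The data on a manifold `N` modelled on `V` which enter the harmonic map equations: complex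
components `κ` of tangent vectors, a Hermitian metric with matrix `G b y` in the chart centred at
`b`, and the Christoffel symbols at the centre of each chart of a symmetric connection compatible
with the metric. -/
structure TargetFrame (n : ℕ) (V : Type*) [NormedAddCommGroup V] [NormedSpace ℝ V]
    (N : Type*) [TopologicalSpace N] [ChartedSpace V N] where
  κ : V →L[ℝ] (Fin n → ℂ)
  G : N → V → Matrix (Fin n) (Fin n) ℂ
  Γ : N → Fin n → Fin n → Fin n → ℂ
  contDiffOn_G : ∀ b i j, ContDiffOn ℝ ∞ (fun y => G b y i j) (extChartAt 𝓘(ℝ, V) b).target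
  G_conj : ∀ b, ∀ y ∈ (extChartAt 𝓘(ℝ, V) b).target, ∀ i j,
    (starRingEnd ℂ) (G b y i j) = G b y j i
  compat : ∀ b v i j, fderiv ℝ (fun y => G b y i j) (extChartAt 𝓘(ℝ, V) b b) v =
    ∑ l, ((∑ k, Γ b l k i * κ v k) * G b (extChartAt 𝓘(ℝ, V) b b) l j +
      (starRingEnd ℂ) (∑ k, Γ b l k j * κ v k) * G b (extChartAt 𝓘(ℝ, V) b b) i l)
  symm : ∀ b i j k, Γ b i j k = Γ b i k j
  change : ∀ b, ∀ y ∈ (extChartAt 𝓘(ℝ, V) b).target, ∀ q,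
    (extChartAt 𝓘(ℝ, V) b).symm y = q → ∀ v w,
      formG (G q (extChartAt 𝓘(ℝ, V) q q)) (κ (coordVecL b y v)) (κ (coordVecL b y w)) =
        formG (G b y) (κ v) (κ w)
  pos : ∀ b v, v ≠ 0 → 0 < (formG (G b (extChartAt 𝓘(ℝ, V) b b)) (κ v) (κ v)).re

variable {n : ℕ} {V : Type*} [NormedAddCommGroup V] [NormedSpace ℝ V]
    {N : Type*} [TopologicalSpace N] [ChartedSpace V N] (T : TargetFrame n V N)

namespace TargetFrame

/-- The covariant derivative, along a map, of a field with components `s` in the direction `u`. -/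
def covDir {E : Type*} [NormedAddCommGroup E] [NormedSpace ℝ E] (c : N) (F : E → V) (x u : E)
    (s : Fin n → E → ℂ) (i : Fin n) : ℂ :=
  fderiv ℝ (s i) x u + ∑ j, ∑ k, T.Γ c i j k * T.κ (fderiv ℝ F x u) j * s k x

/-- Compatibility of the connection with the metric, along a map. -/
theorem fderiv_formG [IsManifold 𝓘(ℝ, V) ∞ N] {E : Type*} [NormedAddCommGroup E] [NormedSpace ℝ E]
    (c : N) {F : E → V} {x : E}
    (hF : DifferentiableAt ℝ F x) (hFx : F x = extChartAt 𝓘(ℝ, V) c c) {s t : Fin n → E → ℂ}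
    (hs : ∀ i, DifferentiableAt ℝ (s i) x) (ht : ∀ i, DifferentiableAt ℝ (t i) x) (u : E) :
    fderiv ℝ (fun y => formG (T.G c (F y)) (fun i => s i y) (fun i => t i y)) x u =
      formG (T.G c (F x)) (T.covDir c F x u s) (fun i => t i x) +
      formG (T.G c (F x)) (fun i => s i x) (T.covDir c F x u t) := by
  have hG : ∀ i j, DifferentiableAt ℝ (fun y => T.G c y i j) (F x) := fun i j => by
    rw [hFx]
    exact ((T.contDiffOn_G c i j).contDiffAt
      (target_mem_nhds c (mem_extChartAt_target c))).differentiableAt (by simp)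
  -- Leibniz's rule on the product of the metric entry, `s`, and the conjugate of `t`. The
  -- derivative of the metric entry is then replaced through `compat`, which is available only at
  -- the centre of the chart; hence the hypothesis `hFx`.
  have h1 : HasFDerivAt (fun y => formG (T.G c (F y)) (fun i => s i y) (fun i => t i y))
      (∑ i, ∑ j, ((T.G c (F x) i j * s i x) • (Complex.conjCLE : ℂ →L[ℝ] ℂ).comp (fderiv ℝ (t j) x) +
        (starRingEnd ℂ) (t j x) • (T.G c (F x) i j • fderiv ℝ (s i) x +
          s i x • (fderiv ℝ (fun y => T.G c y i j) (F x)).comp (fderiv ℝ F x)))) x := by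
    unfold formG
    refine HasFDerivAt.fun_sum fun i _ => HasFDerivAt.fun_sum fun j _ => ?_
    have hg := (hG i j).hasFDerivAt.comp x hF.hasFDerivAt
    have hc := (Complex.conjCLE : ℂ →L[ℝ] ℂ).hasFDerivAt.comp x (ht j).hasFDerivAt
    exact (hg.mul (hs i).hasFDerivAt).mul hc
  rw [h1.fderiv]
  set A : Fin n → Fin n → ℂ := fun l i => ∑ k, T.Γ c l k i * T.κ (fderiv ℝ F x u) k with hA
  have hcov : ∀ s : Fin n → E → ℂ, T.covDir c F x u s =
      fun i => fderiv ℝ (s i) x u + ∑ k, A i k * s k x := by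
    intro s; funext i
    simp only [covDir, hA, Finset.sum_mul]
    rw [Finset.sum_comm]
  rw [hcov, hcov]
  have hD : ∀ i j, fderiv ℝ (fun y => T.G c y i j) (F x) (fderiv ℝ F x u) =
      ∑ l, (A l i * T.G c (F x) l j + (starRingEnd ℂ) (A l j) * T.G c (F x) i l) := by
    intro i j; rw [hFx]; exact T.compat c _ i j
  simp only [sum_apply, add_apply, smul_apply, smul_eq_mul, ContinuousLinearMap.comp_apply, hD,
    formG, map_add, map_sum, map_mul, ContinuousLinearEquiv.coe_coe, Complex.conjCLE_apply]
  -- Renaming of summation indices moves the connection coefficients from the metric onto `s`; the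
  -- analogous `e2` moves them onto `t`.
  have e1 : ∑ i, ∑ j, ∑ l, A l i * T.G c (F x) l j * s i x * (starRingEnd ℂ) (t j x) =
      ∑ i, ∑ j, ∑ l, A i l * T.G c (F x) i j * s l x * (starRingEnd ℂ) (t j x) := by
    calc _ = ∑ i, ∑ l, ∑ j, A l i * T.G c (F x) l j * s i x * (starRingEnd ℂ) (t j x) :=
          Finset.sum_congr rfl fun _ _ => Finset.sum_comm
      _ = ∑ l, ∑ i, ∑ j, A l i * T.G c (F x) l j * s i x * (starRingEnd ℂ) (t j x) :=
          Finset.sum_comm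
      _ = _ := Finset.sum_congr rfl fun _ _ => Finset.sum_comm
  have e2 : ∑ i, ∑ j, ∑ l, (starRingEnd ℂ) (A l j) * T.G c (F x) i l * s i x *
        (starRingEnd ℂ) (t j x) =
      ∑ i, ∑ j, ∑ l, (starRingEnd ℂ) (A j l) * T.G c (F x) i j * s i x *
        (starRingEnd ℂ) (t l x) :=
    Finset.sum_congr rfl fun _ _ => Finset.sum_comm
  have e3 : ∀ i j, (T.G c (F x) i j * s i x * (starRingEnd ℂ) (fderiv ℝ (t j) x u) +
      (starRingEnd ℂ) (t j x) * (T.G c (F x) i j * fderiv ℝ (s i) x u + s i x *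
        ∑ l, (A l i * T.G c (F x) l j + (starRingEnd ℂ) (A l j) * T.G c (F x) i l))) =
      T.G c (F x) i j * s i x * (starRingEnd ℂ) (fderiv ℝ (t j) x u) +
      T.G c (F x) i j * fderiv ℝ (s i) x u * (starRingEnd ℂ) (t j x) +
      ∑ l, A l i * T.G c (F x) l j * s i x * (starRingEnd ℂ) (t j x) +
      ∑ l, (starRingEnd ℂ) (A l j) * T.G c (F x) i l * s i x * (starRingEnd ℂ) (t j x) := by
    intro i j
    have : s i x * ∑ l, (A l i * T.G c (F x) l j + (starRingEnd ℂ) (A l j) * T.G c (F x) i l) *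
        (starRingEnd ℂ) (t j x) =
      ∑ l, A l i * T.G c (F x) l j * s i x * (starRingEnd ℂ) (t j x) +
      ∑ l, (starRingEnd ℂ) (A l j) * T.G c (F x) i l * s i x * (starRingEnd ℂ) (t j x) := by
      rw [← Finset.sum_add_distrib, Finset.mul_sum]
      exact Finset.sum_congr rfl fun l _ => by ring
    rw [add_assoc (_ + _), ← this, ← Finset.sum_mul]
    ring
  refine (Finset.sum_congr rfl fun i _ => Finset.sum_congr rfl fun j _ => e3 i j).trans ?_
  simp only [Finset.sum_add_distrib]
  rw [e1, e2]
  simp only [← Finset.sum_add_distrib]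
  refine Finset.sum_congr rfl fun i _ => Finset.sum_congr rfl fun j _ => ?_
  have e4 : ∑ l, A i l * T.G c (F x) i j * s l x * (starRingEnd ℂ) (t j x) =
      T.G c (F x) i j * (∑ l, A i l * s l x) * (starRingEnd ℂ) (t j x) := by
    rw [Finset.mul_sum, Finset.sum_mul]
    exact Finset.sum_congr rfl fun l _ => by ring
  have e5 : ∑ l, (starRingEnd ℂ) (A j l) * T.G c (F x) i j * s i x * (starRingEnd ℂ) (t l x) =
      T.G c (F x) i j * s i x * ∑ l, (starRingEnd ℂ) (A j l) * (starRingEnd ℂ) (t l x) := by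
    rw [Finset.mul_sum]
    exact Finset.sum_congr rfl fun l _ => by ring
  rw [e4, e5]
  ring

end TargetFrame

end Target

/-! ### Hessian, tension and pointwise integration by parts in coordinates. -/

section PureCalculus

variable {m n : ℕ} {V : Type*} [NormedAddCommGroup V] [NormedSpace ℝ V]
    {N : Type*} [TopologicalSpace N] [ChartedSpace V N] (T : TargetFrame n V N)

namespace TargetFrame

/-- The local data of a map with coordinate expression `F` at `x`. -/
def dataOf (H : Matrix (Fin m) (Fin m) ℂ) (c : N) (F : CSpace m → V) (x : CSpace m) :
    LocalData m n where
  pt := x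
  h := H
  f i y := T.κ (F y) i
  g := T.G c (F x)
  Γ := T.Γ c

/-- The components of a vector valued function. -/
def comps {E : Type*} (s : E → V) (i : Fin n) (x : E) : ℂ := T.κ (s x) i

/-- The component `i` of a tangent vector, as a real linear form. -/
def κi (i : Fin n) : V →L[ℝ] ℂ := (ContinuousLinearMap.proj i).comp T.κ

theorem fderiv_comps {E : Type*} [NormedAddCommGroup E] [NormedSpace ℝ E] {s : E → V} {x : E}
    (hs : DifferentiableAt ℝ s x) (i : Fin n) (u : E) :
    fderiv ℝ (T.comps s i) x u = T.κ (fderiv ℝ s x u) i := by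
  have := ((T.κi i).hasFDerivAt.comp x hs.hasFDerivAt).fderiv
  exact congrArg (fun A : E →L[ℝ] ℂ => A u) this

theorem differentiableAt_comps {E : Type*} [NormedAddCommGroup E] [NormedSpace ℝ E] {s : E → V}
    {x : E} (hs : DifferentiableAt ℝ s x) (i : Fin n) : DifferentiableAt ℝ (T.comps s i) x :=
  (T.κi i).differentiableAt.comp x hs

/-- The second covariant derivative of a map. -/
def hess {E : Type*} [NormedAddCommGroup E] [NormedSpace ℝ E] (c : N) (F : E → V) (x u w : E) :
    Fin n → ℂ :=
  T.covDir c F x u (T.comps fun y => fderiv ℝ F y w)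

theorem hess_apply {E : Type*} [NormedAddCommGroup E] [NormedSpace ℝ E] (c : N) {F : E → V} {x : E}
    (hF : ContDiffAt ℝ ∞ F x) (u w : E) (i : Fin n) :
    T.hess c F x u w i = T.κ (fderiv ℝ (fderiv ℝ F) x u w) i +
      ∑ j, ∑ k, T.Γ c i j k * T.κ (fderiv ℝ F x u) j * T.κ (fderiv ℝ F x w) k := by
  have hd : DifferentiableAt ℝ (fderiv ℝ F) x :=
    (hF.fderiv_right (m := ∞) (by simp)).differentiableAt (by simp)
  have hd' : DifferentiableAt ℝ (fun y => fderiv ℝ F y w) x :=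
    hd.clm_apply (differentiableAt_const w)
  rw [hess, covDir, T.fderiv_comps hd']
  rw [fderiv_clm_apply hd (differentiableAt_const w)]
  simp [comps]

/-- Second derivatives commute and the Christoffel symbols are symmetric, i.e. the connection has no
torsion. Two consequences carry the theorem: the tension does not depend on the sign ε, and the
covariant derivatives in time and space can be exchanged. -/
theorem hess_symm {E : Type*} [NormedAddCommGroup E] [NormedSpace ℝ E] (c : N) {F : E → V} {x : E}
    (hF : ContDiffAt ℝ ∞ F x) (u w : E) : T.hess c F x u w = T.hess c F x w u := by
  funext i
  have h1 : fderiv ℝ (fderiv ℝ F) x u w = fderiv ℝ (fderiv ℝ F) x w u :=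
    (hF.isSymmSndFDerivAt (by simpa using two_le_infty)) u w
  rw [T.hess_apply c hF, T.hess_apply c hF, h1, Finset.sum_comm]
  congr 1
  refine Finset.sum_congr rfl fun j _ => Finset.sum_congr rfl fun k _ => ?_
  rw [T.symm c i k j]
  ring

/-- The component of type `(1,1)` of the second covariant derivative. -/
def mixHess (ε : ℂ) (c : N) (F : CSpace m → V) (x : CSpace m) (α β : Fin m) : Fin n → ℂ :=
  (1 / 4 : ℂ) • (T.hess c F x (cBasis α) (cBasis β) +
    T.hess c F x (Complex.I • cBasis α) (Complex.I • cBasis β) +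
    (ε * Complex.I) • (T.hess c F x (cBasis α) (Complex.I • cBasis β) -
      T.hess c F x (Complex.I • cBasis α) (cBasis β)))

theorem dfE_dataOf (H : Matrix (Fin m) (Fin m) ℂ) (c : N) {F : CSpace m → V} {x : CSpace m}
    (hF : DifferentiableAt ℝ F x) (ε : ℂ) (α : Fin m) :
    (T.dataOf H c F x).dfE ε α = (1 / 2 : ℂ) • (T.κ (fderiv ℝ F x (cBasis α)) +
      (ε * Complex.I) • T.κ (fderiv ℝ F x (Complex.I • cBasis α))) := by
  funext i
  have h := fun u => T.fderiv_comps hF i u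
  simp only [LocalData.dfE, dE, Pi.smul_apply, Pi.add_apply, smul_eq_mul, ← h]
  rfl

theorem covE_dataOf (H : Matrix (Fin m) (Fin m) ℂ) (c : N) {F : CSpace m → V} {x : CSpace m}
    (hF : DifferentiableAt ℝ F x) (ε : ℂ) (s : Fin n → CSpace m → ℂ) (α : Fin m) :
    (T.dataOf H c F x).covE ε s α = (1 / 2 : ℂ) • (T.covDir c F x (cBasis α) s +
      (ε * Complex.I) • T.covDir c F x (Complex.I • cBasis α) s) := by
  funext i
  rw [LocalData.covE, dfE_dataOf T H c hF]
  simp only [covDir, dE, Pi.smul_apply, Pi.add_apply, smul_eq_mul]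
  change _ * (fderiv ℝ (s i) x _ + _ * fderiv ℝ (s i) x _) + ∑ j, ∑ k, T.Γ c i j k * _ * s k x = _
  have : ∀ j k, T.Γ c i j k * (1 / 2 * (T.κ (fderiv ℝ F x (cBasis α)) j +
      ε * Complex.I * T.κ (fderiv ℝ F x (Complex.I • cBasis α)) j)) * s k x =
      (1 / 2) * (T.Γ c i j k * T.κ (fderiv ℝ F x (cBasis α)) j * s k x) +
      (1 / 2) * (ε * Complex.I) *
        (T.Γ c i j k * T.κ (fderiv ℝ F x (Complex.I • cBasis α)) j * s k x) :=
    fun j k => by ring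
  simp only [this, Finset.sum_add_distrib, ← Finset.mul_sum]
  ring

/-- Expanding ∂_α∂̄_β into real directions gives the (1,1)-part of the second derivative. The
quadratic term pairs ∂̄f with ∂f in a fixed order, and symmetry of the Christoffel symbols rewrites
it as the (1,1)-part of the connection term in the Hessian. -/
theorem tension_dataOf (H : Matrix (Fin m) (Fin m) ℂ) (c : N) {F : CSpace m → V} {x : CSpace m}
    (hF : ContDiffAt ℝ ∞ F x) :
    (T.dataOf H c F x).tension = ∑ α, ∑ β, raise H α β • T.mixHess 1 c F x α β := by
  funext i
  have hF1 : DifferentiableAt ℝ F x := hF.differentiableAt (by simp)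
  rw [LocalData.tension, LocalData.dbar_eq, LocalData.del_eq]
  simp only [Finset.sum_apply, Pi.smul_apply, smul_eq_mul]
  refine Finset.sum_congr rfl fun α _ => Finset.sum_congr rfl fun β _ => ?_
  refine congrArg (raise H α β * ·) ?_
  rw [T.dfE_dataOf H c hF1, T.dfE_dataOf H c hF1]
  have hd : DifferentiableAt ℝ (fderiv ℝ F) x :=
    (hF.fderiv_right (m := ∞) (by simp)).differentiableAt (by simp)
  have hd' : ∀ w, DifferentiableAt ℝ (fun y => T.κ (fderiv ℝ F y w) i) x := fun w =>
    T.differentiableAt_comps (hd.clm_apply (differentiableAt_const w)) i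
  have hev : dzbar β ((T.dataOf H c F x).f i) =ᶠ[𝓝 x] fun y => (1 / 2) *
      (T.κ (fderiv ℝ F y (cBasis β)) i + Complex.I *
        T.κ (fderiv ℝ F y (Complex.I • cBasis β)) i) := by
    filter_upwards [(hF.of_le (n := ∞) (m := 1) (by simp)).eventually (by simp)] with y hy
    have h := fun u => T.fderiv_comps (hy.differentiableAt (by simp)) i u
    simp only [dzbar, ← h]
    rfl
  have h2 : ∀ u, fderiv ℝ (dzbar β ((T.dataOf H c F x).f i)) x u = (1 / 2) *
      (T.κ (fderiv ℝ (fderiv ℝ F) x u (cBasis β)) i + Complex.I *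
        T.κ (fderiv ℝ (fderiv ℝ F) x u (Complex.I • cBasis β)) i) := by
    intro u
    have h3 : ∀ w, fderiv ℝ (fun y => T.κ (fderiv ℝ F y w) i) x u =
        T.κ (fderiv ℝ (fderiv ℝ F) x u w) i := by
      intro w
      have h4 : fderiv ℝ (fun y => T.κ (fderiv ℝ F y w) i) x u = _ :=
        T.fderiv_comps (hd.clm_apply (differentiableAt_const w)) i u
      rw [fderiv_clm_apply hd (differentiableAt_const w)] at h4
      simpa using h4
    have h5 : HasFDerivAt (fun y => (1 / 2 : ℂ) * (T.κ (fderiv ℝ F y (cBasis β)) i +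
        Complex.I * T.κ (fderiv ℝ F y (Complex.I • cBasis β)) i)) _ x :=
      ((hd' (cBasis β)).hasFDerivAt.add
        ((hd' (Complex.I • cBasis β)).hasFDerivAt.const_mul Complex.I)).const_mul (1 / 2 : ℂ)
    rw [hev.fderiv_eq, h5.fderiv]
    simp only [smul_apply, add_apply, smul_eq_mul, h3]
  change dz α (dzbar β ((T.dataOf H c F x).f i)) x + _ = _
  rw [dz, h2, h2]
  simp only [mixHess, Pi.smul_apply, Pi.add_apply, Pi.sub_apply, smul_eq_mul, T.hess_apply c hF]
  change _ + ∑ j, ∑ k, T.Γ c i j k * _ * _ = _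
  have h5 : ∀ a b a' b' : Fin n → ℂ, ∑ j, ∑ k, T.Γ c i j k *
      (1 / 2 * (a j + 1 * Complex.I * b j)) * (1 / 2 * (a' k + -1 * Complex.I * b' k)) =
      (1 / 4) * (∑ j, ∑ k, T.Γ c i j k * a' j * a k + ∑ j, ∑ k, T.Γ c i j k * b' j * b k +
        Complex.I * (∑ j, ∑ k, T.Γ c i j k * a' j * b k -
          ∑ j, ∑ k, T.Γ c i j k * b' j * a k)) := by
    intro a b a' b'
    rw [Finset.sum_comm]
    simp only [Finset.mul_sum, ← Finset.sum_add_distrib, ← Finset.sum_sub_distrib]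
    refine Finset.sum_congr rfl fun j _ => Finset.sum_congr rfl fun k _ => ?_
    rw [T.symm c i k j]
    linear_combination (-(1 / 4) * T.Γ c i j k * b k * b' j) * Complex.I_sq
  rw [h5]
  linear_combination (-(1 / 4)) * T.κ (fderiv ℝ (fderiv ℝ F) x (Complex.I • cBasis α)
    (Complex.I • cBasis β)) i * Complex.I_sq

/-- For ε = -1 both the coefficient matrix and the (1,1)-part of the Hessian are transposed, the
latter by symmetry of the Hessian, so the trace is unchanged. This is why ∂ and ∂̄ lead to one and
the same equation. The conjugate anticipates the second, conjugate linear slot of `formG`. -/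
theorem sum_mixHess {H : Matrix (Fin m) (Fin m) ℂ} (hH : H.IsHermitian) (c : N)
    {F : CSpace m → V} {x : CSpace m} (hF : ContDiffAt ℝ ∞ F x) {ε : ℂ} (hε : ε = 1 ∨ ε = -1) :
    ∑ α, ∑ β, (starRingEnd ℂ) (kmat ε H α β) • T.mixHess ε c F x α β =
      (T.dataOf H c F x).tension := by
  rw [T.tension_dataOf H c hF]
  simp only [kmat_conj hH hε]
  rcases hε with rfl | rfl
  · simp only [kmat_one, raise]
  · rw [Finset.sum_comm]
    refine Finset.sum_congr rfl fun α _ => Finset.sum_congr rfl fun β _ => ?_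
    simp only [kmat_neg_one, Matrix.transpose_apply, raise]
    congr 1
    simp only [mixHess, T.hess_symm c hF (cBasis β),
      T.hess_symm c hF (Complex.I • cBasis β)]
    module

/-- The derivatives of the inner products of a section with the differential of the map. -/
def pairDeriv (c : N) (F s : CSpace m → V) (x u w : CSpace m) : ℂ :=
  fderiv ℝ (fun y => formG (T.G c (F y)) (T.κ (s y)) (T.κ (fderiv ℝ F y w))) x u

/-- Integration by parts, pointwise. -/
theorem pairE_add_tension [IsManifold 𝓘(ℝ, V) ∞ N] {H : Matrix (Fin m) (Fin m) ℂ}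
    (hH : H.IsHermitian) (c : N)
    {F s : CSpace m → V} {x : CSpace m} (hF : ContDiffAt ℝ ∞ F x)
    (hFx : F x = extChartAt 𝓘(ℝ, V) c c) (hs : DifferentiableAt ℝ s x)
    {ε : ℂ} (hε : ε = 1 ∨ ε = -1) :
    ∑ α, ∑ β, kmat ε H α β * ((1 / 4) *
      (T.pairDeriv c F s x (cBasis α) (cBasis β) +
       T.pairDeriv c F s x (Complex.I • cBasis α) (Complex.I • cBasis β) +
       ε * Complex.I * (T.pairDeriv c F s x (Complex.I • cBasis α) (cBasis β) -
         T.pairDeriv c F s x (cBasis α) (Complex.I • cBasis β)))) =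
    (T.dataOf H c F x).pairE ε (T.comps s) +
      formG (T.G c (F x)) (T.κ (s x)) (T.dataOf H c F x).tension := by
  have hF1 : DifferentiableAt ℝ F x := hF.differentiableAt (by simp)
  have hd : DifferentiableAt ℝ (fderiv ℝ F) x :=
    (hF.fderiv_right (m := ∞) (by simp)).differentiableAt (by simp)
  -- Metric compatibility along `F`; the derivative of the differential of `F` is the Hessian by
  -- definition.
  have hP : ∀ u w, T.pairDeriv c F s x u w =
      formG (T.G c (F x)) (T.covDir c F x u (T.comps s)) (T.κ (fderiv ℝ F x w)) +
      formG (T.G c (F x)) (T.κ (s x)) (T.hess c F x u w) := fun u w =>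
    T.fderiv_formG c hF1 hFx (fun i => T.differentiableAt_comps hs i)
      (fun i => T.differentiableAt_comps (hd.clm_apply (differentiableAt_const w)) i) u
  have hform : ∀ a : Fin n → ℂ, formG (T.G c (F x)) a (T.dataOf H c F x).tension =
      ∑ α, ∑ β, kmat ε H α β * formG (T.G c (F x)) a (T.mixHess ε c F x α β) := by
    intro a
    rw [← T.sum_mixHess hH c hF hε]
    have hadd : ∀ (ι : Type) (S : Finset ι) (b : ι → Fin n → ℂ),
        formG (T.G c (F x)) a (∑ i ∈ S, b i) = ∑ i ∈ S, formG (T.G c (F x)) a (b i) :=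
      fun ι S b => map_sum (formGR (T.G c (F x)) a) b S
    simp only [hadd, formG_smul_right, Complex.conj_conj]
  rw [hform, LocalData.pairE, LocalData.innerE, ← Finset.sum_add_distrib]
  refine Finset.sum_congr rfl fun α _ => ?_
  rw [← Finset.sum_add_distrib]
  refine Finset.sum_congr rfl fun β _ => ?_
  rw [T.covE_dataOf H c hF1, T.dfE_dataOf H c hF1]
  have hsub : ∀ a b b' : Fin n → ℂ, formG (T.G c (F x)) a (b - b') =
      formG (T.G c (F x)) a b - formG (T.G c (F x)) a b' :=
    fun a b b' => map_sub (formGR (T.G c (F x)) a) b b'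
  change _ = kmat ε H α β * formG (T.G c (F x)) _ _ + _
  simp only [hP, mixHess, formG_smul_left, formG_smul_right, formG_add_left, formG_add_right, hsub,
    map_mul, conj_sign hε, Complex.conj_I, map_div₀, map_one, map_ofNat]
  have h1 := sign_sq hε
  -- The only discrepancy is in the term with both directions multiplied by i: there ε² = 1 and i² =
  -- -1 are needed.
  linear_combination (kmat ε H α β * (1 / 4) * formG (T.G c (F x))
    (T.covDir c F x (Complex.I • cBasis α) (T.comps s))
    (T.κ (fderiv ℝ F x (Complex.I • cBasis β)))) * (ε * ε * Complex.I_sq - h1)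

end TargetFrame

end PureCalculus

/-! ### Smoothness of coordinate expressions and of sections along a map. -/

section Smoothness

variable {W V : Type*} [NormedAddCommGroup W] [NormedSpace ℝ W]
  [NormedAddCommGroup V] [NormedSpace ℝ V]
  {M : Type*} [TopologicalSpace M] [ChartedSpace W M]
  {N : Type*} [TopologicalSpace N] [ChartedSpace V N]

/-- The domain of the coordinate expression of a map. -/
def locDom (b : M) (c : N) (f : M → N) : Set W :=
  (extChartAt 𝓘(ℝ, W) b).target ∩ (extChartAt 𝓘(ℝ, W) b).symm ⁻¹'
    (f ⁻¹' (extChartAt 𝓘(ℝ, V) c).source)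

theorem isOpen_locDom (b : M) (c : N) {f : M → N} (hf : Continuous f) :
    IsOpen (locDom (W := W) (V := V) b c f) :=
  (continuousOn_extChartAt_symm b).isOpen_inter_preimage (isOpen_extChartAt_target b)
    ((isOpen_extChartAt_source c).preimage hf)

theorem center_mem_locDom (p : M) (f : M → N) :
    extChartAt 𝓘(ℝ, W) p p ∈ locDom (W := W) (V := V) p (f p) f := by
  refine ⟨mem_extChartAt_target p, ?_⟩
  rw [mem_preimage, mem_preimage, extChartAt_to_inv]
  exact mem_extChartAt_source _

theorem locMap_center (p : M) (f : M → N) :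
    locMap (W := W) (V := V) p (f p) f (extChartAt 𝓘(ℝ, W) p p) = extChartAt 𝓘(ℝ, V) (f p) (f p) := by
  rw [locMap, extChartAt_to_inv]

theorem locMap_mem_target (b : M) (c : N) {f : M → N} {y : W}
    (hy : y ∈ locDom (W := W) (V := V) b c f) :
    locMap b c f y ∈ (extChartAt 𝓘(ℝ, V) c).target :=
  (extChartAt 𝓘(ℝ, V) c).map_source hy.2

theorem secLoc_eq (f : M → N) (X : ∀ p : M, TangentSpace 𝓘(ℝ, V) (f p)) (p : M) (x : W) :
    secLoc f X p x = chartDeriv (V := V) (f p) (f ((extChartAt 𝓘(ℝ, W) p).symm x))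
      (X ((extChartAt 𝓘(ℝ, W) p).symm x)) := rfl

variable [IsManifold 𝓘(ℝ, V) ∞ N]

/-- Identifies the bundle trivialization with the derivative of the chart, so that smoothness of a
section can be tested on its components `secLoc`. -/
theorem trivializationAt_snd {c q : N} (hq : q ∈ (chartAt V c).source)
    (v : TangentSpace 𝓘(ℝ, V) q) :
    (trivializationAt V (TangentSpace 𝓘(ℝ, V)) c (⟨q, v⟩ : TangentBundle 𝓘(ℝ, V) N)).2 =
      chartDeriv (V := V) c q v := by
  have : IsManifold 𝓘(ℝ, V) 1 N := .of_le (n := ∞) (by simp)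
  have h1 := TangentBundle.continuousLinearMapAt_trivializationAt (I := 𝓘(ℝ, V)) hq
  have h2 : Bundle.Trivialization.continuousLinearMapAt ℝ
    (trivializationAt V (TangentSpace 𝓘(ℝ, V)) c) q v = chartDeriv (V := V) c q v := by rw [h1]; rfl
  rw [← h2, Bundle.Trivialization.continuousLinearMapAt_apply,
    Bundle.Trivialization.coe_linearMapAt_of_mem]
  simpa using hq

theorem isSmoothAlong_of_secLoc {f : M → N} (hf : ContMDiff 𝓘(ℝ, W) 𝓘(ℝ, V) ∞ f)
    {X : ∀ p : M, TangentSpace 𝓘(ℝ, V) (f p)}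
    (hX : ∀ p, ContDiffAt ℝ ∞ (secLoc (W := W) f X p) (extChartAt 𝓘(ℝ, W) p p)) :
    IsSmoothAlong (W := W) f X := by
  intro p
  refine Bundle.contMDiffAt_totalSpace.2 ⟨hf p, ?_⟩
  have h1 := (hX p).contMDiffAt.comp p (contMDiffAt_extChartAt (I := 𝓘(ℝ, W)) (n := ∞))
  refine h1.congr_of_eventuallyEq ?_
  filter_upwards [extChartAt_source_mem_nhds (I := 𝓘(ℝ, W)) p,
    hf.continuous.continuousAt.preimage_mem_nhds ((chartAt V (f p)).open_source.mem_nhds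
      (mem_chart_source V (f p)))] with q hq hq'
  simp only [Function.comp, secLoc_eq]
  rw [trivializationAt_snd hq', (extChartAt 𝓘(ℝ, W) p).left_inv hq]

theorem coordVecL_secLoc (f : M → N) (X : ∀ p : M, TangentSpace 𝓘(ℝ, V) (f p)) (p : M) {y : W}
    (hy : y ∈ locDom (W := W) (V := V) p (f p) f) :
    coordVecL (f p) (locMap p (f p) f y) (secLoc f X p y) =
      X ((extChartAt 𝓘(ℝ, W) p).symm y) :=
  coordVecL_chartDeriv' (f p) hy.2 _

theorem secLoc_center (f : M → N) (X : ∀ p : M, TangentSpace 𝓘(ℝ, V) (f p)) (p : M) :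
    secLoc f X p (extChartAt 𝓘(ℝ, W) p p) = X p := by
  rw [secLoc_eq, extChartAt_to_inv]
  exact chartDeriv_center _ _

variable [IsManifold 𝓘(ℝ, W) ∞ M]

theorem contDiffOn_locMap (b : M) (c : N) {f : M → N} (hf : ContMDiff 𝓘(ℝ, W) 𝓘(ℝ, V) ∞ f) :
    ContDiffOn ℝ ∞ (locMap (W := W) (V := V) b c f) (locDom (W := W) (V := V) b c f) := by
  rw [← contMDiffOn_iff_contDiffOn]
  exact (contMDiffOn_extChartAt (I := 𝓘(ℝ, V)) (n := ∞) (x := c)).comp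
    (hf.comp_contMDiffOn ((contMDiffOn_extChartAt_symm b).mono inter_subset_left))
    (fun y hy => by simpa [extChartAt_source] using hy.2)

theorem contDiffAt_locMap (b : M) (c : N) {f : M → N} (hf : ContMDiff 𝓘(ℝ, W) 𝓘(ℝ, V) ∞ f)
    {y : W} (hy : y ∈ locDom (W := W) (V := V) b c f) :
    ContDiffAt ℝ ∞ (locMap (W := W) (V := V) b c f) y :=
  (contDiffOn_locMap b c hf).contDiffAt ((isOpen_locDom b c hf.continuous).mem_nhds hy)

theorem IsSmoothAlong.contDiffOn_secLoc {f : M → N} (hf : ContMDiff 𝓘(ℝ, W) 𝓘(ℝ, V) ∞ f)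
    {X : ∀ p : M, TangentSpace 𝓘(ℝ, V) (f p)} (hX : IsSmoothAlong (W := W) f X) (p : M) :
    ContDiffOn ℝ ∞ (secLoc (W := W) f X p) (locDom (W := W) (V := V) p (f p) f) := by
  intro y hy
  refine ContDiffAt.contDiffWithinAt ?_
  have hq : f ((extChartAt 𝓘(ℝ, W) p).symm y) ∈ (chartAt V (f p)).source := by
    simpa [extChartAt_source] using hy.2
  have h1 := (Bundle.Trivialization.contMDiffAt_iff
    (e := trivializationAt V (TangentSpace 𝓘(ℝ, V)) (f p)) (IB := 𝓘(ℝ, V)) (n := ∞)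
    (f := fun p => (⟨f p, X p⟩ : TangentBundle 𝓘(ℝ, V) N))
    (x₀ := (extChartAt 𝓘(ℝ, W) p).symm y) (by simpa using hq)).1 (hX _)
  have h2 := h1.2.comp y ((contMDiffOn_extChartAt_symm p).contMDiffAt (target_mem_nhds p hy.1))
  refine h2.contDiffAt.congr_of_eventuallyEq ?_
  filter_upwards [(isOpen_locDom p (f p) hf.continuous).mem_nhds hy] with y' hy'
  exact (trivializationAt_snd (by simpa [extChartAt_source] using hy'.2) _).symm

end Smoothness

/-! ### The one-form ⟨X, df⟩ and its divergence. -/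

section Zeta

variable {m : ℕ} {M : Type*} [TopologicalSpace M] [ChartedSpace (CSpace m) M]
  [IsManifold 𝓘(ℂ, CSpace m) ω M]
  {n : ℕ} {V : Type*} [NormedAddCommGroup V] [NormedSpace ℝ V]
  {N : Type*} [TopologicalSpace N] [ChartedSpace V N] [IsManifold 𝓘(ℝ, V) ∞ N]
  (T : TargetFrame n V N) (h : RiemMetric (CSpace m) M)

namespace TargetFrame

/-- The local expression of `f` at `p` in the charts centred at `p` and `f p`. -/
def localData (f : M → N) (p : M) : LocalData m n :=
  T.dataOf (hermMatrix h p (extChartAt 𝓘(ℝ, CSpace m) p p)) (f p) (locMap p (f p) f)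
    (extChartAt 𝓘(ℝ, CSpace m) p p)

/-- The inner products of the section `X` with the differential of `f`. -/
def zeta (f : M → N) (X : ∀ p : M, TangentSpace 𝓘(ℝ, V) (f p)) (q : M) : CSpace m →L[ℝ] ℂ :=
  ((formGR (T.G (f q) (extChartAt 𝓘(ℝ, V) (f q) (f q))) (T.κ (X q))).comp T.κ).comp
    (mapDeriv f q)

/-- The real part of `zeta`. -/
def zetaRe (f : M → N) (X : ∀ p : M, TangentSpace 𝓘(ℝ, V) (f p)) (q : M) :
    TangentSpace 𝓘(ℝ, CSpace m) q →L[ℝ] ℝ :=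
  Complex.reCLM.comp (T.zeta f X q)

/-- The imaginary part of `zeta`. -/
def zetaIm (f : M → N) (X : ∀ p : M, TangentSpace 𝓘(ℝ, V) (f p)) (q : M) :
    TangentSpace 𝓘(ℝ, CSpace m) q →L[ℝ] ℝ :=
  Complex.imCLM.comp (T.zeta f X q)

variable {T h}
variable {f : M → N} (hf : ContMDiff 𝓘(ℝ, CSpace m) 𝓘(ℝ, V) ∞ f)
  {X : ∀ p : M, TangentSpace 𝓘(ℝ, V) (f p)} (hX : IsSmoothAlong (W := CSpace m) f X)

-- `zeta` uses the metric in the chart centred at each image point. The field `change` transports it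
-- to the fixed chart at `f p`, giving an expression that can be differentiated.
include hf in
theorem zeta_coordVecL (p : M) {y : CSpace m} (hy : y ∈ locDom (W := CSpace m) (V := V) p (f p) f)
    (w : CSpace m) :
    T.zeta f X ((extChartAt 𝓘(ℝ, CSpace m) p).symm y) (coordVecL p y w) =
      formG (T.G (f p) (locMap p (f p) f y)) (T.κ (secLoc f X p y))
        (T.κ (fderiv ℝ (locMap p (f p) f) y w)) := by
  have h1 := mfderiv_coordVecL p (f p) f hy.1 ((hf _).mdifferentiableAt (by simp)) hy.2 w
  simp only [zeta, ContinuousLinearMap.comp_apply, formGR_apply]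
  rw [h1, ← coordVecL_secLoc f X p hy]
  exact T.change (f p) _ (locMap_mem_target p (f p) hy) _
    ((extChartAt 𝓘(ℝ, V) (f p)).left_inv hy.2) _ _

include hf hX in
theorem contDiffOn_zeta (p : M) (w : CSpace m) :
    ContDiffOn ℝ ∞ (fun y => formG (T.G (f p) (locMap p (f p) f y)) (T.κ (secLoc f X p y))
        (T.κ (fderiv ℝ (locMap p (f p) f) y w))) (locDom (W := CSpace m) (V := V) p (f p) f) := by
  have h1 := contDiffOn_locMap p (f p) hf
  have h2 := (h1.fderiv_of_isOpen (isOpen_locDom p (f p) hf.continuous) (m := ∞) (by simp)).clm_apply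
    (contDiffOn_const (c := w))
  have h3 := hX.contDiffOn_secLoc hf p
  unfold formG
  refine ContDiffOn.sum fun i _ => ContDiffOn.sum fun j _ => ?_
  have hG := (T.contDiffOn_G (f p) i j).comp h1 (fun y hy => locMap_mem_target p (f p) hy)
  exact (hG.mul ((T.κi i).contDiff.comp_contDiffOn h3)).mul
    ((Complex.conjCLE : ℂ →L[ℝ] ℂ).contDiff.comp_contDiffOn ((T.κi j).contDiff.comp_contDiffOn h2))

include hf hX in
theorem isSmoothOneForm_zetaRe : IsSmoothOneForm (m := m) (M := M) (T.zetaRe f X) := by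
  refine isSmoothOneForm_of_formLoc _ fun p => ⟨locDom (W := CSpace m) (V := V) p (f p) f,
    (isOpen_locDom p (f p) hf.continuous).mem_nhds (center_mem_locDom p f), fun w => ?_⟩
  refine (Complex.reCLM.contDiff.comp_contDiffOn (contDiffOn_zeta (T := T) hf hX p w)).congr fun y hy => ?_
  exact congrArg Complex.re (zeta_coordVecL hf p hy w)

include hf hX in
theorem isSmoothOneForm_zetaIm : IsSmoothOneForm (m := m) (M := M) (T.zetaIm f X) := by
  refine isSmoothOneForm_of_formLoc _ fun p => ⟨locDom (W := CSpace m) (V := V) p (f p) f,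
    (isOpen_locDom p (f p) hf.continuous).mem_nhds (center_mem_locDom p f), fun w => ?_⟩
  refine (Complex.imCLM.contDiff.comp_contDiffOn (contDiffOn_zeta (T := T) hf hX p w)).congr fun y hy => ?_
  exact congrArg Complex.im (zeta_coordVecL hf p hy w)

include hf hX in
theorem formDeriv_zeta (p : M) (u w : CSpace m) :
    (formDeriv (T.zetaRe f X) p (extChartAt 𝓘(ℝ, CSpace m) p p) u w : ℂ) + Complex.I *
      (formDeriv (T.zetaIm f X) p (extChartAt 𝓘(ℝ, CSpace m) p p) u w : ℂ) =
    T.pairDeriv (f p) (locMap p (f p) f) (secLoc f X p) (extChartAt 𝓘(ℝ, CSpace m) p p) u w := by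
  have hp := center_mem_locDom (W := CSpace m) (V := V) p f
  have hnhds := (isOpen_locDom p (f p) hf.continuous).mem_nhds hp
  have hd := ((contDiffOn_zeta (T := T) hf hX p w).contDiffAt hnhds).differentiableAt (by simp)
  rw [← (isSmoothOneForm_zetaRe hf hX).fderiv_formLoc p (mem_extChartAt_target p),
    ← (isSmoothOneForm_zetaIm hf hX).fderiv_formLoc p (mem_extChartAt_target p)]
  have e1 : (fun y => formLoc (T.zetaRe f X) p y w) =ᶠ[𝓝 (extChartAt 𝓘(ℝ, CSpace m) p p)]
      fun y => Complex.reCLM (formG (T.G (f p) (locMap p (f p) f y)) (T.κ (secLoc f X p y))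
        (T.κ (fderiv ℝ (locMap p (f p) f) y w))) := by
    filter_upwards [hnhds] with y hy
    exact congrArg Complex.re (zeta_coordVecL hf p hy w)
  have e2 : (fun y => formLoc (T.zetaIm f X) p y w) =ᶠ[𝓝 (extChartAt 𝓘(ℝ, CSpace m) p p)]
      fun y => Complex.imCLM (formG (T.G (f p) (locMap p (f p) f y)) (T.κ (secLoc f X p y))
        (T.κ (fderiv ℝ (locMap p (f p) f) y w))) := by
    filter_upwards [hnhds] with y hy
    exact congrArg Complex.im (zeta_coordVecL hf p hy w)
  have h1 := (Complex.reCLM.hasFDerivAt.comp _ hd.hasFDerivAt).fderiv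
  have h2 := (Complex.imCLM.hasFDerivAt.comp _ hd.hasFDerivAt).fderiv
  rw [e1.fderiv_eq, e2.fderiv_eq]
  have h1' := congrArg (fun A : CSpace m →L[ℝ] ℝ => A u) h1
  have h2' := congrArg (fun A : CSpace m →L[ℝ] ℝ => A u) h2
  refine (congrArg₂ (fun a b : ℝ => (a : ℂ) + Complex.I * (b : ℂ)) h1' h2').trans ?_
  simp only [ContinuousLinearMap.comp_apply, Complex.reCLM_apply, Complex.imCLM_apply, pairDeriv]
  rw [mul_comm Complex.I, Complex.re_add_im]

include hf hX in
/-- Integration by parts: the pairing of the covariant derivative of a section with the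
differential of `f`, as a divergence and a term containing the tension. -/
theorem divForm_zeta (hh : IsHermitian h) {ε : ℂ} (hε : ε = 1 ∨ ε = -1) (p : M) :
    divForm ε h (T.zetaRe f X) p + Complex.I * divForm ε h (T.zetaIm f X) p =
      (T.localData h f p).pairE ε (T.comps (secLoc f X p)) +
        formG (T.G (f p) (extChartAt 𝓘(ℝ, V) (f p) (f p))) (T.κ (X p))
          (T.localData h f p).tension := by
  have hp := center_mem_locDom (W := CSpace m) (V := V) p f
  have hnhds := (isOpen_locDom p (f p) hf.continuous).mem_nhds hp
  have hH : (hermMatrix h p (extChartAt 𝓘(ℝ, CSpace m) p p)).IsHermitian := by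
    rw [hermMatrix_center]
    exact Matrix.IsHermitian.ext fun i j => (isHermitianInner_metricAt hh p).gram_conj _ j i
  -- The divergences of the real and imaginary parts recombine linearly into the contraction of
  -- `pairDeriv`, and the coordinate identity applies.
  have key := T.pairE_add_tension hH (f p) (contDiffAt_locMap p (f p) hf hp) (locMap_center p f)
    (((hX.contDiffOn_secLoc hf p).contDiffAt hnhds).differentiableAt (by simp)) hε
  rw [secLoc_center, locMap_center] at key
  refine Eq.trans ?_ key
  simp only [← formDeriv_zeta hf hX, divForm, contr, polar, toBilin_apply, Finset.mul_sum,
    ← Finset.sum_add_distrib]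
  exact Finset.sum_congr rfl fun α _ => Finset.sum_congr rfl fun β _ => by ring

/-- The divergence term in the integration by parts. -/
def divSec (T : TargetFrame n V N) (h : RiemMetric (CSpace m) M) (ε : ℂ) (f : M → N)
    (X : ∀ p : M, TangentSpace 𝓘(ℝ, V) (f p)) (p : M) : ℂ :=
  divForm ε h (T.zetaRe f X) p + Complex.I * divForm ε h (T.zetaIm f X) p

include hf hX in
theorem continuous_divSec (hh : IsHermitian h) {ε : ℂ} (hε : ε = 1 ∨ ε = -1) :
    Continuous (T.divSec h ε f X) :=
  (continuous_divForm hε hh (isSmoothOneForm_zetaRe hf hX)).add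
    (continuous_const.mul (continuous_divForm hε hh (isSmoothOneForm_zetaIm hf hX)))

variable [CompactSpace M] [T2Space M] [MeasurableSpace M] [BorelSpace M]

include hf hX in
theorem integral_divSec (hh : IsHermitian h) (hb : IsBalanced h) {ε : ℂ}
    (hε : ε = 1 ∨ ε = -1) : ∫ p, T.divSec h ε f X p ∂(volumeMeasure h) = 0 := by
  have h1 := integrable_of_continuous h (continuous_divForm hε hh (isSmoothOneForm_zetaRe (T := T) hf hX))
  have h2 := integrable_of_continuous h (continuous_divForm hε hh (isSmoothOneForm_zetaIm (T := T) hf hX))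
  unfold divSec
  rw [integral_add h1 (h2.const_mul _), integral_const_mul,
    integral_divForm hε hh hb (isSmoothOneForm_zetaRe hf hX),
    integral_divForm hε hh hb (isSmoothOneForm_zetaIm hf hX)]
  simp

end TargetFrame

end Zeta

/-! ### Differentiation of integrals depending on a parameter. -/

section Parametric

variable {m : ℕ} {M : Type*} [TopologicalSpace M] [ChartedSpace (CSpace m) M]

/-- A function on `ℝ × M` which is smooth in the charts of `M`. -/
def IsSmoothFamily (e : ℝ → M → ℝ) : Prop :=
  ∀ (t₀ : ℝ) (p₀ : M), ∃ E : ℝ × CSpace m → ℝ,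
    ContDiffAt ℝ ∞ E (t₀, extChartAt 𝓘(ℝ, CSpace m) p₀ p₀) ∧
    ∀ᶠ q : ℝ × M in 𝓝 (t₀, p₀), e q.1 q.2 = E (q.1, extChartAt 𝓘(ℝ, CSpace m) p₀ q.2)

variable {e : ℝ → M → ℝ}

theorem continuousAt_chart_prod (t₀ : ℝ) (p₀ : M) :
    ContinuousAt (fun q : ℝ × M => (q.1, extChartAt 𝓘(ℝ, CSpace m) p₀ q.2)) (t₀, p₀) :=
  continuousAt_fst.prodMk (ContinuousAt.comp (x := (t₀, p₀)) (f := Prod.snd)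
    (continuousAt_extChartAt p₀) continuousAt_snd)

theorem IsSmoothFamily.continuous (he : IsSmoothFamily (m := m) e) :
    Continuous fun q : ℝ × M => e q.1 q.2 := by
  refine continuous_iff_continuousAt.2 fun ⟨t₀, p₀⟩ => ?_
  obtain ⟨E, hE, heq⟩ := he t₀ p₀
  have h1 : ContinuousAt (fun q : ℝ × M => E (q.1, extChartAt 𝓘(ℝ, CSpace m) p₀ q.2)) (t₀, p₀) :=
    ContinuousAt.comp (x := (t₀, p₀)) (g := E) hE.continuousAt (continuousAt_chart_prod t₀ p₀)
  exact h1.congr (heq.mono fun q hq => hq.symm)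

/-- One chart representative serves for all nearby times and points, so the time derivative is
represented by a single continuous function near the base point; differentiability and joint
continuity of the derivative follow. -/
theorem IsSmoothFamily.hasDerivAt_aux (he : IsSmoothFamily (m := m) e) (t₀ : ℝ) (p₀ : M) :
    ∃ E : ℝ × CSpace m → ℝ, ContDiffAt ℝ ∞ E (t₀, extChartAt 𝓘(ℝ, CSpace m) p₀ p₀) ∧
    ∀ᶠ q : ℝ × M in 𝓝 (t₀, p₀), HasDerivAt (fun t => e t q.2)
      (fderiv ℝ E (q.1, extChartAt 𝓘(ℝ, CSpace m) p₀ q.2) (1, 0)) q.1 := by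
  obtain ⟨E, hE, heq⟩ := he t₀ p₀
  refine ⟨E, hE, ?_⟩
  have h1 := (continuousAt_chart_prod t₀ p₀).eventually
    ((hE.of_le (n := ∞) (m := 1) (by simp)).eventually (by simp))
  filter_upwards [heq.eventually_nhds, h1] with q hq hq1
  have h2 : HasDerivAt (fun t : ℝ => (t, extChartAt 𝓘(ℝ, CSpace m) p₀ q.2)) (1, 0) q.1 :=
    (hasDerivAt_id q.1).prodMk (hasDerivAt_const q.1 _)
  have h3 := (hq1.differentiableAt (by simp)).hasFDerivAt.comp_hasDerivAt q.1 h2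
  have h4 : Tendsto (fun t : ℝ => (t, q.2)) (𝓝 q.1) (𝓝 q) :=
    (Continuous.prodMk continuous_id continuous_const).tendsto' _ _ rfl
  exact h3.congr_of_eventuallyEq (h4.eventually hq)

theorem IsSmoothFamily.hasDerivAt (he : IsSmoothFamily (m := m) e) (t : ℝ) (p : M) :
    HasDerivAt (fun t => e t p) (deriv (fun t => e t p) t) t := by
  obtain ⟨E, -, h⟩ := he.hasDerivAt_aux t p
  exact h.self_of_nhds.differentiableAt.hasDerivAt

theorem IsSmoothFamily.continuous_deriv (he : IsSmoothFamily (m := m) e) :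
    Continuous fun q : ℝ × M => deriv (fun t => e t q.2) q.1 := by
  refine continuous_iff_continuousAt.2 fun ⟨t₀, p₀⟩ => ?_
  obtain ⟨E, hE, h⟩ := he.hasDerivAt_aux t₀ p₀
  have h0 : ContinuousAt (fun z => fderiv ℝ E z (1, 0)) (t₀, extChartAt 𝓘(ℝ, CSpace m) p₀ p₀) :=
    ((hE.fderiv_right (m := ∞) (by simp)).clm_apply contDiffAt_const).continuousAt
  have h1 : ContinuousAt (fun q : ℝ × M =>
      fderiv ℝ E (q.1, extChartAt 𝓘(ℝ, CSpace m) p₀ q.2) (1, 0)) (t₀, p₀) :=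
    ContinuousAt.comp (x := (t₀, p₀)) (g := fun z => fderiv ℝ E z (1, 0)) h0
      (continuousAt_chart_prod t₀ p₀)
  exact h1.congr (h.mono fun q hq => hq.deriv.symm)

/-- Differentiation under the integral sign. -/
theorem IsSmoothFamily.hasDerivAt_integral [IsManifold 𝓘(ℂ, CSpace m) ω M]
    [CompactSpace M] [T2Space M] [MeasurableSpace M]
    [BorelSpace M] (he : IsSmoothFamily (m := m) e) (h : RiemMetric (CSpace m) M) (t₀ : ℝ) :
    HasDerivAt (fun t => ∫ p, e t p ∂(volumeMeasure h))
      (∫ p, deriv (fun t => e t p) t₀ ∂(volumeMeasure h)) t₀ := by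
  have hc : ∀ t, Continuous (e t) := fun t => he.continuous.comp (Continuous.prodMk_right t)
  have hd : ∀ t, Continuous fun p => deriv (fun t => e t p) t := fun t =>
    he.continuous_deriv.comp (Continuous.prodMk_right t)
  -- Joint continuity on a compact time interval times the compact manifold gives a constant
  -- dominating the derivative.
  obtain ⟨C, hC⟩ := ((isCompact_Icc (a := t₀ - 1) (b := t₀ + 1)).prod
    (isCompact_univ (X := M))).exists_bound_of_continuousOn he.continuous_deriv.continuousOn
  refine (hasDerivAt_integral_of_dominated_loc_of_deriv_le (bound := fun _ => C)
    (F := e) (F' := fun t p => deriv (fun t => e t p) t)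
    (Icc_mem_nhds (by linarith : t₀ - 1 < t₀) (by linarith : t₀ < t₀ + 1))
    (Eventually.of_forall fun t => (integrable_of_continuous h (hc t)).aestronglyMeasurable)
    (integrable_of_continuous h (hc t₀))
    (integrable_of_continuous h (hd t₀)).aestronglyMeasurable
    (Eventually.of_forall fun p t ht => hC (t, p) ⟨ht, mem_univ p⟩)
    (integrable_const C) (Eventually.of_forall fun p t _ => he.hasDerivAt t p)).2

theorem IsSmoothFamily.const_mul (he : IsSmoothFamily (m := m) e) (a : ℝ) :
    IsSmoothFamily (m := m) fun t p => a * e t p := by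
  intro t₀ p₀
  obtain ⟨E, hE, h⟩ := he t₀ p₀
  exact ⟨fun z => a * E z, contDiffAt_const.mul hE, h.mono fun q hq => congrArg (a * ·) hq⟩

theorem IsSmoothFamily.add (he : IsSmoothFamily (m := m) e) {e' : ℝ → M → ℝ}
    (he' : IsSmoothFamily (m := m) e') : IsSmoothFamily (m := m) fun t p => e t p + e' t p := by
  intro t₀ p₀
  obtain ⟨E, hE, h⟩ := he t₀ p₀
  obtain ⟨E', hE', h'⟩ := he' t₀ p₀
  exact ⟨fun z => E z + E' z, hE.add hE', by filter_upwards [h, h'] with q hq hq'; exact congrArg₂ (· + ·) hq hq'⟩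

end Parametric

/-! ### Variations of a map and their variation fields. -/

section Family

variable {W V : Type*} [NormedAddCommGroup W] [NormedSpace ℝ W]
  [NormedAddCommGroup V] [NormedSpace ℝ V]
  {M : Type*} [TopologicalSpace M] [ChartedSpace W M]
  {N : Type*} [TopologicalSpace N] [ChartedSpace V N]

/-- The coordinate expression of a family of maps. -/
def famLoc (b : M) (c : N) (F : ℝ × M → N) (z : ℝ × W) : V :=
  extChartAt 𝓘(ℝ, V) c (F (z.1, (extChartAt 𝓘(ℝ, W) b).symm z.2))

/-- The domain of the coordinate expression of a family of maps. -/
def famDom (b : M) (c : N) (F : ℝ × M → N) : Set (ℝ × W) :=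
  univ ×ˢ (extChartAt 𝓘(ℝ, W) b).target ∩
    (fun z => (z.1, (extChartAt 𝓘(ℝ, W) b).symm z.2)) ⁻¹' (F ⁻¹' (extChartAt 𝓘(ℝ, V) c).source)

theorem isOpen_famDom (b : M) (c : N) {F : ℝ × M → N} (hF : Continuous F) :
    IsOpen (famDom (W := W) (V := V) b c F) := by
  refine ContinuousOn.isOpen_inter_preimage ?_ (isOpen_univ.prod (isOpen_extChartAt_target b))
    ((isOpen_extChartAt_source c).preimage hF)
  exact continuousOn_fst.prodMk ((continuousOn_extChartAt_symm b).comp continuousOn_snd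
    fun z hz => hz.2)

theorem center_mem_famDom (t : ℝ) (p : M) (F : ℝ × M → N) :
    (t, extChartAt 𝓘(ℝ, W) p p) ∈ famDom (W := W) (V := V) p (F (t, p)) F := by
  refine ⟨⟨mem_univ _, mem_extChartAt_target p⟩, ?_⟩
  simp only [mem_preimage]
  rw [extChartAt_to_inv]
  exact mem_extChartAt_source _

variable {F : ℝ × M → N} (hF : ContMDiff (𝓘(ℝ, ℝ).prod 𝓘(ℝ, W)) 𝓘(ℝ, V) ∞ F)

include hF in
theorem contMDiff_slice (t : ℝ) : ContMDiff 𝓘(ℝ, W) 𝓘(ℝ, V) ∞ fun p => F (t, p) :=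
  hF.comp (contMDiff_const.prodMk contMDiff_id)

theorem hasFDerivAt_slice (t : ℝ) (y : W) :
    HasFDerivAt (fun y : W => (t, y)) (ContinuousLinearMap.inr ℝ ℝ W) y :=
  hasFDerivAt_prodMk_right t y

include hF in
theorem eventually_mem_famDom (p : M) (t : ℝ) : ∀ᶠ y in 𝓝 (extChartAt 𝓘(ℝ, W) p p),
    (t, y) ∈ famDom (W := W) (V := V) p (F (t, p)) F :=
  (Continuous.prodMk_right t).continuousAt.eventually
    ((isOpen_famDom p (F (t, p)) hF.continuous).mem_nhds (center_mem_famDom t p F))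

variable [IsManifold 𝓘(ℝ, W) ∞ M] [IsManifold 𝓘(ℝ, V) ∞ N]

include hF in
theorem contDiffAt_famLoc (b : M) (c : N) {z : ℝ × W}
    (hz : z ∈ famDom (W := W) (V := V) b c F) :
    ContDiffAt ℝ ∞ (famLoc (W := W) (V := V) b c F) z := by
  refine ContDiffOn.contDiffAt (s := famDom (W := W) (V := V) b c F) ?_
    ((isOpen_famDom b c hF.continuous).mem_nhds hz)
  rw [← contMDiffOn_iff_contDiffOn]
  have h1 : ContMDiffOn 𝓘(ℝ, ℝ × W) (𝓘(ℝ, ℝ).prod 𝓘(ℝ, W)) ∞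
      (fun z : ℝ × W => (z.1, (extChartAt 𝓘(ℝ, W) b).symm z.2))
      (famDom (W := W) (V := V) b c F) :=
    (contDiff_fst.contMDiff.contMDiffOn).prodMk ((contMDiffOn_extChartAt_symm b).comp
      (contDiff_snd.contMDiff.contMDiffOn) fun z hz => hz.1.2)
  exact (contMDiffOn_extChartAt (I := 𝓘(ℝ, V)) (n := ∞) (x := c)).comp
    (hF.comp_contMDiffOn h1) (fun y hy => by simpa [extChartAt_source] using hy.2)

include hF in
theorem fderiv_locMap_slice (b : M) (c : N) {t : ℝ} {y : W}
    (hz : (t, y) ∈ famDom (W := W) (V := V) b c F) (u : W) :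
    fderiv ℝ (locMap (W := W) (V := V) b c fun p => F (t, p)) y u =
      fderiv ℝ (famLoc (W := W) (V := V) b c F) (t, y) (0, u) := by
  have h1 := ((contDiffAt_famLoc hF b c hz).differentiableAt (by simp)).hasFDerivAt
  have h2 := (h1.comp y (hasFDerivAt_slice t y)).fderiv
  exact congrArg (fun A : W →L[ℝ] V => A u) h2

/-- The variation field of a family of maps at `t = 0`. -/
def varField (F : ℝ × M → N) (p : M) : TangentSpace 𝓘(ℝ, V) (F (0, p)) :=
  mfderiv 𝓘(ℝ, ℝ) 𝓘(ℝ, V) (fun t : ℝ => F (t, p)) 0 (1 : ℝ)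

-- The velocity of the curve t ↦ F(t, q), read in the chart at F(0, p), is the partial time
-- derivative of the coordinate expression. This makes the variation field accessible to the Hessian
-- on time times space.
include hF in
theorem secLoc_varField (p : M) {y : W}
    (hz : (0, y) ∈ famDom (W := W) (V := V) p (F (0, p)) F) :
    secLoc (fun p => F (0, p)) (varField (V := V) F) p y =
      fderiv ℝ (famLoc (W := W) (V := V) p (F (0, p)) F) (0, y) (1, 0) := by
  set q := (extChartAt 𝓘(ℝ, W) p).symm y with hq
  have : IsManifold 𝓘(ℝ, V) 1 N := .of_le (n := ∞) (by simp)
  have h1 : MDifferentiableAt 𝓘(ℝ, V) 𝓘(ℝ, V) (extChartAt 𝓘(ℝ, V) (F (0, p))) (F (0, q)) :=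
    mdifferentiableAt_extChartAt (by have := hz.2; rwa [mem_preimage, mem_preimage,
      extChartAt_source] at this)
  have h2 : MDifferentiableAt 𝓘(ℝ, ℝ) 𝓘(ℝ, V) (fun t : ℝ => F (t, q)) 0 :=
    ((hF.comp (contMDiff_id.prodMk contMDiff_const)) 0).mdifferentiableAt (by simp)
  have h3 := mfderiv_comp (0 : ℝ) (g := extChartAt 𝓘(ℝ, V) (F (0, p))) h1 h2
  rw [mfderiv_eq_fderiv] at h3
  have h4 := ((contDiffAt_famLoc hF p (F (0, p)) hz).differentiableAt (by simp)).hasFDerivAt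
  have h5 := (HasFDerivAt.comp (0 : ℝ) (f := fun t : ℝ => (t, y))
    h4 (hasFDerivAt_prodMk_left (𝕜 := ℝ) (0 : ℝ) y)).fderiv
  have h6 := congrArg (fun A : ℝ →L[ℝ] V => A 1) h3
  have h7 := congrArg (fun A : ℝ →L[ℝ] V => A 1) h5
  exact h6.symm.trans h7

include hF in
theorem isSmoothAlong_varField :
    IsSmoothAlong (W := W) (fun p => F (0, p)) (varField (V := V) F) := by
  refine isSmoothAlong_of_secLoc (contMDiff_slice hF 0) fun p => ?_
  have h1 := ((contDiffAt_famLoc hF p (F (0, p)) (center_mem_famDom 0 p F)).fderiv_right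
    (m := ∞) (by simp)).clm_apply (contDiffAt_const (c := ((1 : ℝ), (0 : W))))
  have h2 := h1.comp (extChartAt 𝓘(ℝ, W) p p)
    (f := fun y : W => ((0 : ℝ), y)) (contDiffAt_const.prodMk contDiffAt_id)
  refine h2.congr_of_eventuallyEq ?_
  filter_upwards [eventually_mem_famDom hF p 0] with y hy
  exact secLoc_varField hF p hy

end Family

/-! ### Energy densities and their first variation. -/

section Density

variable {m n : ℕ}

/-- The bilinear form `formG A (L u) (L w)`. -/
def formB (A : Matrix (Fin n) (Fin n) ℂ) (L : CSpace m →L[ℝ] (Fin n → ℂ)) :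
    CSpace m →ₗ[ℝ] CSpace m →ₗ[ℝ] ℂ :=
  LinearMap.mk₂ ℝ (fun u w => formG A (L u) (L w))
    (fun u u' w => by rw [map_add, formG_add_left])
    (fun c u w => by
      have := formG_smul_left A (c : ℂ) (L u) (L w)
      rw [map_smul]; simpa using this)
    (fun u w w' => by rw [map_add, formG_add_right])
    (fun c u w => by
      have := formG_smul_right A (c : ℂ) (L u) (L w)
      rw [Complex.conj_ofReal] at this
      rw [map_smul]; simpa using this)

theorem formB_apply (A : Matrix (Fin n) (Fin n) ℂ) (L : CSpace m →L[ℝ] (Fin n → ℂ))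
    (u w : CSpace m) : formB A L u w = formG A (L u) (L w) := rfl

/-- The components of the part of type `(0,1)` or `(1,0)` of a real linear map. -/
def partE (ε : ℂ) (L : CSpace m →L[ℝ] (Fin n → ℂ)) (α : Fin m) : Fin n → ℂ :=
  (1 / 2 : ℂ) • (L (cBasis α) + (ε * Complex.I) • L (Complex.I • cBasis α))

/-- The polarization of the pulled back metric factors into the two parts of the differential, so
the energy density is an instance of the basis independent contraction. -/
theorem contr_formB {ε : ℂ} (hε : ε = 1 ∨ ε = -1) (K : Matrix (Fin m) (Fin m) ℂ)
    (A : Matrix (Fin n) (Fin n) ℂ) (L : CSpace m →L[ℝ] (Fin n → ℂ)) :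
    contr ε K cBasis (formB A L) = ∑ α, ∑ β, K α β * formG A (partE ε L α) (partE ε L β) := by
  refine Finset.sum_congr rfl fun α _ => Finset.sum_congr rfl fun β _ => ?_
  refine congrArg (K α β * ·) ?_
  simp only [polar, formB_apply, partE, formG_smul_left, formG_smul_right, formG_add_left,
    formG_add_right, map_mul, conj_sign hε, Complex.conj_I, map_div₀, map_one, map_ofNat]
  have h1 := sign_sq hε
  linear_combination (1 / 4) * formG A (L (Complex.I • cBasis α)) (L (Complex.I • cBasis β)) *
    (ε * ε * Complex.I_sq - h1)

variable {V : Type*} [NormedAddCommGroup V] [NormedSpace ℝ V]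

theorem fderiv_locMap_center {W : Type*} [NormedAddCommGroup W] [NormedSpace ℝ W]
    {M : Type*} [TopologicalSpace M] [ChartedSpace W M]
    {N : Type*} [TopologicalSpace N] [ChartedSpace V N]
    [IsManifold 𝓘(ℝ, W) ∞ M] [IsManifold 𝓘(ℝ, V) ∞ N]
    {f : M → N} (hf : ContMDiff 𝓘(ℝ, W) 𝓘(ℝ, V) ∞ f) (p : M) :
    fderiv ℝ (locMap (W := W) (V := V) p (f p) f) (extChartAt 𝓘(ℝ, W) p p) = mapDeriv f p := by
  ext u
  have h := center_mem_locDom (W := W) (V := V) p f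
  have h1 := mfderiv_coordVecL p (f p) f h.1 ((hf _).mdifferentiableAt (by simp)) h.2 u
  rw [locMap_center, coordVecL_center, coordVecL_center, extChartAt_to_inv] at h1
  exact h1.symm

variable {M : Type*} [TopologicalSpace M] [ChartedSpace (CSpace m) M]
  [IsManifold 𝓘(ℂ, CSpace m) ω M]
  {N : Type*} [TopologicalSpace N] [ChartedSpace V N] [IsManifold 𝓘(ℝ, V) ∞ N]
  (T : TargetFrame n V N) {h : RiemMetric (CSpace m) M}

namespace TargetFrame

theorem dfE_dataOf_eq_partE (H : Matrix (Fin m) (Fin m) ℂ) (c : N) {F : CSpace m → V}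
    {x : CSpace m} (hF : DifferentiableAt ℝ F x) (ε : ℂ) :
    (T.dataOf H c F x).dfE ε = partE ε (T.κ.comp (fderiv ℝ F x)) :=
  funext fun α => T.dfE_dataOf H c hF ε α

/-- The energy density in arbitrary charts. -/
theorem densE_localData (hh : IsHermitian h) {ε : ℂ} (hε : ε = 1 ∨ ε = -1) {f : M → N}
    (hf : ContMDiff 𝓘(ℝ, CSpace m) 𝓘(ℝ, V) ∞ f) (b : M) (c : N) {y : CSpace m}
    (hy : y ∈ locDom (W := CSpace m) (V := V) b c f) {q : M}
    (hq : (extChartAt 𝓘(ℝ, CSpace m) b).symm y = q) :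
    (T.localData h f q).densE ε = (∑ α, ∑ β, kmat ε (hermMatrix h b y) α β *
      formG (T.G c (locMap b c f y)) (partE ε (T.κ.comp (fderiv ℝ (locMap b c f) y)) α)
        (partE ε (T.κ.comp (fderiv ℝ (locMap b c f) y)) β)).re := by
  have hd := (contDiffAt_locMap q (f q) hf (center_mem_locDom q f)).differentiableAt (by simp)
  have h1 : (T.localData h f q).densE ε = (contr ε (kmat ε (hermMatrix h q
      (extChartAt 𝓘(ℝ, CSpace m) q q))) cBasis (formB (T.G (f q)
        (extChartAt 𝓘(ℝ, V) (f q) (f q))) (T.κ.comp (mapDeriv f q)))).re := by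
    rw [LocalData.densE, localData, T.dfE_dataOf_eq_partE _ _ hd, contr_formB hε,
      fderiv_locMap_center hf, ← locMap_center (W := CSpace m) (V := V) q f]
    rfl
  -- Both sides are contractions of the pullback of the target metric by `f`, so only the invariance
  -- of that pullback under a change of charts remains.
  rw [h1, ← contr_formB hε, contr_center_eq hε hh b hy.1 _ _ (fun u w => ?_) hq]
  subst hq
  have h2 := mfderiv_coordVecL b c f hy.1 ((hf _).mdifferentiableAt (by simp)) hy.2
  simp only [formB_apply, ContinuousLinearMap.comp_apply, h2]
  exact T.change c _ (locMap_mem_target b c hy) _ ((extChartAt 𝓘(ℝ, V) c).left_inv hy.2) _ _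

/-- The components of the differential of a family of maps in the space directions. -/
def famPart (ε : ℂ) (Φ : ℝ × CSpace m → V) (α : Fin m) (z : ℝ × CSpace m) : Fin n → ℂ :=
  partE ε (T.κ.comp ((fderiv ℝ Φ z).comp (ContinuousLinearMap.inr ℝ ℝ (CSpace m)))) α

/-- The energy density of a family of maps with coordinate expression `Φ`. -/
def famDens (ε : ℂ) (H : CSpace m → Matrix (Fin m) (Fin m) ℂ) (c : N) (Φ : ℝ × CSpace m → V)
    (z : ℝ × CSpace m) : ℂ :=
  ∑ α, ∑ β, kmat ε (H z.2) α β *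
    formG (T.G c (Φ z)) (T.famPart ε Φ α z) (T.famPart ε Φ β z)

theorem famPart_apply (ε : ℂ) (Φ : ℝ × CSpace m → V) (α : Fin m) (z : ℝ × CSpace m)
    (i : Fin n) : T.famPart ε Φ α z i = (1 / 2) *
      (T.comps (fun z => fderiv ℝ Φ z (0, cBasis α)) i z +
        ε * Complex.I * T.comps (fun z => fderiv ℝ Φ z (0, Complex.I • cBasis α)) i z) := rfl

theorem contDiffAt_famPart (ε : ℂ) {Φ : ℝ × CSpace m → V} {z : ℝ × CSpace m}
    (hΦ : ContDiffAt ℝ ∞ Φ z) (α : Fin m) (i : Fin n) :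
    ContDiffAt ℝ ∞ (fun z => T.famPart ε Φ α z i) z := by
  have h1 : ∀ u, ContDiffAt ℝ ∞ (T.comps (fun z => fderiv ℝ Φ z u) i) z := fun u =>
    (T.κi i).contDiff.contDiffAt.comp z
      ((hΦ.fderiv_right (m := ∞) (by simp)).clm_apply contDiffAt_const)
  simp only [famPart_apply]
  exact contDiffAt_const.mul ((h1 _).add (contDiffAt_const.mul (h1 _)))

theorem contDiffAt_formG_famPart (ε : ℂ) (c : N) {Φ : ℝ × CSpace m → V} {z : ℝ × CSpace m}
    (hΦ : ContDiffAt ℝ ∞ Φ z) (hz : Φ z ∈ (extChartAt 𝓘(ℝ, V) c).target) (α β : Fin m) :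
    ContDiffAt ℝ ∞
      (fun z => formG (T.G c (Φ z)) (T.famPart ε Φ α z) (T.famPart ε Φ β z)) z := by
  unfold formG
  refine ContDiffAt.sum fun i _ => ContDiffAt.sum fun j _ => ?_
  exact ((((T.contDiffOn_G c i j).contDiffAt (target_mem_nhds c hz)).comp z hΦ).mul
    (T.contDiffAt_famPart ε hΦ α i)).mul
      ((Complex.conjCLE : ℂ →L[ℝ] ℂ).contDiff.contDiffAt.comp z (T.contDiffAt_famPart ε hΦ β j))

variable {F : ℝ × M → N} (hF : ContMDiff (𝓘(ℝ, ℝ).prod 𝓘(ℝ, CSpace m)) 𝓘(ℝ, V) ∞ F)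

include hF in
theorem densE_family (hh : IsHermitian h) {ε : ℂ} (hε : ε = 1 ∨ ε = -1) (b : M) (c : N) {t : ℝ}
    {y : CSpace m} (hz : (t, y) ∈ famDom (W := CSpace m) (V := V) b c F) {q : M}
    (hq : (extChartAt 𝓘(ℝ, CSpace m) b).symm y = q) :
    (T.localData h (fun p => F (t, p)) q).densE ε =
      (T.famDens ε (hermMatrix h b) c (famLoc b c F) (t, y)).re := by
  rw [T.densE_localData hh hε (contMDiff_slice hF t) b c ⟨hz.1.2, hz.2⟩ hq]
  have h1 : fderiv ℝ (locMap (W := CSpace m) (V := V) b c fun p => F (t, p)) y =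
      (fderiv ℝ (famLoc (W := CSpace m) (V := V) b c F) (t, y)).comp
        (ContinuousLinearMap.inr ℝ ℝ (CSpace m)) :=
    ContinuousLinearMap.ext fun u => fderiv_locMap_slice hF b c hz u
  rw [h1]
  rfl

include hF in
theorem isSmoothFamily_densE (hh : IsHermitian h) {ε : ℂ} (hε : ε = 1 ∨ ε = -1) :
    IsSmoothFamily (m := m) fun t p => (T.localData h (fun p => F (t, p)) p).densE ε := by
  intro t₀ p₀
  have hz := center_mem_famDom (W := CSpace m) (V := V) t₀ p₀ F
  refine ⟨fun z => (T.famDens ε (hermMatrix h p₀) (F (t₀, p₀)) (famLoc p₀ (F (t₀, p₀)) F) z).re,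
    ?_, ?_⟩
  · refine Complex.reCLM.contDiff.contDiffAt.comp _ ?_
    refine ContDiffAt.sum fun α _ => ContDiffAt.sum fun β _ => ?_
    exact (((contDiffOn_kmat hh p₀ hε α β).contDiffAt (target_mem_nhds p₀ hz.1.2)).comp
      (t₀, extChartAt 𝓘(ℝ, CSpace m) p₀ p₀) contDiffAt_snd).mul
      (T.contDiffAt_formG_famPart ε _ (contDiffAt_famLoc hF p₀ _ hz)
        ((extChartAt 𝓘(ℝ, V) _).map_source hz.2) α β)
  · have h1 := (continuousAt_chart_prod t₀ p₀).eventually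
      ((isOpen_famDom p₀ (F (t₀, p₀)) hF.continuous).mem_nhds hz)
    have h2 : ∀ᶠ q : ℝ × M in 𝓝 (t₀, p₀), q.2 ∈ (extChartAt 𝓘(ℝ, CSpace m) p₀).source :=
      continuousAt_snd.eventually (extChartAt_source_mem_nhds (I := 𝓘(ℝ, CSpace m)) p₀)
    filter_upwards [h1, h2] with q hq hq2
    exact T.densE_family hF hh hε p₀ _ hq ((extChartAt 𝓘(ℝ, CSpace m) p₀).left_inv hq2)

-- The covariant derivative of ∂_t F in a space direction equals the covariant time derivative of dF
-- in that direction. This is the symmetry of the Hessian of the family, viewed as a map on time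
-- times space.
include hF in
theorem covE_varField (p : M) (ε : ℂ) (α : Fin m) :
    (T.localData h (fun p => F (0, p)) p).covE ε
      (T.comps (secLoc (fun p => F (0, p)) (varField (V := V) F) p)) α =
    T.covDir (F (0, p)) (famLoc p (F (0, p)) F) (0, extChartAt 𝓘(ℝ, CSpace m) p p) (1, 0)
      (fun i z => T.famPart ε (famLoc p (F (0, p)) F) α z i) := by
  set x := extChartAt 𝓘(ℝ, CSpace m) p p with hx
  set Φ := famLoc (W := CSpace m) (V := V) p (F (0, p)) F with hΦ
  have hz := center_mem_famDom (W := CSpace m) (V := V) 0 p F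
  have hΦd : ContDiffAt ℝ ∞ Φ (0, x) := contDiffAt_famLoc hF p _ hz
  have hd : DifferentiableAt ℝ (fderiv ℝ Φ) (0, x) :=
    (hΦd.fderiv_right (m := ∞) (by simp)).differentiableAt (by simp)
  have hdu : ∀ u, DifferentiableAt ℝ (fun z => fderiv ℝ Φ z u) (0, x) := fun u =>
    hd.clm_apply (differentiableAt_const u)
  have hloc := (contDiffAt_locMap p (F (0, p)) (contMDiff_slice hF 0)
    (center_mem_locDom (W := CSpace m) (V := V) p fun p => F (0, p))).differentiableAt (by simp)
  have h1 : ∀ u, T.covDir (F (0, p)) (locMap p (F (0, p)) fun p => F (0, p)) x u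
      (T.comps (secLoc (fun p => F (0, p)) (varField (V := V) F) p)) =
      T.hess (F (0, p)) Φ (0, x) (1, 0) (0, u) := by
    intro u
    -- Exchange of the space direction with the time direction; absence of torsion is used here.
    rw [T.hess_symm _ hΦd]
    funext i
    have hsec : T.comps (secLoc (fun p => F (0, p)) (varField (V := V) F) p) i =ᶠ[𝓝 x]
        fun y => T.comps (fun z => fderiv ℝ Φ z (1, 0)) i (0, y) := by
      filter_upwards [eventually_mem_famDom hF p 0] with y hy
      simp only [comps, secLoc_varField hF p hy, hΦ]
    have h2 := ((T.differentiableAt_comps (hdu (1, 0)) i).hasFDerivAt.comp x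
      (hasFDerivAt_slice 0 x)).fderiv
    have h3 := congrArg (fun A : CSpace m →L[ℝ] ℂ => A u) (hsec.fderiv_eq.trans h2)
    have h4 := fderiv_locMap_slice hF p (F (0, p)) hz u
    have h5 : secLoc (fun p => F (0, p)) (varField (V := V) F) p x = fderiv ℝ Φ (0, x) (1, 0) :=
      secLoc_varField hF p hz
    rw [hess, covDir, covDir, h4]
    refine congrArg₂ (· + ·) h3 ?_
    simp only [comps, h5]
    rfl
  refine (T.covE_dataOf _ (F (0, p)) hloc ε _ α).trans ?_
  rw [h1, h1]
  funext i
  have h6 : HasFDerivAt (fun z => T.famPart ε Φ α z i) _ (0, x) :=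
    (((T.differentiableAt_comps (hdu (0, cBasis α)) i).hasFDerivAt).add
      ((T.differentiableAt_comps (hdu (0, Complex.I • cBasis α)) i).hasFDerivAt.const_mul
        (ε * Complex.I))).const_mul (1 / 2 : ℂ)
  simp only [hess, covDir, Pi.smul_apply, Pi.add_apply, smul_eq_mul]
  rw [h6.fderiv]
  simp only [famPart_apply, smul_apply, add_apply, smul_eq_mul]
  have h7 : ∀ a b : Fin n → ℂ, ∑ j, ∑ k, T.Γ (F (0, p)) i j k * T.κ (fderiv ℝ Φ (0, x) (1, 0)) j *
      (1 / 2 * (a k + ε * Complex.I * b k)) = (1 / 2) * (∑ j, ∑ k, T.Γ (F (0, p)) i j k *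
        T.κ (fderiv ℝ Φ (0, x) (1, 0)) j * a k + ε * Complex.I * ∑ j, ∑ k, T.Γ (F (0, p)) i j k *
        T.κ (fderiv ℝ Φ (0, x) (1, 0)) j * b k) := by
    intro a b
    simp only [Finset.mul_sum, ← Finset.sum_add_distrib]
    exact Finset.sum_congr rfl fun j _ => Finset.sum_congr rfl fun k _ => by ring
  rw [h7 (fun k => T.comps (fun z => fderiv ℝ Φ z (0, cBasis α)) k (0, x))
    (fun k => T.comps (fun z => fderiv ℝ Φ z (0, Complex.I • cBasis α)) k (0, x))]
  ring

include hF in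
/-- The first variation of the energy density. -/
theorem deriv_densE (hh : IsHermitian h) {ε : ℂ} (hε : ε = 1 ∨ ε = -1) (p : M) :
    deriv (fun t => (T.localData h (fun p => F (t, p)) p).densE ε) 0 =
      2 * ((T.localData h (fun p => F (0, p)) p).pairE ε
        (T.comps (secLoc (fun p => F (0, p)) (varField (V := V) F) p))).re := by
  set x := extChartAt 𝓘(ℝ, CSpace m) p p with hx
  set Φ := famLoc (W := CSpace m) (V := V) p (F (0, p)) F with hΦ
  have hz := center_mem_famDom (W := CSpace m) (V := V) 0 p F
  have hΦd : ContDiffAt ℝ ∞ Φ (0, x) := contDiffAt_famLoc hF p _ hz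
  have hΦx : Φ (0, x) = extChartAt 𝓘(ℝ, V) (F (0, p)) (F (0, p)) :=
    locMap_center (W := CSpace m) p fun p => F (0, p)
  have hslice : HasDerivAt (fun t : ℝ => (t, x)) ((1 : ℝ), (0 : CSpace m)) 0 :=
    (hasDerivAt_id (0 : ℝ)).prodMk (hasDerivAt_const (0 : ℝ) x)
  set D := T.localData h (fun p => F (0, p)) p with hD
  set s := T.comps (secLoc (W := CSpace m) (fun p => F (0, p)) (varField (V := V) F) p) with hs
  have hloc := (contDiffAt_locMap p (F (0, p)) (contMDiff_slice hF 0)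
    (center_mem_locDom (W := CSpace m) (V := V) p fun p => F (0, p))).differentiableAt (by simp)
  have hdf : D.dfE ε = fun α => T.famPart ε Φ α (0, x) := by
    refine (T.dfE_dataOf_eq_partE _ (F (0, p)) hloc ε).trans ?_
    have h1 : fderiv ℝ (locMap (W := CSpace m) (V := V) p (F (0, p)) fun p => F (0, p)) x =
        (fderiv ℝ Φ (0, x)).comp (ContinuousLinearMap.inr ℝ ℝ (CSpace m)) :=
      ContinuousLinearMap.ext fun u => fderiv_locMap_slice hF p _ hz u
    rw [h1]; rfl
  have hG : D.g = T.G (F (0, p)) (Φ (0, x)) := rfl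
  -- The domain metric does not depend on t, so only the target inner product is differentiated, by
  -- metric compatibility along the curve at the fixed point x.
  have h1 : HasDerivAt (fun t => T.famDens ε (hermMatrix h p) (F (0, p)) Φ (t, x))
      (∑ α, ∑ β, kmat ε (hermMatrix h p x) α β * (formG D.g (D.covE ε s α) (D.dfE ε β) +
        formG D.g (D.dfE ε α) (D.covE ε s β))) 0 := by
    refine HasDerivAt.fun_sum fun α _ => HasDerivAt.fun_sum fun β _ =>
      HasDerivAt.const_mul (𝔸 := ℂ) (kmat ε (hermMatrix h p x) α β) ?_
    have h2 := ((T.contDiffAt_formG_famPart ε (F (0, p)) hΦd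
      ((extChartAt 𝓘(ℝ, V) _).map_source hz.2) α β).differentiableAt
        (by simp)).hasFDerivAt.comp_hasDerivAt (0 : ℝ) hslice
    have h3 := T.fderiv_formG (F (0, p)) (hΦd.differentiableAt (by simp)) hΦx
      (fun i => (T.contDiffAt_famPart ε hΦd α i).differentiableAt (by simp))
      (fun i => (T.contDiffAt_famPart ε hΦd β i).differentiableAt (by simp)) (1, 0)
    rw [← T.covE_varField (h := h) hF p ε α, ← T.covE_varField (h := h) hF p ε β] at h3
    refine h2.congr_deriv (h3.trans ?_)
    rw [hdf]; rfl
  have h2 : (fun t => (T.localData h (fun p => F (t, p)) p).densE ε) =ᶠ[𝓝 0]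
      fun t => Complex.reCLM (T.famDens ε (hermMatrix h p) (F (0, p)) Φ (t, x)) := by
    have h3 := hslice.continuousAt.eventually
      ((isOpen_famDom p (F (0, p)) hF.continuous).mem_nhds hz)
    filter_upwards [h3] with t ht
    exact T.densE_family hF hh hε p _ ht (extChartAt_to_inv p)
  rw [h2.deriv_eq]
  refine (Complex.reCLM.hasFDerivAt.comp_hasDerivAt (0 : ℝ) h1).deriv.trans ?_
  have hH : (hermMatrix h p x).IsHermitian := by
    rw [hx, hermMatrix_center]
    exact Matrix.IsHermitian.ext fun i j => (isHermitianInner_metricAt hh p).gram_conj _ j i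
  -- The two terms of the product rule are conjugate to each other, which yields twice the real
  -- part.
  have h4 : (starRingEnd ℂ) (D.pairE ε s) = ∑ α, ∑ β, kmat ε (hermMatrix h p x) α β *
      formG D.g (D.dfE ε α) (D.covE ε s β) := by
    rw [LocalData.pairE, LocalData.innerE, Finset.sum_comm]
    simp only [map_sum, map_mul]
    refine Finset.sum_congr rfl fun α _ => Finset.sum_congr rfl fun β _ => ?_
    exact congrArg₂ (· * ·) (kmat_conj hH hε β α)
      (formG_conj (fun i j => T.G_conj _ _ ((extChartAt 𝓘(ℝ, V) _).map_source hz.2) i j) _ _)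
  simp only [mul_add, Finset.sum_add_distrib, Complex.reCLM_apply, Complex.add_re]
  rw [← h4, Complex.conj_re, two_mul]
  rfl

end TargetFrame

end Density

/-! ### Localized variations in a prescribed direction. -/

section TestFamily

variable {m : ℕ} {M : Type*} [TopologicalSpace M] [ChartedSpace (CSpace m) M]
  {V : Type*} [NormedAddCommGroup V] [NormedSpace ℝ V]
  {N : Type*} [TopologicalSpace N] [ChartedSpace V N]

/-- The field `χ v` along `f`, where `v` is constant in the chart centred at `c`. -/
def testField (f : M → N) (c : N) (v : V) (χ : M → ℝ) (p : M) : TangentSpace 𝓘(ℝ, V) (f p) :=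
  (χ p • coordVecL c (extChartAt 𝓘(ℝ, V) c (f p)) v : V)

/-- The set of points mapped into the coordinate ball of radius `r` around `c`. -/
def ballPreimage (f : M → N) (c : N) (r : ℝ) : Set M :=
  f ⁻¹' ((extChartAt 𝓘(ℝ, V) c).source ∩
    extChartAt 𝓘(ℝ, V) c ⁻¹' Metric.ball (extChartAt 𝓘(ℝ, V) c c) r)

/-- The cutoff function `χ` and the vector `v` are such that moving `f` in the direction `χ v`
stays in the domain of the chart centred at `c`. -/
structure IsTest (f : M → N) (c : N) (v : V) (χ : M → ℝ) : Prop where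
  smooth : ContMDiff 𝓘(ℝ, CSpace m) 𝓘(ℝ, ℝ) ∞ χ
  abs_le : ∀ p, |χ p| ≤ 1
  exists_radius : ∃ r, ‖v‖ < r ∧
    Metric.ball (extChartAt 𝓘(ℝ, V) c c) (2 * r) ⊆ (extChartAt 𝓘(ℝ, V) c).target ∧
    tsupport χ ⊆ ballPreimage (V := V) f c r

theorem isOpen_ballPreimage {f : M → N} (hf : Continuous f) (c : N) (r : ℝ) :
    IsOpen (ballPreimage (V := V) f c r) :=
  ((continuousOn_extChartAt c).isOpen_inter_preimage (isOpen_extChartAt_source c)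
    Metric.isOpen_ball).preimage hf

theorem IsTest.mul {f : M → N} {c : N} {v : V} {χ χ' : M → ℝ} (h : IsTest (m := m) f c v χ)
    (hs : ContMDiff 𝓘(ℝ, CSpace m) 𝓘(ℝ, ℝ) ∞ χ') (h1 : ∀ p, |χ' p| ≤ 1) :
    IsTest (m := m) f c v (fun p => χ' p * χ p) where
  smooth := hs.mul h.smooth
  abs_le p := by
    rw [abs_mul]
    exact mul_le_one₀ (h1 p) (abs_nonneg _) (h.abs_le p)
  exists_radius := by
    obtain ⟨r, hv, hb, ht⟩ := h.exists_radius
    exact ⟨r, hv, hb, (tsupport_mul_subset_right (f := χ') (g := χ)).trans ht⟩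

/-- Only the norm of the direction matters; in the Kähler case this allows `v` to be replaced by
i`v`. -/
theorem IsTest.congr_vec {f : M → N} {c : N} {v v' : V} {χ : M → ℝ} (h : IsTest (m := m) f c v χ)
    (hv : ‖v'‖ = ‖v‖) : IsTest (m := m) f c v' χ where
  smooth := h.smooth
  abs_le := h.abs_le
  exists_radius := by rw [hv]; exact h.exists_radius

open Classical in
/-- The variation of `f` in the direction `χ v`. -/
def testFam (f : M → N) (c : N) (v : V) (χ : M → ℝ) (r : ℝ) (q : ℝ × M) : N :=
  if q.2 ∈ ballPreimage (V := V) f c r then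
    (extChartAt 𝓘(ℝ, V) c).symm (extChartAt 𝓘(ℝ, V) c (f q.2) + (Real.sin q.1 * χ q.2) • v)
  else f q.2

theorem testFam_of_mem {f : M → N} {c : N} {v : V} {χ : M → ℝ} {r : ℝ} {q : ℝ × M}
    (hq : q.2 ∈ ballPreimage (V := V) f c r) : testFam f c v χ r q =
      (extChartAt 𝓘(ℝ, V) c).symm (extChartAt 𝓘(ℝ, V) c (f q.2) + (Real.sin q.1 * χ q.2) • v) :=
  if_pos hq

theorem testFam_of_eq_zero {f : M → N} {c : N} {v : V} {χ : M → ℝ} {r : ℝ} {q : ℝ × M}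
    (hq : Real.sin q.1 * χ q.2 = 0) : testFam f c v χ r q = f q.2 := by
  by_cases h : q.2 ∈ ballPreimage (V := V) f c r
  · rw [testFam_of_mem h, hq, zero_smul, add_zero]
    exact (extChartAt 𝓘(ℝ, V) c).left_inv h.1
  · exact if_neg h

variable [IsManifold 𝓘(ℝ, CSpace m) ∞ M] [IsManifold 𝓘(ℝ, V) ∞ N]

/-- A variation must be defined for all real times. Using sin t in place of t keeps the displacement
below ‖v‖ < r, so a point of the ball of radius r stays in the ball of radius 2r, inside the chart.
-/
theorem add_smul_mem_target {f : M → N} {c : N} {v : V} {χ : M → ℝ} {r : ℝ}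
    (h1 : ∀ p, |χ p| ≤ 1) (hv : ‖v‖ < r)
    (hb : Metric.ball (extChartAt 𝓘(ℝ, V) c c) (2 * r) ⊆ (extChartAt 𝓘(ℝ, V) c).target)
    {q : ℝ × M} (hq : q.2 ∈ ballPreimage (V := V) f c r) :
    extChartAt 𝓘(ℝ, V) c (f q.2) + (Real.sin q.1 * χ q.2) • v ∈
      (extChartAt 𝓘(ℝ, V) c).target := by
  refine hb ?_
  have h2 : ‖(Real.sin q.1 * χ q.2) • v‖ ≤ ‖v‖ := by
    rw [norm_smul, Real.norm_eq_abs, abs_mul]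
    exact mul_le_of_le_one_left (norm_nonneg _)
      (mul_le_one₀ (Real.abs_sin_le_one _) (abs_nonneg _) (h1 _))
  have h3 : ‖extChartAt 𝓘(ℝ, V) c (f q.2) - extChartAt 𝓘(ℝ, V) c c‖ < r := by
    simpa [dist_eq_norm] using hq.2
  rw [Metric.mem_ball, dist_eq_norm, add_sub_right_comm]
  calc _ ≤ _ := norm_add_le _ _
    _ < 2 * r := by linarith

theorem contMDiff_testFam {f : M → N} (hf : ContMDiff 𝓘(ℝ, CSpace m) 𝓘(ℝ, V) ∞ f) {c : N} {v : V}
    {χ : M → ℝ} {r : ℝ} (hχ : ContMDiff 𝓘(ℝ, CSpace m) 𝓘(ℝ, ℝ) ∞ χ)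
    (h1 : ∀ p, |χ p| ≤ 1) (hv : ‖v‖ < r)
    (hb : Metric.ball (extChartAt 𝓘(ℝ, V) c c) (2 * r) ⊆ (extChartAt 𝓘(ℝ, V) c).target)
    (ht : tsupport χ ⊆ ballPreimage (V := V) f c r) :
    ContMDiff (𝓘(ℝ, ℝ).prod 𝓘(ℝ, CSpace m)) 𝓘(ℝ, V) ∞ (testFam f c v χ r) := by
  intro q
  by_cases hq : q.2 ∈ ballPreimage (V := V) f c r
  · have h2 : ContMDiffAt (𝓘(ℝ, ℝ).prod 𝓘(ℝ, CSpace m)) 𝓘(ℝ, V) ∞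
        (fun q : ℝ × M => extChartAt 𝓘(ℝ, V) c (f q.2) + (Real.sin q.1 * χ q.2) • v) q := by
      have h3 : ContMDiffAt (𝓘(ℝ, ℝ).prod 𝓘(ℝ, CSpace m)) 𝓘(ℝ, V) ∞
          (fun q : ℝ × M => extChartAt 𝓘(ℝ, V) c (f q.2)) q :=
        ContMDiffAt.comp q (contMDiffAt_extChartAt' (by simpa [extChartAt_source] using hq.1))
          (hf.comp contMDiff_snd q)
      have h4 : ContMDiffAt (𝓘(ℝ, ℝ).prod 𝓘(ℝ, CSpace m)) 𝓘(ℝ, ℝ) ∞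
          (fun q : ℝ × M => Real.sin q.1 * χ q.2) q :=
        ((Real.contDiff_sin.contMDiff.comp contMDiff_fst).mul (hχ.comp contMDiff_snd)) q
      exact h3.add (h4.smul contMDiffAt_const)
    have h5 := ContMDiffAt.comp q ((contMDiffOn_extChartAt_symm (I := 𝓘(ℝ, V)) (n := ∞) c).contMDiffAt
      (target_mem_nhds c (add_smul_mem_target h1 hv hb hq))) h2
    refine h5.congr_of_eventuallyEq ?_
    filter_upwards [continuousAt_snd.eventually
      ((isOpen_ballPreimage hf.continuous c r).mem_nhds hq)] with q' hq'
    exact testFam_of_mem hq'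
  -- Off the preimage of the ball the cutoff vanishes on a neighbourhood, and both branches of the
  -- definition agree with `f` there.
  · refine (hf.comp contMDiff_snd q).congr_of_eventuallyEq ?_
    have h2 : q.2 ∈ (tsupport χ)ᶜ := fun h => hq (ht h)
    filter_upwards [continuousAt_snd.eventually
      ((isClosed_tsupport χ).isOpen_compl.mem_nhds h2)] with q' hq'
    refine testFam_of_eq_zero ?_
    rw [image_eq_zero_of_notMem_tsupport hq', mul_zero]

theorem varField_testFam {f : M → N} {c : N} {v : V} {χ : M → ℝ} {r : ℝ}
    (h1 : ∀ p, |χ p| ≤ 1) (hv : ‖v‖ < r)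
    (hb : Metric.ball (extChartAt 𝓘(ℝ, V) c c) (2 * r) ⊆ (extChartAt 𝓘(ℝ, V) c).target)
    (ht : tsupport χ ⊆ ballPreimage (V := V) f c r) (p : M) :
    (varField (V := V) (testFam f c v χ r) p : V) = (testField f c v χ p : V) := by
  by_cases hp : p ∈ ballPreimage (V := V) f c r
  · set y := extChartAt 𝓘(ℝ, V) c (f p) with hy
    -- The derivative of sin at 0 is 1, so replacing t by sin t does not affect the velocity.
    have h2 : HasDerivAt (fun t : ℝ => y + (Real.sin t * χ p) • v) (χ p • v) 0 := by
      have := (((Real.hasDerivAt_sin 0).mul_const (χ p)).smul_const v).const_add y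
      simpa using this
    have h3 : MDifferentiableAt 𝓘(ℝ, V) 𝓘(ℝ, V) (extChartAt 𝓘(ℝ, V) c).symm
        (y + (Real.sin 0 * χ p) • v) :=
      mdifferentiableAt_extChartAt_symm c (add_smul_mem_target (q := ((0 : ℝ), p)) h1 hv hb hp)
    have h4 := mfderiv_comp (I := 𝓘(ℝ, ℝ)) (0 : ℝ) (g := (extChartAt 𝓘(ℝ, V) c).symm)
      (f := fun t : ℝ => y + (Real.sin t * χ p) • v) h3 h2.differentiableAt.mdifferentiableAt
    have h5 : (fun t : ℝ => testFam f c v χ r (t, p)) =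
        (extChartAt 𝓘(ℝ, V) c).symm ∘ fun t : ℝ => y + (Real.sin t * χ p) • v :=
      funext fun t => testFam_of_mem hp
    have h6 : y + (Real.sin 0 * χ p) • v = y := by simp
    have h7 : (mfderiv 𝓘(ℝ, ℝ) 𝓘(ℝ, V) (fun t : ℝ => testFam f c v χ r (t, p)) 0 : ℝ →L[ℝ] V) =
        (coordVecL c y).comp (fderiv ℝ (fun t : ℝ => y + (Real.sin t * χ p) • v) 0) := by
      rw [h5]
      refine h4.trans ?_
      rw [mfderiv_eq_fderiv]
      change (coordVecL c (y + (Real.sin 0 * χ p) • v)).comp _ = _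
      rw [h6]
      rfl
    have h8 := congrArg (fun A : ℝ →L[ℝ] V => A 1) h7
    refine h8.trans ?_
    change coordVecL c y (fderiv ℝ (fun t : ℝ => y + (Real.sin t * χ p) • v) 0 1) = _
    rw [h2.hasFDerivAt.fderiv]
    simp [testField, hy]
  · have h0 : χ p = 0 := image_eq_zero_of_notMem_tsupport fun h => hp (ht h)
    have h2 : (fun t : ℝ => testFam f c v χ r (t, p)) = fun _ => f p :=
      funext fun t => testFam_of_eq_zero (by simp [h0])
    have h3 : (mfderiv 𝓘(ℝ, ℝ) 𝓘(ℝ, V) (fun t : ℝ => testFam f c v χ r (t, p)) 0 : ℝ →L[ℝ] V) =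
        0 := by rw [h2]; exact mfderiv_const
    have h4 := congrArg (fun A : ℝ →L[ℝ] V => A 1) h3
    refine h4.trans ?_
    change (0 : V) = χ p • coordVecL c (extChartAt 𝓘(ℝ, V) c (f p)) v
    rw [h0, zero_smul]

/-- Test fields are variation fields. -/
theorem IsTest.exists_variation {f : M → N} (hf : ContMDiff 𝓘(ℝ, CSpace m) 𝓘(ℝ, V) ∞ f) {c : N}
    {v : V} {χ : M → ℝ} (h : IsTest (m := m) f c v χ) :
    ∃ F : ℝ × M → N, ContMDiff (𝓘(ℝ, ℝ).prod 𝓘(ℝ, CSpace m)) 𝓘(ℝ, V) ∞ F ∧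
      (∀ p, F (0, p) = f p) ∧
      ∀ p, (varField (V := V) F p : V) = (testField f c v χ p : V) := by
  obtain ⟨r, hv, hb, ht⟩ := h.exists_radius
  exact ⟨testFam f c v χ r, contMDiff_testFam hf h.smooth h.abs_le hv hb ht,
    fun p => testFam_of_eq_zero (by simp), varField_testFam h.abs_le hv hb ht⟩

theorem exists_bump [T2Space M] {U : Set M} {p : M} (hU : U ∈ 𝓝 p) :
    ∃ χ : M → ℝ, ContMDiff 𝓘(ℝ, CSpace m) 𝓘(ℝ, ℝ) ∞ χ ∧ (∀ q, 0 ≤ χ q) ∧ (∀ q, χ q ≤ 1) ∧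
      χ p = 1 ∧ tsupport χ ⊆ U := by
  obtain ⟨χ, -, hχ⟩ := (SmoothBumpFunction.nhds_basis_tsupport (I := 𝓘(ℝ, CSpace m)) p).mem_iff.1 hU
  exact ⟨χ, χ.contMDiff, fun q => χ.nonneg, fun q => χ.le_one, χ.eq_one, hχ⟩

/-- Test fields with prescribed direction at a point. -/
theorem exists_isTest [T2Space M] {f : M → N} (hf : Continuous f) (p : M) (v : V) :
    ∃ δ : ℝ, 0 < δ ∧ ∃ χ : M → ℝ, IsTest (m := m) f (f p) (δ • v) χ ∧ χ p = 1 := by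
  obtain ⟨s, hs, hb⟩ := Metric.isOpen_iff.1 (isOpen_extChartAt_target (I := 𝓘(ℝ, V)) (f p)) _
    (mem_extChartAt_target (f p))
  have hp : p ∈ ballPreimage (V := V) f (f p) (s / 2) :=
    ⟨mem_extChartAt_source _, Metric.mem_ball_self (by linarith)⟩
  obtain ⟨χ, h1, h2, h3, h4, h5⟩ := exists_bump (m := m) ((isOpen_ballPreimage hf _ _).mem_nhds hp)
  -- The radius is s/2, so the doubled ball is the ball of radius s inside the chart. The scaling
  -- gives the strict bound ‖δ v‖ < s/2, also when `v` is zero.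
  refine ⟨s / 2 / (‖v‖ + 1), by positivity, χ, ⟨h1, fun q => ?_, s / 2, ?_, ?_, h5⟩, h4⟩
  · rw [abs_of_nonneg (h2 q)]; exact h3 q
  · rw [norm_smul, Real.norm_eq_abs, abs_of_pos (by positivity), div_mul_eq_mul_div,
      div_lt_iff₀ (by positivity)]
    nlinarith [norm_nonneg v]
  · rwa [mul_div_cancel₀ s two_ne_zero]

end TestFamily

/-! ### The weighted energy, its Euler-Lagrange equation and the tension field. -/

section Equivalence

variable {m n : ℕ} {V : Type*} [NormedAddCommGroup V] [NormedSpace ℝ V]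
  {M : Type*} [TopologicalSpace M] [ChartedSpace (CSpace m) M]
  [IsManifold 𝓘(ℂ, CSpace m) ω M]
  {N : Type*} [TopologicalSpace N] [ChartedSpace V N] [IsManifold 𝓘(ℝ, V) ∞ N]
  (T : TargetFrame n V N) (h : RiemMetric (CSpace m) M)

namespace TargetFrame

/-- The weighted pairing of the covariant derivative of a section with the differential. -/
def pairW (a b : ℝ) (f : M → N) (X : ∀ p : M, TangentSpace 𝓘(ℝ, V) (f p)) (p : M) : ℂ :=
  a * (T.localData h f p).pairE 1 (T.comps (secLoc f X p)) +
    b * (T.localData h f p).pairE (-1) (T.comps (secLoc f X p))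

/-- The inner product of a section with the tension field. -/
def tensionForm (f : M → N) (X : ∀ p : M, TangentSpace 𝓘(ℝ, V) (f p)) (p : M) : ℂ :=
  formG (T.G (f p) (extChartAt 𝓘(ℝ, V) (f p) (f p))) (T.κ (X p)) (T.localData h f p).tension

/-- The weighted divergence term. -/
def divW (a b : ℝ) (f : M → N) (X : ∀ p : M, TangentSpace 𝓘(ℝ, V) (f p)) (p : M) : ℂ :=
  a * T.divSec h 1 f X p + b * T.divSec h (-1) f X p

variable {h}

section Divergence

variable (hh : IsHermitian h) {f : M → N} (hf : ContMDiff 𝓘(ℝ, CSpace m) 𝓘(ℝ, V) ∞ f)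
  {X : ∀ p : M, TangentSpace 𝓘(ℝ, V) (f p)} (hX : IsSmoothAlong (W := CSpace m) f X) (a b : ℝ)

include hh hf hX

/-- The tension term has the same form for both signs, so the weights simply add up; a + b > 0 later
allows division by this factor. -/
theorem divW_eq (p : M) :
    T.divW h a b f X p = T.pairW h a b f X p + (a + b) * T.tensionForm h f X p := by
  have h1 := divForm_zeta (T := T) hf hX hh (Or.inl rfl) p
  have h2 := divForm_zeta (T := T) hf hX hh (Or.inr rfl) p
  simp only [divW, divSec, h1, h2, pairW, tensionForm]
  ring

theorem continuous_divW : Continuous (T.divW h a b f X) :=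
  (continuous_const.mul (continuous_divSec hf hX hh (Or.inl rfl))).add
    (continuous_const.mul (continuous_divSec hf hX hh (Or.inr rfl)))

variable [CompactSpace M] [T2Space M] [MeasurableSpace M] [BorelSpace M]

theorem integral_divW (hb : IsBalanced h) : ∫ p, T.divW h a b f X p ∂(volumeMeasure h) = 0 := by
  have h1 := integrable_of_continuous h (continuous_divSec (T := T) hf hX hh (Or.inl rfl))
  have h2 := integrable_of_continuous h (continuous_divSec (T := T) hf hX hh (Or.inr rfl))
  unfold divW
  rw [integral_add (h1.const_mul _) (h2.const_mul _), integral_const_mul, integral_const_mul,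
    integral_divSec hf hX hh hb (Or.inl rfl), integral_divSec hf hX hh hb (Or.inr rfl)]
  simp

theorem integral_re_divW (hb : IsBalanced h) :
    ∫ p, (T.divW h a b f X p).re ∂(volumeMeasure h) = 0 := by
  have h1 := integrable_of_continuous h (T.continuous_divW hh hf hX a b)
  have h2 := Complex.reCLM.integral_comp_comm h1
  rw [T.integral_divW hh hf hX a b hb] at h2
  simpa using h2

/-- The integrated pairing vanishes if the tension field does. -/
theorem integral_pairW_of_tension_eq_zero (hb : IsBalanced h)
    (ht : ∀ p, (T.localData h f p).tension = 0) :
    ∫ p, T.pairW h a b f X p ∂(volumeMeasure h) = 0 := by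
  have h1 : T.pairW h a b f X = T.divW h a b f X := by
    funext p
    have h2 : T.tensionForm h f X p = 0 := by
      simp [tensionForm, ht p, formG]
    rw [T.divW_eq hh hf hX, h2, mul_zero, add_zero]
  rw [h1]
  exact T.integral_divW hh hf hX a b hb

end Divergence

section Variation

variable (a b : ℝ)

theorem isSmoothFamily_energyDensity {F : ℝ × M → N}
    (hF : ContMDiff (𝓘(ℝ, ℝ).prod 𝓘(ℝ, CSpace m)) 𝓘(ℝ, V) ∞ F) (hh : IsHermitian h) :
    IsSmoothFamily (m := m) fun t p => a * (T.localData h (fun p => F (t, p)) p).densE 1 +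
      b * (T.localData h (fun p => F (t, p)) p).densE (-1) :=
  ((T.isSmoothFamily_densE hF hh (Or.inl rfl)).const_mul a).add
    ((T.isSmoothFamily_densE hF hh (Or.inr rfl)).const_mul b)

theorem deriv_energyDensity {F : ℝ × M → N}
    (hF : ContMDiff (𝓘(ℝ, ℝ).prod 𝓘(ℝ, CSpace m)) 𝓘(ℝ, V) ∞ F) (hh : IsHermitian h) (p : M) :
    deriv (fun t => a * (T.localData h (fun p => F (t, p)) p).densE 1 +
      b * (T.localData h (fun p => F (t, p)) p).densE (-1)) 0 =
    2 * (T.pairW h a b (fun p => F (0, p)) (varField F) p).re := by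
  have h1 := ((T.isSmoothFamily_densE hF hh (Or.inl rfl)).hasDerivAt 0 p).const_mul a
  have h2 := ((T.isSmoothFamily_densE hF hh (Or.inr rfl)).hasDerivAt 0 p).const_mul b
  refine (h1.add h2).deriv.trans ?_
  rw [T.deriv_densE hF hh (Or.inl rfl), T.deriv_densE hF hh (Or.inr rfl), pairW, Complex.add_re,
    Complex.re_ofReal_mul, Complex.re_ofReal_mul]
  ring

/-- Obtained without coordinates: the real pairing is half the time derivative of a density already
known to be a smooth family. -/
theorem continuous_re_pairW {F : ℝ × M → N}
    (hF : ContMDiff (𝓘(ℝ, ℝ).prod 𝓘(ℝ, CSpace m)) 𝓘(ℝ, V) ∞ F) (hh : IsHermitian h) :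
    Continuous fun p => (T.pairW h a b (fun p => F (0, p)) (varField F) p).re := by
  have h1 := (T.isSmoothFamily_energyDensity a b hF hh).continuous_deriv.comp
    (Continuous.prodMk_right (X := ℝ) (0 : ℝ))
  have h2 : ∀ p, (T.pairW h a b (fun p => F (0, p)) (varField F) p).re = (1 / 2) *
      deriv (fun t => a * (T.localData h (fun p => F (t, p)) p).densE 1 +
      b * (T.localData h (fun p => F (t, p)) p).densE (-1)) 0 := fun p => by
    rw [T.deriv_energyDensity a b hF hh p]; ring
  rw [funext h2]
  exact continuous_const.mul h1

variable [CompactSpace M] [T2Space M] [MeasurableSpace M]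

variable (h) in
/-- The weighted energy of a map. -/
def energyW (f : M → N) : ℝ :=
  ∫ p, (a * (T.localData h f p).densE 1 + b * (T.localData h f p).densE (-1)) ∂(volumeMeasure h)

variable [BorelSpace M]

/-- The first variation of the energy. -/
theorem hasDerivAt_energyW {F : ℝ × M → N}
    (hF : ContMDiff (𝓘(ℝ, ℝ).prod 𝓘(ℝ, CSpace m)) 𝓘(ℝ, V) ∞ F) (hh : IsHermitian h) :
    HasDerivAt (fun t => T.energyW h a b fun p => F (t, p))
      (2 * ∫ p, (T.pairW h a b (fun p => F (0, p)) (varField F) p).re ∂(volumeMeasure h)) 0 := by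
  refine ((T.isSmoothFamily_energyDensity a b hF hh).hasDerivAt_integral h 0).congr_deriv ?_
  rw [← integral_const_mul]
  exact integral_congr_ae (Eventually.of_forall fun p => T.deriv_energyDensity a b hF hh p)

theorem isCritical_of_tension_eq_zero (hh : IsHermitian h) (hb : IsBalanced h) {f : M → N}
    (hf : ContMDiff 𝓘(ℝ, CSpace m) 𝓘(ℝ, V) ∞ f) (ht : ∀ p, (T.localData h f p).tension = 0) :
    IsCritical (W := CSpace m) (V := V) (T.energyW h a b) f := by
  intro F hF hF0
  obtain rfl : f = fun p => F (0, p) := funext fun p => (hF0 p).symm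
  refine (T.hasDerivAt_energyW a b hF hh).congr_deriv ?_
  have hX := isSmoothAlong_varField hF
  have h1 : ∀ p, (T.pairW h a b (fun p => F (0, p)) (varField F) p) =
      T.divW h a b (fun p => F (0, p)) (varField F) p := by
    intro p
    have h2 : T.tensionForm h (fun p => F (0, p)) (varField F) p = 0 := by
      simp [tensionForm, ht p, formG]
    rw [T.divW_eq hh hf hX, h2, mul_zero, add_zero]
  simp only [h1]
  rw [T.integral_re_divW hh hf hX a b hb, mul_zero]

end Variation

section Test

variable (hh : IsHermitian h) {f : M → N} (hf : ContMDiff 𝓘(ℝ, CSpace m) 𝓘(ℝ, V) ∞ f)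
  {c : N} {v : V} {χ : M → ℝ} (hχ : IsTest (m := m) f c v χ)

include hf hχ in
theorem _root_.HarmonicMaps.IsTest.isSmoothAlong :
    IsSmoothAlong (W := CSpace m) f (testField f c v χ) := by
  obtain ⟨F, hF, hF0, hv⟩ := hχ.exists_variation hf
  obtain rfl : f = fun p => F (0, p) := funext fun p => (hF0 p).symm
  rw [← funext hv]
  exact isSmoothAlong_varField hF

include hh hf hχ in
theorem continuous_re_pairW_testField (a b : ℝ) :
    Continuous fun p => (T.pairW h a b f (testField f c v χ) p).re := by
  obtain ⟨F, hF, hF0, hv⟩ := hχ.exists_variation hf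
  obtain rfl : f = fun p => F (0, p) := funext fun p => (hF0 p).symm
  have h1 : testField (fun p => F (0, p)) c v χ = varField F := (funext hv).symm
  rw [h1]
  exact T.continuous_re_pairW a b hF hh

-- The components of the tension live in moving charts, so continuity is obtained indirectly, as the
-- difference of the divergence and the pairing, both known to be continuous. The weights (1, 0) are
-- one choice with a + b = 1.
include hh hf hχ in
theorem continuous_re_tensionForm :
    Continuous fun p => (T.tensionForm h f (testField f c v χ) p).re := by
  have hX := hχ.isSmoothAlong hf
  have h1 : ∀ p, (T.tensionForm h f (testField f c v χ) p).re =
      (T.divW h 1 0 f (testField f c v χ) p).re - (T.pairW h 1 0 f (testField f c v χ) p).re := by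
    intro p
    rw [T.divW_eq hh hf hX]
    simp
  rw [funext h1]
  exact (Complex.continuous_re.comp (T.continuous_divW hh hf hX 1 0)).sub
    (T.continuous_re_pairW_testField hh hf hχ 1 0)

theorem tensionForm_testField (p : M) : T.tensionForm h f (testField f c v χ) p =
    χ p * formG (T.G (f p) (extChartAt 𝓘(ℝ, V) (f p) (f p)))
      (T.κ (coordVecL c (extChartAt 𝓘(ℝ, V) c (f p)) v)) (T.localData h f p).tension := by
  rw [tensionForm, ← formG_smul_left]
  congr 1
  refine (map_smul T.κ (χ p) _).trans ?_
  funext i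
  simp

variable [CompactSpace M] [T2Space M] [MeasurableSpace M] [BorelSpace M]

include hh hf hχ in
theorem integral_pairW_testField_of_isCritical (a b : ℝ)
    (hc : IsCritical (W := CSpace m) (V := V) (T.energyW h a b) f) :
    ∫ p, (T.pairW h a b f (testField f c v χ) p).re ∂(volumeMeasure h) = 0 := by
  obtain ⟨F, hF, hF0, hv⟩ := hχ.exists_variation hf
  have h0 := hc F hF hF0
  obtain rfl : f = fun p => F (0, p) := funext fun p => (hF0 p).symm
  have h1 : testField (fun p => F (0, p)) c v χ = varField F := (funext hv).symm
  rw [h1]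
  have h2 := (T.hasDerivAt_energyW a b hF hh).unique h0
  linarith

include hh hf in
/-- If the pairing with all test fields vanishes, then so does the tension field. -/
theorem tension_eq_zero_of_test (hb : IsBalanced h) {a b : ℝ} (hab : 0 < a + b) (p₀ : M)
    (hτ : ∃ v, T.κ v = (T.localData h f p₀).tension)
    (H : ∀ v χ, IsTest (m := m) f (f p₀) v χ →
      ∫ p, (T.pairW h a b f (testField f (f p₀) v χ) p).re ∂(volumeMeasure h) = 0) :
    (T.localData h f p₀).tension = 0 := by
  obtain ⟨v, hv⟩ := hτ
  by_contra hne
  have hv0 : v ≠ 0 := by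
    rintro rfl
    exact hne (by rw [← hv, map_zero])
  obtain ⟨δ, hδ, χ, hχ, hχ1⟩ := exists_isTest (m := m) hf.continuous p₀ v
  have hcont := T.continuous_re_tensionForm hh hf hχ
  set r : M → ℝ := fun p => (T.tensionForm h f (testField f (f p₀) (δ • v) χ) p).re with hr
  -- The test direction is a positive multiple of the tension at `p₀`, so the value there is a
  -- positive multiple of its squared length.
  have hr0 : 0 < r p₀ := by
    have h1 : r p₀ = δ * (formG (T.G (f p₀) (extChartAt 𝓘(ℝ, V) (f p₀) (f p₀))) (T.κ v)
        (T.κ v)).re := by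
      simp only [hr]
      rw [tensionForm_testField, hχ1, Complex.ofReal_one, one_mul, coordVecL_center, ← hv, map_smul,
        ← Complex.re_ofReal_mul, ← formG_smul_left]
      refine congrArg (fun A => (formG _ A _).re) ?_
      funext i
      simp
    rw [h1]
    exact mul_pos hδ (T.pos _ v hv0)
  have hU : {p | 0 < r p} ∈ 𝓝 p₀ := (isOpen_lt continuous_const hcont).mem_nhds hr0
  -- A second cutoff supported where `r` is positive makes the integrand nonnegative. The product of
  -- the cutoffs still defines a test field, so the hypothesis applies to it.
  obtain ⟨χ', h1, h2, h3, h4, h5⟩ := exists_bump (m := m) hU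
  have hχ' := hχ.mul h1 fun p => by rw [abs_of_nonneg (h2 p)]; exact h3 p
  have hX := hχ'.isSmoothAlong hf
  have hform : ∀ p, (T.tensionForm h f (testField f (f p₀) (δ • v) fun p => χ' p * χ p) p).re =
      χ' p * r p := by
    intro p
    simp only [hr]
    rw [tensionForm_testField, tensionForm_testField, Complex.ofReal_mul, mul_assoc,
      Complex.re_ofReal_mul]
  have hint : ∫ p, χ' p * r p ∂(volumeMeasure h) = 0 := by
    -- The divergence integrates to zero because the metric is balanced, and the pairing by
    -- hypothesis; what is left is (a + b) times the wanted integral.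
    have e1 := T.integral_re_divW hh hf hX a b hb
    have e2 := H _ _ hχ'
    have e3 : ∀ p, (T.divW h a b f (testField f (f p₀) (δ • v) fun p => χ' p * χ p) p).re =
        (T.pairW h a b f (testField f (f p₀) (δ • v) fun p => χ' p * χ p) p).re +
          (a + b) * (χ' p * r p) := by
      intro p
      rw [T.divW_eq hh hf hX, Complex.add_re, ← hform, ← Complex.ofReal_add, Complex.re_ofReal_mul]
    simp only [e3] at e1
    rw [integral_add (integrable_of_continuous h (T.continuous_re_pairW_testField hh hf hχ' a b))
      (Integrable.const_mul (f := fun p => χ' p * r p)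
        (integrable_of_continuous h (h1.continuous.mul hcont)) _), e2, zero_add,
      integral_const_mul] at e1
    exact (mul_eq_zero.1 e1).resolve_left hab.ne'
  have hpos : ∀ p, 0 ≤ χ' p * r p := by
    intro p
    by_cases hp : p ∈ tsupport χ'
    · exact mul_nonneg (h2 p) (le_of_lt (h5 hp))
    · rw [image_eq_zero_of_notMem_tsupport hp, zero_mul]
  have := eq_zero_of_integral_eq_zero hh (h1.continuous.mul hcont) hpos hint p₀
  rw [Pi.mul_apply, h4, one_mul] at this
  exact hr0.ne' this

include hh hf in
/-- Critical points of the weighted energy are the maps with vanishing tension field. -/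
theorem isCritical_energyW_iff (hb : IsBalanced h) {a b : ℝ} (hab : 0 < a + b)
    (hτ : ∀ p, ∃ v, T.κ v = (T.localData h f p).tension) :
    IsCritical (W := CSpace m) (V := V) (T.energyW h a b) f ↔
      ∀ p, (T.localData h f p).tension = 0 :=
  ⟨fun hc p => T.tension_eq_zero_of_test hh hf hb hab p (hτ p) fun _ _ hχ =>
    T.integral_pairW_testField_of_isCritical hh hf hχ a b hc,
    T.isCritical_of_tension_eq_zero a b hh hb hf⟩

include hh hf in
/-- The weak form of the Euler-Lagrange equation. -/
theorem eulerLagrange_iff (hb : IsBalanced h) {a b : ℝ} (hab : 0 < a + b)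
    (hτ : ∀ p, ∃ v, T.κ v = (T.localData h f p).tension)
    (him : ∀ c v χ, IsTest (m := m) f c v χ →
      Continuous fun p => (T.tensionForm h f (testField f c v χ) p).im) :
    (∀ X : ∀ p : M, TangentSpace 𝓘(ℝ, V) (f p), IsSmoothAlong (W := CSpace m) f X →
      ∫ p, T.pairW h a b f X p ∂(volumeMeasure h) = 0) ↔
      ∀ p, (T.localData h f p).tension = 0 := by
  refine ⟨fun H p => T.tension_eq_zero_of_test hh hf hb hab p (hτ p) fun v χ hχ => ?_,
    fun ht X hX => T.integral_pairW_of_tension_eq_zero hh hf hX a b hb ht⟩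
  have hX := hχ.isSmoothAlong hf
  have h1 : T.pairW h a b f (testField f (f p) v χ) = fun q =>
      T.divW h a b f (testField f (f p) v χ) q -
        (a + b) * T.tensionForm h f (testField f (f p) v χ) q := by
    funext q
    rw [T.divW_eq hh hf hX]; ring
  -- Taking the real part of the integral requires integrability of the complex pairing, since the
  -- Bochner integral of a nonintegrable function is zero by convention. Hence continuity of the
  -- imaginary part is also needed.
  have h2 : Continuous (T.tensionForm h f (testField f (f p) v χ)) := by
    have h3 : T.tensionForm h f (testField f (f p) v χ) = fun q =>
        ((T.tensionForm h f (testField f (f p) v χ) q).re : ℂ) +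
          (T.tensionForm h f (testField f (f p) v χ) q).im * Complex.I :=
      funext fun q => (Complex.re_add_im _).symm
    rw [h3]
    exact (Complex.continuous_ofReal.comp (T.continuous_re_tensionForm hh hf hχ)).add
      ((Complex.continuous_ofReal.comp (him _ _ _ hχ)).mul continuous_const)
  have h4 : Continuous (T.pairW h a b f (testField f (f p) v χ)) := by
    rw [h1]
    exact (T.continuous_divW hh hf hX a b).sub (continuous_const.mul h2)
  have h5 := Complex.reCLM.integral_comp_comm (integrable_of_continuous h h4)
  rw [H _ hX] at h5
  simpa using h5

end Test

end TargetFrame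

end Equivalence

/-! ### Kähler targets: the Chern connection is metric and torsion-free. -/

section Kahler

variable {n : ℕ} {N : Type*} [TopologicalSpace N] [ChartedSpace (CSpace n) N]
  [IsManifold 𝓘(ℂ, CSpace n) ω N] {g : RiemMetric (CSpace n) N}

/-- The complex coordinates of a vector, as a real linear map. -/
def complexCoords (n : ℕ) : CSpace n →L[ℝ] (Fin n → ℂ) :=
  ((EuclideanSpace.equiv (Fin n) ℂ : CSpace n →L[ℂ] (Fin n → ℂ))).restrictScalars ℝ

theorem complexCoords_I_smul (v : CSpace n) :
    complexCoords n (Complex.I • v) = Complex.I • complexCoords n v := rfl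

theorem sum_coord_smul_cBasis (v : CSpace n) : ∑ i, v i • (cBasis i : CSpace n) = v := by
  have := (stdBasis n).sum_repr v
  simpa [stdBasis, cBasis] using this

theorem formG_gram {g : CSpace n →L[ℝ] CSpace n →L[ℝ] ℝ} (hg : IsHermitianInner g)
    (x : Fin n → CSpace n) (a b : Fin n → ℂ) :
    formG (IsHermitianInner.gram g x) a b = hermOf g (∑ i, a i • x i) (∑ j, b j • x j) := by
  rw [hg.hermOf_sum_left]
  simp only [hg.hermOf_sum_right, formG, IsHermitianInner.gram, Matrix.of_apply, Finset.mul_sum]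
  exact Finset.sum_congr rfl fun i _ => Finset.sum_congr rfl fun j _ => by ring

theorem formG_hermMatrix (hg : IsHermitian g) (b : N) {y : CSpace n}
    (hy : y ∈ (extChartAt 𝓘(ℝ, CSpace n) b).target) (v w : CSpace n) :
    formG (hermMatrix g b y) (complexCoords n v) (complexCoords n w) =
      hermOf (metricAt g ((extChartAt 𝓘(ℝ, CSpace n) b).symm y)) (coordVecL b y v)
        (coordVecL b y w) := by
  rw [hermMatrix_eq_gram g b hy, formG_gram (isHermitianInner_metricAt hg _)]
  have h1 : ∀ v : CSpace n, ∑ i, complexCoords n v i • chartBasis b hy i = coordVecL b y v := by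
    intro v
    have h2 : coordVecC b hy v = coordVecL b y v := rfl
    rw [← h2]
    conv_rhs => rw [← sum_coord_smul_cBasis v, map_sum]
    refine Finset.sum_congr rfl fun i _ => ?_
    rw [map_smul, chartBasis_apply]
    rfl
  rw [h1, h1]

theorem formG_hermMatrix_center (hg : IsHermitian g) (q : N) (v w : CSpace n) :
    formG (hermMatrix g q (extChartAt 𝓘(ℝ, CSpace n) q q)) (complexCoords n v)
      (complexCoords n w) = hermOf (metricAt g q) v w := by
  rw [formG_hermMatrix hg q (mem_extChartAt_target q), coordVecL_center, coordVecL_center,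
    extChartAt_to_inv]

theorem hermMatrix_conj (hg : IsHermitian g) (b : N) {y : CSpace n}
    (hy : y ∈ (extChartAt 𝓘(ℝ, CSpace n) b).target) (i j : Fin n) :
    (starRingEnd ℂ) (hermMatrix g b y i j) = hermMatrix g b y j i := by
  rw [hermMatrix_eq_gram g b hy]
  exact (isHermitianInner_metricAt hg _).gram_conj _ i j

theorem fderiv_eq_sum_dz (u : CSpace n → ℂ) (y v : CSpace n) :
    fderiv ℝ u y v = ∑ k, (dz k u y * v k + dzbar k u y * (starRingEnd ℂ) (v k)) := by
  conv_lhs => rw [← sum_coord_smul_cBasis v, map_sum]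
  refine Finset.sum_congr rfl fun k _ => ?_
  rw [complex_smul_eq, map_add, map_smul, map_smul, dz, dzbar, Complex.real_smul,
    Complex.real_smul]
  set A := fderiv ℝ u y (cBasis k)
  set B := fderiv ℝ u y (Complex.I • cBasis k)
  have h1 : v k = ((v k).re : ℂ) + (v k).im * Complex.I := (Complex.re_add_im _).symm
  have h2 : (starRingEnd ℂ) (v k) = ((v k).re : ℂ) - (v k).im * Complex.I := by
    apply Complex.ext <;> simp
  rw [h2]
  conv_rhs => rw [h1]
  simp only [Complex.add_re, Complex.add_im, Complex.ofReal_re, Complex.ofReal_im,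
    Complex.re_ofReal_mul, Complex.im_ofReal_mul, Complex.I_re, Complex.I_im, mul_zero, mul_one,
    add_zero, zero_add]
  linear_combination ((v k).im : ℂ) * B * Complex.I_sq

theorem conj_dz (u : CSpace n → ℂ) (k : Fin n) (y : CSpace n) (hu : DifferentiableAt ℝ u y) :
    (starRingEnd ℂ) (dz k u y) = dzbar k (fun y => (starRingEnd ℂ) (u y)) y := by
  have h1 : fderiv ℝ (fun y => (starRingEnd ℂ) (u y)) y = _ :=
    ((Complex.conjCLE : ℂ →L[ℝ] ℂ).hasFDerivAt.comp y hu.hasFDerivAt).fderiv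
  have h2 : ∀ v, fderiv ℝ (fun y => (starRingEnd ℂ) (u y)) y v =
      (starRingEnd ℂ) (fderiv ℝ u y v) := fun v => by rw [h1]; rfl
  simp only [dz, dzbar, h2, map_mul, map_sub, map_div₀, map_one, map_ofNat, Complex.conj_I]
  ring

theorem differentiableAt_hermMatrix (g : RiemMetric (CSpace n) N) (b : N) (i j : Fin n) :
    DifferentiableAt ℝ (fun y => hermMatrix g b y i j) (extChartAt 𝓘(ℝ, CSpace n) b b) :=
  ((contDiffOn_hermMatrix g b i j).contDiffAt (target_mem_nhds b (mem_extChartAt_target b)))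
    |>.differentiableAt (by simp)

/-- Lowering the upper index cancels the inverse metric in the definition of the Christoffel
symbols. -/
theorem christoffel_mul_hermMatrix (hg : IsHermitian g) (b : N) (k i j : Fin n) :
    ∑ l, KahlerTarget.christoffel g b l k i *
      hermMatrix g b (extChartAt 𝓘(ℝ, CSpace n) b b) l j =
    dz k (fun y => hermMatrix g b y i j) (extChartAt 𝓘(ℝ, CSpace n) b b) := by
  set y := extChartAt 𝓘(ℝ, CSpace n) b b with hy
  have hu : IsUnit (hermMatrix g b y).det := by
    refine isUnit_iff_ne_zero.2 fun h0 => ?_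
    have := hermMatrix_det_pos hg b (mem_extChartAt_target (I := 𝓘(ℝ, CSpace n)) b)
    rw [← hy, h0] at this
    simp at this
  have h1 : ∀ s, ∑ l, (hermMatrix g b y)⁻¹ s l * hermMatrix g b y l j =
      (1 : Matrix (Fin n) (Fin n) ℂ) s j := fun s => by
    rw [← Matrix.nonsing_inv_mul _ hu, Matrix.mul_apply]
  simp only [KahlerTarget.christoffel, raise, Finset.sum_mul, ← hy]
  rw [Finset.sum_comm]
  have h2 : ∀ s, ∑ l, (hermMatrix g b y)⁻¹ s l * dz k (fun y => hermMatrix g b y i s) y *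
      hermMatrix g b y l j = dz k (fun y => hermMatrix g b y i s) y *
        (1 : Matrix (Fin n) (Fin n) ℂ) s j := by
    intro s
    rw [← h1, Finset.mul_sum]
    exact Finset.sum_congr rfl fun l _ => by ring
  simp only [h2, Matrix.one_apply, mul_ite, mul_one, mul_zero, Finset.sum_ite_eq',
    Finset.mem_univ, if_true]

theorem sum_mul_add_sum_mul_comm (A B : Fin n → Fin n → ℂ) (c d w w' : Fin n → ℂ) :
    ∑ k, ((∑ l, A l k * c l) * w k + (∑ l, B l k * d l) * w' k) =
      ∑ l, ((∑ k, A l k * w k) * c l + (∑ k, B l k * w' k) * d l) := by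
  simp only [Finset.sum_add_distrib, Finset.sum_mul]
  congr 1 <;> rw [Finset.sum_comm] <;>
    exact Finset.sum_congr rfl fun l _ => Finset.sum_congr rfl fun k _ => mul_right_comm _ _ _

/-- Metric compatibility of the Chern connection, valid for every Hermitian metric. The
∂-derivatives are lowered Christoffel symbols, and the ∂̄-derivatives are their conjugates by
Hermitian symmetry. -/
theorem fderiv_hermMatrix (hg : IsHermitian g) (b : N) (v : CSpace n) (i j : Fin n) :
    fderiv ℝ (fun y => hermMatrix g b y i j) (extChartAt 𝓘(ℝ, CSpace n) b b) v =
    ∑ l, ((∑ k, KahlerTarget.christoffel g b l k i * complexCoords n v k) *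
        hermMatrix g b (extChartAt 𝓘(ℝ, CSpace n) b b) l j +
      (starRingEnd ℂ) (∑ k, KahlerTarget.christoffel g b l k j * complexCoords n v k) *
        hermMatrix g b (extChartAt 𝓘(ℝ, CSpace n) b b) i l) := by
  set y := extChartAt 𝓘(ℝ, CSpace n) b b with hy
  have ht := mem_extChartAt_target (I := 𝓘(ℝ, CSpace n)) b
  have h1 : ∀ k, dzbar k (fun y => hermMatrix g b y i j) y =
      ∑ l, (starRingEnd ℂ) (KahlerTarget.christoffel g b l k j) * hermMatrix g b y i l := by
    intro k
    have h2 : (fun y => hermMatrix g b y i j) =ᶠ[𝓝 y]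
        fun y => (starRingEnd ℂ) (hermMatrix g b y j i) := by
      filter_upwards [target_mem_nhds b ht] with z hz
      exact (hermMatrix_conj hg b hz j i).symm
    have h3 : dzbar k (fun y => hermMatrix g b y i j) y =
        dzbar k (fun y => (starRingEnd ℂ) (hermMatrix g b y j i)) y := by
      simp only [dzbar, h2.fderiv_eq]
    rw [h3, ← conj_dz _ k y (differentiableAt_hermMatrix g b j i),
      ← christoffel_mul_hermMatrix hg b k j i, map_sum]
    refine Finset.sum_congr rfl fun l _ => ?_
    rw [map_mul, hermMatrix_conj hg b ht]
  have h0 : ∀ k, dz k (fun y => hermMatrix g b y i j) y =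
      ∑ l, KahlerTarget.christoffel g b l k i * hermMatrix g b y l j :=
    fun k => (christoffel_mul_hermMatrix hg b k i j).symm
  have h4 : ∀ l, (starRingEnd ℂ) (∑ k, KahlerTarget.christoffel g b l k j *
      complexCoords n v k) = ∑ k, (starRingEnd ℂ) (KahlerTarget.christoffel g b l k j) *
        (starRingEnd ℂ) (v k) := fun l => by
    rw [map_sum]
    exact Finset.sum_congr rfl fun k _ => map_mul _ _ _
  rw [fderiv_eq_sum_dz]
  simp only [h0, h1, h4]
  exact sum_mul_add_sum_mul_comm _ _ _ _ _ _

/-- The derivatives of the metric at the centre of a chart. -/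
def metricDeriv (g : RiemMetric (CSpace n) N) (b : N) (u v w : CSpace n) : ℝ :=
  fderiv ℝ (fun y => metricAt g ((extChartAt 𝓘(ℝ, CSpace n) b).symm y)
    (coordVecL b y v) (coordVecL b y w)) (extChartAt 𝓘(ℝ, CSpace n) b b) u

theorem metricDeriv_neg_right (b : N) (u v w : CSpace n) :
    metricDeriv g b u v (-w) = -metricDeriv g b u v w := by
  simp only [metricDeriv, map_neg, fderiv_fun_neg, neg_apply]

theorem metricDeriv_symm (b : N) (u v w : CSpace n) :
    metricDeriv g b u v w = metricDeriv g b u w v := by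
  simp only [metricDeriv, metricAt_symm g _ (coordVecL b _ v)]

/-- J has constant coefficients in a holomorphic chart, so its skewness with respect to the metric
survives differentiation. -/
theorem metricDeriv_I_left (hg : IsHermitian g) (b : N) (u v w : CSpace n) :
    metricDeriv g b u (Complex.I • v) w = -metricDeriv g b u v (Complex.I • w) := by
  have h1 : (fun y => metricAt g ((extChartAt 𝓘(ℝ, CSpace n) b).symm y)
      (coordVecL b y (Complex.I • v)) (coordVecL b y w)) =ᶠ[𝓝 (extChartAt 𝓘(ℝ, CSpace n) b b)]
      fun y => -metricAt g ((extChartAt 𝓘(ℝ, CSpace n) b).symm y)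
      (coordVecL b y v) (coordVecL b y (Complex.I • w)) := by
    filter_upwards [target_mem_nhds b (mem_extChartAt_target b)] with y hy
    rw [coordVecL_I b hy, coordVecL_I b hy]
    exact (isHermitianInner_metricAt hg _).I_left _ _
  rw [metricDeriv, h1.fderiv_eq, fderiv_fun_neg]
  rfl

theorem IsKahler.metricDeriv_cyclic (hg : IsKahler g) (b : N) (u v w : CSpace n) :
    metricDeriv g b u (Complex.I • v) w - metricDeriv g b v (Complex.I • u) w +
      metricDeriv g b w (Complex.I • u) v = 0 := by
  have h1 : ∀ v w : CSpace n,
      (fun y => fundForm g _ (coordVec b y v) (coordVec b y w)) =ᶠ[𝓝 (extChartAt 𝓘(ℝ, CSpace n) b b)]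
      fun y => metricAt g ((extChartAt 𝓘(ℝ, CSpace n) b).symm y)
        (coordVecL b y (Complex.I • v)) (coordVecL b y w) := by
    intro v w
    filter_upwards [target_mem_nhds b (mem_extChartAt_target b)] with y hy
    rw [coordVecL_I b hy]
    rfl
  have h2 := hg.2 b u v w
  simp only [(h1 _ _).fderiv_eq] at h2
  exact h2

theorem dz_hermMatrix (b : N) (j k l : Fin n) :
    dz j (fun y => hermMatrix g b y k l) (extChartAt 𝓘(ℝ, CSpace n) b b) = (1 / 2) *
      (((metricDeriv g b (cBasis j) (cBasis k) (cBasis l) +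
        metricDeriv g b (Complex.I • cBasis j) (cBasis k) (Complex.I • cBasis l) : ℝ) : ℂ) +
      Complex.I * ((metricDeriv g b (cBasis j) (cBasis k) (Complex.I • cBasis l) -
        metricDeriv g b (Complex.I • cBasis j) (cBasis k) (cBasis l) : ℝ) : ℂ)) := by
  set y := extChartAt 𝓘(ℝ, CSpace n) b b with hy
  have ht := target_mem_nhds b (mem_extChartAt_target (I := 𝓘(ℝ, CSpace n)) b)
  have h1 : (fun y => hermMatrix g b y k l) =ᶠ[𝓝 y] fun y =>
      ((metricAt g ((extChartAt 𝓘(ℝ, CSpace n) b).symm y)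
        (coordVecL b y (cBasis k)) (coordVecL b y (cBasis l)) : ℝ) : ℂ) + Complex.I *
      ((metricAt g ((extChartAt 𝓘(ℝ, CSpace n) b).symm y)
        (coordVecL b y (cBasis k)) (coordVecL b y (Complex.I • cBasis l)) : ℝ) : ℂ) := by
    filter_upwards [ht] with z hz
    rw [coordVecL_I b hz]
    rfl
  have hd : ∀ v w : CSpace n, DifferentiableAt ℝ (fun y =>
      metricAt g ((extChartAt 𝓘(ℝ, CSpace n) b).symm y) (coordVecL b y v) (coordVecL b y w)) y :=
    fun v w => ((contDiffOn_metricAt g b v w).contDiffAt ht).differentiableAt (by simp)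
  have h2 := fun v w => Complex.ofRealCLM.hasFDerivAt.comp y (hd v w).hasFDerivAt
  have h3 : HasFDerivAt (fun y =>
      ((metricAt g ((extChartAt 𝓘(ℝ, CSpace n) b).symm y)
        (coordVecL b y (cBasis k)) (coordVecL b y (cBasis l)) : ℝ) : ℂ) + Complex.I *
      ((metricAt g ((extChartAt 𝓘(ℝ, CSpace n) b).symm y)
        (coordVecL b y (cBasis k)) (coordVecL b y (Complex.I • cBasis l)) : ℝ) : ℂ)) _ y :=
    (h2 (cBasis k) (cBasis l)).add ((h2 (cBasis k) (Complex.I • cBasis l)).const_mul Complex.I)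
  have h4 : ∀ u, fderiv ℝ (fun y => hermMatrix g b y k l) y u =
      (metricDeriv g b u (cBasis k) (cBasis l) : ℂ) +
        Complex.I * (metricDeriv g b u (cBasis k) (Complex.I • cBasis l) : ℂ) := by
    intro u
    rw [h1.fderiv_eq, h3.fderiv]
    rfl
  rw [dz, h4, h4]
  push_cast
  linear_combination (-(1 / 2) * (metricDeriv g b (Complex.I • cBasis j) (cBasis k)
    (Complex.I • cBasis l) : ℂ)) * Complex.I_sq

/-- The Christoffel symbols of a Kähler metric are symmetric. -/
theorem IsKahler.christoffel_symm (hg : IsKahler g) (b : N) (i j k : Fin n) :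
    KahlerTarget.christoffel g b i j k = KahlerTarget.christoffel g b i k j := by
  have h1 : ∀ u v w, metricDeriv g b u v w + metricDeriv g b (Complex.I • u) v (Complex.I • w) =
      metricDeriv g b v u w + metricDeriv g b (Complex.I • v) u (Complex.I • w) := by
    intro u v w
    -- Closedness is used on (u, v, iw) and on (iu, iv, iw). The derivative in the direction iw
    -- occurs in both with the same value and cancels in the difference.
    have e1 := hg.metricDeriv_cyclic b u v (Complex.I • w)
    have e2 := hg.metricDeriv_cyclic b (Complex.I • u) (Complex.I • v) (Complex.I • w)
    have e3 : ∀ a c d, metricDeriv g b a (-c) d = -metricDeriv g b a c d := fun a c d => by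
      rw [metricDeriv_symm, metricDeriv_neg_right, metricDeriv_symm]
    simp only [metricDeriv_I_left hg.1, I_smul_I_smul, metricDeriv_neg_right, e3, neg_neg] at e1 e2
    linarith
  refine Finset.sum_congr rfl fun l _ => congrArg (_ * ·) ?_
  rw [dz_hermMatrix, dz_hermMatrix, h1]
  -- The identity gives the real part of the symmetry of ∂_j g_{kl̄}; inserting i times the last
  -- basis vector gives the imaginary part.
  have h2 := h1 (cBasis j) (cBasis k) (Complex.I • cBasis l)
  simp only [I_smul_I_smul, metricDeriv_neg_right, ← sub_eq_add_neg] at h2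
  rw [h2]

/-- The holomorphic tangent frame of a Kähler manifold. -/
def kahlerFrame (g : RiemMetric (CSpace n) N) (hg : IsKahler g) :
    TargetFrame n (CSpace n) N where
  κ := complexCoords n
  G := hermMatrix g
  Γ := KahlerTarget.christoffel g
  contDiffOn_G := contDiffOn_hermMatrix g
  G_conj b _ hy := hermMatrix_conj hg.1 b hy
  compat b v i j := fderiv_hermMatrix hg.1 b v i j
  symm := hg.christoffel_symm
  change b y hy q hq v w := by
    rw [formG_hermMatrix_center hg.1, formG_hermMatrix hg.1 b hy, hq]
  pos b v hv := by
    rw [formG_hermMatrix_center hg.1, (isHermitianInner_metricAt hg.1 b).hermOf_self]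
    exact metricAt_pos g b hv

end Kahler

/-! ### The equivalences for Kähler targets. -/

section KahlerMaps

variable {m : ℕ} {M : Type*} [TopologicalSpace M] [ChartedSpace (CSpace m) M]
  [IsManifold 𝓘(ℂ, CSpace m) ω M]
  {n : ℕ} {N : Type*} [TopologicalSpace N] [ChartedSpace (CSpace n) N]
  [IsManifold 𝓘(ℂ, CSpace n) ω N]
  {h : RiemMetric (CSpace m) M} {g : RiemMetric (CSpace n) N} (hg : IsKahler g)

theorem kahlerLocalData_eq (f : M → N) (p : M) :
    KahlerTarget.localData h g f p = (kahlerFrame g hg).localData h f p := by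
  have h1 := locMap_center (W := CSpace m) (V := CSpace n) p f
  simp only [TargetFrame.localData, TargetFrame.dataOf, h1]
  rfl

/-- Multiplying the direction by i turns the real part into minus the imaginary part, so this
reduces to the continuity of the real part for another test field. -/
theorem continuous_im_tensionForm_kahler (hh : IsHermitian h) {f : M → N}
    (hf : ContMDiff 𝓘(ℝ, CSpace m) 𝓘(ℝ, CSpace n) ∞ f) {c : N} {v : CSpace n} {χ : M → ℝ}
    (hχ : IsTest (m := m) f c v χ) :
    Continuous fun p => ((kahlerFrame g hg).tensionForm h f (testField f c v χ) p).im := by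
  have h1 := (kahlerFrame g hg).continuous_re_tensionForm hh hf
    (hχ.congr_vec (v' := Complex.I • v) (by rw [norm_smul, Complex.norm_I, one_mul]))
  refine h1.neg.congr fun p => ?_
  change -((kahlerFrame g hg).tensionForm h f (testField f c (Complex.I • v) χ) p).re = _
  rw [TargetFrame.tensionForm_testField, TargetFrame.tensionForm_testField]
  -- Complex linearity of the coordinate vectors is available only inside the chart; elsewhere the
  -- cutoff vanishes.
  by_cases hp : χ p = 0
  · simp [hp]
  · obtain ⟨r, -, -, ht⟩ := hχ.exists_radius
    have h2 := (ht (subset_tsupport _ hp)).1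
    rw [coordVecL_I c ((extChartAt 𝓘(ℝ, CSpace n) c).map_source h2)]
    have h3 : ∀ w, (kahlerFrame g hg).κ (Complex.I • w) =
        Complex.I • (kahlerFrame g hg).κ w := complexCoords_I_smul
    rw [h3, formG_smul_left]
    simp

include hg in
theorem kahler_tfae [CompactSpace M] [T2Space M] [MeasurableSpace M] [BorelSpace M]
    (hh : IsHermitian h) (hb : IsBalanced h) {f : M → N}
    (hf : ContMDiff 𝓘(ℝ, CSpace m) 𝓘(ℝ, CSpace n) ∞ f) :
    List.TFAE [KahlerTarget.IsDbarHarmonic h g f, KahlerTarget.DbarEulerLagrange h g f,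
      KahlerTarget.IsDelHarmonic h g f, KahlerTarget.DelEulerLagrange h g f,
      KahlerTarget.IsHarmonic h g f, KahlerTarget.EulerLagrange h g f,
      KahlerTarget.IsHermitianHarmonic h g f] := by
  set T := kahlerFrame g hg with hT
  -- The complex components of a tangent vector are arbitrary, so every tension is the component
  -- vector of a test direction.
  have hτ : ∀ p, ∃ v, T.κ v = (T.localData h f p).tension := fun p =>
    ⟨WithLp.toLp 2 (T.localData h f p).tension, rfl⟩
  have hiff : KahlerTarget.IsHermitianHarmonic h g f ↔ ∀ p, (T.localData h f p).tension = 0 :=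
    forall_congr' fun p => by
      rw [kahlerLocalData_eq hg, LocalData.hermitianHarmonicEq_iff]
  have hcrit : ∀ a b : ℝ, 0 < a + b →
      (IsCritical (W := CSpace m) (V := CSpace n) (T.energyW h a b) f ↔
        KahlerTarget.IsHermitianHarmonic h g f) := fun a b hab =>
    (T.isCritical_energyW_iff hh hf hb hab hτ).trans hiff.symm
  have hel : ∀ a b : ℝ, 0 < a + b →
      ((∀ X : ∀ p : M, TangentSpace 𝓘(ℝ, CSpace n) (f p), IsSmoothAlong (W := CSpace m) f X →
        ∫ p, T.pairW h a b f X p ∂(volumeMeasure h) = 0) ↔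
        KahlerTarget.IsHermitianHarmonic h g f) := fun a b hab =>
    (T.eulerLagrange_iff hh hf hb hab hτ
      fun c v χ hχ => continuous_im_tensionForm_kahler hg hh hf hχ).trans hiff.symm
  have e1 : KahlerTarget.dbarEnergy h g = T.energyW h 1 0 := by
    funext f
    simp only [KahlerTarget.dbarEnergy, TargetFrame.energyW, kahlerLocalData_eq hg,
      LocalData.dbarNormSq_eq, one_mul, zero_mul, add_zero, ← hT]
  have e2 : KahlerTarget.delEnergy h g = T.energyW h 0 1 := by
    funext f
    simp only [KahlerTarget.delEnergy, TargetFrame.energyW, kahlerLocalData_eq hg,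
      LocalData.delNormSq_eq, one_mul, zero_mul, zero_add, ← hT]
  have e3 : KahlerTarget.energy h g = T.energyW h 1 1 := by
    funext f
    simp only [KahlerTarget.energy, TargetFrame.energyW, kahlerLocalData_eq hg,
      LocalData.delNormSq_eq, LocalData.dbarNormSq_eq, one_mul, ← hT]
  have i1 := hcrit 1 0 (by norm_num)
  have i2 := hcrit 0 1 (by norm_num)
  have i3 := hcrit 1 1 (by norm_num)
  have j1 := hel 1 0 (by norm_num)
  have j2 := hel 0 1 (by norm_num)
  have j3 := hel 1 1 (by norm_num)
  rw [← e1] at i1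
  rw [← e2] at i2
  rw [← e3] at i3
  simp only [TargetFrame.pairW, Complex.ofReal_one, Complex.ofReal_zero, one_mul, zero_mul,
    add_zero, zero_add, ← LocalData.dbarPair_eq, ← LocalData.delPair_eq, hT,
    ← kahlerLocalData_eq hg] at j1 j2 j3
  tfae_have 1 ↔ 7 := i1
  tfae_have 2 ↔ 7 := j1
  tfae_have 3 ↔ 7 := i2
  tfae_have 4 ↔ 7 := j2
  tfae_have 5 ↔ 7 := i3
  tfae_have 6 ↔ 7 := j3
  tfae_finish

end KahlerMaps

/-! ### Complex linearity of the pairing in the section. -/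

namespace LocalData

variable {m n : ℕ} (D : LocalData m n)

theorem covE_add_I_mul (ε : ℂ) {s s' : Fin n → CSpace m → ℂ}
    (hs : ∀ i, DifferentiableAt ℝ (s i) D.pt) (hs' : ∀ i, DifferentiableAt ℝ (s' i) D.pt)
    (α : Fin m) : D.covE ε (fun i x => s i x + Complex.I * s' i x) α =
      D.covE ε s α + Complex.I • D.covE ε s' α := by
  funext i
  have h1 : HasFDerivAt (fun x => s i x + Complex.I * s' i x) _ D.pt :=
    (hs i).hasFDerivAt.add ((hs' i).hasFDerivAt.const_mul Complex.I)
  have h2 : ∑ j, ∑ k, D.Γ i j k * D.dfE ε α j * (s k D.pt + Complex.I * s' k D.pt) =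
      ∑ j, ∑ k, D.Γ i j k * D.dfE ε α j * s k D.pt +
        Complex.I * ∑ j, ∑ k, D.Γ i j k * D.dfE ε α j * s' k D.pt := by
    simp only [Finset.mul_sum, ← Finset.sum_add_distrib]
    exact Finset.sum_congr rfl fun j _ => Finset.sum_congr rfl fun k _ => by ring
  simp only [covE, dE, Pi.add_apply, Pi.smul_apply, smul_eq_mul]
  rw [h1.fderiv, h2]
  simp only [add_apply, smul_apply, smul_eq_mul]
  ring

theorem pairE_add_I_mul (ε : ℂ) {s s' : Fin n → CSpace m → ℂ}
    (hs : ∀ i, DifferentiableAt ℝ (s i) D.pt) (hs' : ∀ i, DifferentiableAt ℝ (s' i) D.pt) :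
    D.pairE ε (fun i x => s i x + Complex.I * s' i x) =
      D.pairE ε s + Complex.I * D.pairE ε s' := by
  simp only [pairE, innerE, Finset.mul_sum, ← Finset.sum_add_distrib]
  refine Finset.sum_congr rfl fun α _ => Finset.sum_congr rfl fun β _ => ?_
  rw [D.covE_add_I_mul ε hs hs', formG_add_left, formG_smul_left]
  ring

end LocalData

/-! ### Riemannian targets: the Levi-Civita connection. -/

section Riemannian

variable {n : ℕ} {N : Type*} [TopologicalSpace N] [ChartedSpace (RSpace n) N]
  [IsManifold 𝓘(ℝ, RSpace n) ∞ N] (g : RiemMetric (RSpace n) N)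

/-- The real coordinates of a vector, regarded as complex numbers. -/
def realCoords (n : ℕ) : RSpace n →L[ℝ] (Fin n → ℂ) :=
  ContinuousLinearMap.pi fun i => Complex.ofRealCLM.comp (EuclideanSpace.proj i)

theorem realCoords_apply (v : RSpace n) (i : Fin n) : realCoords n v i = (v i : ℂ) := rfl

theorem sum_coord_smul_rBasis (v : RSpace n) : ∑ i, v i • (rBasis i : RSpace n) = v := by
  have := ((EuclideanSpace.basisFun (Fin n) ℝ).toBasis).sum_repr v
  simpa [rBasis] using this

theorem metricMatrix_apply (b : N) (y : RSpace n) (i j : Fin n) :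
    RiemannianTarget.metricMatrix g b y i j =
      metricAt g ((extChartAt 𝓘(ℝ, RSpace n) b).symm y) (coordVecL b y (rBasis i))
        (coordVecL b y (rBasis j)) := rfl

theorem metricMatrix_symm (b : N) (y : RSpace n) (i j : Fin n) :
    RiemannianTarget.metricMatrix g b y i j = RiemannianTarget.metricMatrix g b y j i := by
  rw [metricMatrix_apply, metricMatrix_apply, metricAt_symm]

theorem metricAt_coordVecL_eq_sum (b : N) (y v w : RSpace n) :
    metricAt g ((extChartAt 𝓘(ℝ, RSpace n) b).symm y) (coordVecL b y v) (coordVecL b y w) =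
      ∑ i, ∑ j, RiemannianTarget.metricMatrix g b y i j * v i * w j := by
  conv_lhs => rw [← sum_coord_smul_rBasis v, ← sum_coord_smul_rBasis w]
  simp only [map_sum, map_smul, sum_apply, smul_apply, smul_eq_mul, metricMatrix_apply,
    Finset.mul_sum]
  rw [Finset.sum_comm]
  exact Finset.sum_congr rfl fun i _ => Finset.sum_congr rfl fun j _ => by ring

theorem formG_metricMatrix (b : N) (y v w : RSpace n) :
    formG ((RiemannianTarget.metricMatrix g b y).map Complex.ofReal) (realCoords n v)
      (realCoords n w) =
    (metricAt g ((extChartAt 𝓘(ℝ, RSpace n) b).symm y) (coordVecL b y v) (coordVecL b y w) : ℝ) := by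
  rw [metricAt_coordVecL_eq_sum]
  simp only [formG, Matrix.map_apply, realCoords_apply, Complex.conj_ofReal]
  push_cast
  rfl

theorem formG_metricMatrix_center (q : N) (v w : RSpace n) :
    formG ((RiemannianTarget.metricMatrix g q (extChartAt 𝓘(ℝ, RSpace n) q q)).map Complex.ofReal)
      (realCoords n v) (realCoords n w) = (metricAt g q v w : ℝ) := by
  rw [formG_metricMatrix, coordVecL_center, coordVecL_center, extChartAt_to_inv]

theorem isUnit_det_metricMatrix (b : N) :
    IsUnit (RiemannianTarget.metricMatrix g b (extChartAt 𝓘(ℝ, RSpace n) b b)).det := by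
  have h : (RiemannianTarget.metricMatrix g b (extChartAt 𝓘(ℝ, RSpace n) b b)).PosDef := by
    refine Matrix.PosDef.of_dotProduct_mulVec_pos (Matrix.IsHermitian.ext fun i j => ?_) fun c hc => ?_
    · exact metricMatrix_symm g b _ j i
    · have h1 := metricAt_coordVecL_eq_sum g b (extChartAt 𝓘(ℝ, RSpace n) b b) (WithLp.toLp 2 c)
        (WithLp.toLp 2 c)
      rw [coordVecL_center, extChartAt_to_inv] at h1
      have h2 := metricAt_pos g b (v := WithLp.toLp 2 c) (by simpa using hc)
      rw [h1] at h2
      refine h2.trans_eq ?_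
      simp only [dotProduct, Matrix.mulVec, Finset.mul_sum, Pi.star_apply, star_trivial]
      exact Finset.sum_congr rfl fun i _ => Finset.sum_congr rfl fun j _ => by ring
  exact isUnit_iff_ne_zero.2 h.det_pos.ne'

theorem contDiffOn_metricMatrix (b : N) (i j : Fin n) :
    ContDiffOn ℝ ∞ (fun y => RiemannianTarget.metricMatrix g b y i j)
      (extChartAt 𝓘(ℝ, RSpace n) b).target := contDiffOn_metricAt g b _ _

theorem riemannian_christoffel_symm (b : N) (i j k : Fin n) :
    RiemannianTarget.christoffel g b i j k = RiemannianTarget.christoffel g b i k j := by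
  simp only [RiemannianTarget.christoffel, metricMatrix_symm g b _ k j]
  refine congrArg _ (Finset.sum_congr rfl fun l _ => ?_)
  ring

/-- The Christoffel symbols of the first kind. -/
theorem christoffel_mul_metricMatrix (b : N) (k i j : Fin n) :
    ∑ l, RiemannianTarget.christoffel g b l k i *
      RiemannianTarget.metricMatrix g b (extChartAt 𝓘(ℝ, RSpace n) b b) l j = (1 / 2) *
    (fderiv ℝ (fun y => RiemannianTarget.metricMatrix g b y i j)
        (extChartAt 𝓘(ℝ, RSpace n) b b) (rBasis k)
      + fderiv ℝ (fun y => RiemannianTarget.metricMatrix g b y k j)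
        (extChartAt 𝓘(ℝ, RSpace n) b b) (rBasis i)
      - fderiv ℝ (fun y => RiemannianTarget.metricMatrix g b y k i)
        (extChartAt 𝓘(ℝ, RSpace n) b b) (rBasis j)) := by
  set y := extChartAt 𝓘(ℝ, RSpace n) b b with hy
  set A := RiemannianTarget.metricMatrix g b y with hA
  have h1 : ∀ s, ∑ l, A j l * A⁻¹ l s = (1 : Matrix (Fin n) (Fin n) ℝ) j s := fun s => by
    rw [← Matrix.mul_nonsing_inv _ (isUnit_det_metricMatrix g b), Matrix.mul_apply]
  set B : Fin n → ℝ := fun s =>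
    fderiv ℝ (fun y => RiemannianTarget.metricMatrix g b y i s) y (rBasis k)
      + fderiv ℝ (fun y => RiemannianTarget.metricMatrix g b y k s) y (rBasis i)
      - fderiv ℝ (fun y => RiemannianTarget.metricMatrix g b y k i) y (rBasis s) with hB
  have h2 : ∀ l, RiemannianTarget.christoffel g b l k i * A l j =
      ∑ s, (1 / 2) * (B s * (A j l * A⁻¹ l s)) := by
    intro l
    have h3 : RiemannianTarget.christoffel g b l k i = (1 / 2) * ∑ s, A⁻¹ l s * B s := rfl
    rw [h3, hA, metricMatrix_symm g b y l j, Finset.mul_sum, Finset.sum_mul]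
    exact Finset.sum_congr rfl fun s _ => by ring
  simp only [h2]
  rw [Finset.sum_comm]
  simp only [← Finset.mul_sum, h1, Matrix.one_apply, mul_ite, mul_one, mul_zero, Finset.sum_ite_eq,
    Finset.mem_univ, if_true]
  rfl

/-- Adding the lowered symbols with i and j exchanged cancels the four derivatives that are not in
the direction k and leaves ∂_k g_{ij}. -/
theorem fderiv_metricMatrix (b : N) (v : RSpace n) (i j : Fin n) :
    fderiv ℝ (fun y => RiemannianTarget.metricMatrix g b y i j)
      (extChartAt 𝓘(ℝ, RSpace n) b b) v =
    ∑ l, ((∑ k, RiemannianTarget.christoffel g b l k i * v k) *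
        RiemannianTarget.metricMatrix g b (extChartAt 𝓘(ℝ, RSpace n) b b) l j +
      (∑ k, RiemannianTarget.christoffel g b l k j * v k) *
        RiemannianTarget.metricMatrix g b (extChartAt 𝓘(ℝ, RSpace n) b b) i l) := by
  set y := extChartAt 𝓘(ℝ, RSpace n) b b with hy
  have h1 : ∀ i j, ∑ l, (∑ k, RiemannianTarget.christoffel g b l k i * v k) *
      RiemannianTarget.metricMatrix g b y l j = ∑ k, v k *
        ∑ l, RiemannianTarget.christoffel g b l k i * RiemannianTarget.metricMatrix g b y l j := by
    intro i j
    simp only [Finset.sum_mul, Finset.mul_sum]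
    rw [Finset.sum_comm]
    exact Finset.sum_congr rfl fun k _ => Finset.sum_congr rfl fun l _ => by ring
  simp only [metricMatrix_symm g b y i]
  rw [Finset.sum_add_distrib, h1, h1, ← Finset.sum_add_distrib]
  conv_lhs => rw [← sum_coord_smul_rBasis v, map_sum]
  refine Finset.sum_congr rfl fun k _ => ?_
  rw [map_smul, smul_eq_mul, christoffel_mul_metricMatrix, christoffel_mul_metricMatrix,
    funext fun y => metricMatrix_symm g b y j i]
  ring

/-- The complexified tangent frame of a Riemannian manifold. -/
def riemannianFrame : TargetFrame n (RSpace n) N where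
  κ := realCoords n
  G b y := (RiemannianTarget.metricMatrix g b y).map Complex.ofReal
  Γ b i j k := (RiemannianTarget.christoffel g b i j k : ℝ)
  contDiffOn_G b i j := Complex.ofRealCLM.contDiff.comp_contDiffOn (contDiffOn_metricMatrix g b i j)
  G_conj b y _ i j := by
    rw [Matrix.map_apply, Matrix.map_apply, Complex.conj_ofReal, metricMatrix_symm]
  compat b v i j := by
    have h1 := ((contDiffOn_metricMatrix g b i j).contDiffAt (target_mem_nhds b
      (mem_extChartAt_target b))).differentiableAt (by simp)
    have h2 : fderiv ℝ (fun y => (RiemannianTarget.metricMatrix g b y).map Complex.ofReal i j)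
        (extChartAt 𝓘(ℝ, RSpace n) b b) v = ((fderiv ℝ (fun y =>
          RiemannianTarget.metricMatrix g b y i j) (extChartAt 𝓘(ℝ, RSpace n) b b) v : ℝ) : ℂ) :=
      congrArg (fun A : RSpace n →L[ℝ] ℂ => A v)
        (Complex.ofRealCLM.hasFDerivAt.comp _ h1.hasFDerivAt).fderiv
    rw [h2, fderiv_metricMatrix]
    simp only [Matrix.map_apply, realCoords_apply, ← Complex.ofReal_mul, ← Complex.ofReal_sum,
      Complex.conj_ofReal, ← Complex.ofReal_add]
  symm b i j k := by rw [riemannian_christoffel_symm]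
  change b y _ q hq v w := by
    rw [formG_metricMatrix_center, formG_metricMatrix, hq]
  pos b v hv := by
    rw [formG_metricMatrix_center]
    exact metricAt_pos g b hv

end Riemannian

/-! ### The equivalences for Riemannian targets. -/

section RiemannianMaps

variable {m : ℕ} {M : Type*} [TopologicalSpace M] [ChartedSpace (CSpace m) M]
  [IsManifold 𝓘(ℂ, CSpace m) ω M]
  {n : ℕ} {N : Type*} [TopologicalSpace N] [ChartedSpace (RSpace n) N]
  [IsManifold 𝓘(ℝ, RSpace n) ∞ N]
  {h : RiemMetric (CSpace m) M} (g : RiemMetric (RSpace n) N)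

theorem riemannianLocalData_eq (f : M → N) (p : M) :
    RiemannianTarget.localData h g f p = (riemannianFrame g).localData h f p := by
  have h1 := locMap_center (W := CSpace m) (V := RSpace n) p f
  simp only [TargetFrame.localData, TargetFrame.dataOf, h1]
  rfl

theorem conj_hess_riemannian (c : N) {F : CSpace m → RSpace n} {x : CSpace m}
    (hF : ContDiffAt ℝ ∞ F x) (u w : CSpace m) (i : Fin n) :
    (starRingEnd ℂ) ((riemannianFrame g).hess c F x u w i) =
      (riemannianFrame g).hess c F x u w i := by
  have h1 : ∀ v i, (starRingEnd ℂ) ((riemannianFrame g).κ v i) = (riemannianFrame g).κ v i :=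
    fun v i => Complex.conj_ofReal _
  have h2 : ∀ i j k, (starRingEnd ℂ) ((riemannianFrame g).Γ c i j k) =
      (riemannianFrame g).Γ c i j k := fun i j k => Complex.conj_ofReal _
  simp only [(riemannianFrame g).hess_apply c hF, map_add, map_sum, map_mul, h1, h2]

/-- The tension field of a map into a Riemannian manifold is real. -/
theorem conj_tension_riemannian (hh : IsHermitian h) {f : M → N}
    (hf : ContMDiff 𝓘(ℝ, CSpace m) 𝓘(ℝ, RSpace n) ∞ f) (p : M) (i : Fin n) :
    (starRingEnd ℂ) (((riemannianFrame g).localData h f p).tension i) =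
      ((riemannianFrame g).localData h f p).tension i := by
  have hloc := contDiffAt_locMap p (f p) hf (center_mem_locDom (W := CSpace m) (V := RSpace n) p f)
  have hH : (hermMatrix h p (extChartAt 𝓘(ℝ, CSpace m) p p)).IsHermitian :=
    Matrix.IsHermitian.ext fun i j => hermMatrix_conj hh p (mem_extChartAt_target p) j i
  have h1 : ∀ α β, (starRingEnd ℂ) (raise (hermMatrix h p (extChartAt 𝓘(ℝ, CSpace m) p p)) α β) =
      raise (hermMatrix h p (extChartAt 𝓘(ℝ, CSpace m) p p)) β α :=
    fun α β => hH.inv.apply α β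
  rw [TargetFrame.localData, TargetFrame.tension_dataOf _ _ _ hloc]
  simp only [Finset.sum_apply, Pi.smul_apply, smul_eq_mul, map_sum, map_mul, h1]
  rw [Finset.sum_comm]
  refine Finset.sum_congr rfl fun α _ => Finset.sum_congr rfl fun β _ => congrArg (_ * ·) ?_
  simp only [TargetFrame.mixHess, Pi.smul_apply, Pi.add_apply, Pi.sub_apply, smul_eq_mul, map_mul,
    map_add, map_sub, conj_hess_riemannian g _ hloc, Complex.conj_I, map_div₀, map_one, map_ofNat]
  -- Conjugation transposes the inverse domain metric and reverses the sign of the i-term in the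
  -- (1,1)-part of the Hessian. Exchanging α and β has the same effect, by symmetry of the Hessian,
  -- so the trace is real.
  rw [(riemannianFrame g).hess_symm _ hloc (cBasis β) (cBasis α),
    (riemannianFrame g).hess_symm _ hloc (Complex.I • cBasis β) (Complex.I • cBasis α),
    (riemannianFrame g).hess_symm _ hloc (cBasis β) (Complex.I • cBasis α),
    (riemannianFrame g).hess_symm _ hloc (Complex.I • cBasis β) (cBasis α)]
  ring

theorem im_tensionForm_riemannian (hh : IsHermitian h) {f : M → N}
    (hf : ContMDiff 𝓘(ℝ, CSpace m) 𝓘(ℝ, RSpace n) ∞ f)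
    (X : ∀ p : M, TangentSpace 𝓘(ℝ, RSpace n) (f p)) (p : M) :
    ((riemannianFrame g).tensionForm h f X p).im = 0 := by
  refine Complex.conj_eq_iff_im.1 ?_
  have h1 : ∀ i, (starRingEnd ℂ) ((riemannianFrame g).κ (X p) i) = (riemannianFrame g).κ (X p) i :=
    fun i => Complex.conj_ofReal _
  have h2 : ∀ b y i j, (starRingEnd ℂ) ((riemannianFrame g).G b y i j) =
      (riemannianFrame g).G b y i j := fun b y i j => Complex.conj_ofReal _
  simp only [TargetFrame.tensionForm, formG, map_sum, map_mul, h1, h2,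
    conj_tension_riemannian g hh hf]

theorem pairE_secComp {f : M → N} (hf : ContMDiff 𝓘(ℝ, CSpace m) 𝓘(ℝ, RSpace n) ∞ f)
    {X Y : ∀ p : M, TangentSpace 𝓘(ℝ, RSpace n) (f p)} (hX : IsSmoothAlong (W := CSpace m) f X)
    (hY : IsSmoothAlong (W := CSpace m) f Y) (ε : ℂ) (p : M) :
    ((riemannianFrame g).localData h f p).pairE ε (RiemannianTarget.secComp f X Y p) =
      ((riemannianFrame g).localData h f p).pairE ε ((riemannianFrame g).comps (secLoc f X p)) +
      Complex.I *
        ((riemannianFrame g).localData h f p).pairE ε ((riemannianFrame g).comps (secLoc f Y p)) := by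
  have hd : ∀ {X : ∀ p : M, TangentSpace 𝓘(ℝ, RSpace n) (f p)},
      IsSmoothAlong (W := CSpace m) f X → ∀ i, DifferentiableAt ℝ
        ((riemannianFrame g).comps (secLoc (W := CSpace m) f X p) i)
        (extChartAt 𝓘(ℝ, CSpace m) p p) := fun hX i =>
    (riemannianFrame g).differentiableAt_comps (((hX.contDiffOn_secLoc hf p).contDiffAt
      ((isOpen_locDom p (f p) hf.continuous).mem_nhds (center_mem_locDom p f))).differentiableAt
        (by simp)) i
  exact LocalData.pairE_add_I_mul _ ε (hd hX) (hd hY)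

variable [CompactSpace M] [T2Space M] [MeasurableSpace M] [BorelSpace M]

/-- The pairing is complex linear in the section, so testing with complex sections reduces to
testing with real ones. -/
theorem riemannian_eulerLagrange_iff (hh : IsHermitian h) (hb : IsBalanced h) {f : M → N}
    (hf : ContMDiff 𝓘(ℝ, CSpace m) 𝓘(ℝ, RSpace n) ∞ f) {a b : ℝ} (hab : 0 < a + b)
    (hτ : ∀ p, ∃ v, (riemannianFrame g).κ v = ((riemannianFrame g).localData h f p).tension) :
    (∀ X Y : ∀ p : M, TangentSpace 𝓘(ℝ, RSpace n) (f p),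
      IsSmoothAlong (W := CSpace m) f X → IsSmoothAlong (W := CSpace m) f Y →
      ∫ p, (a * ((riemannianFrame g).localData h f p).pairE 1 (RiemannianTarget.secComp f X Y p) +
        b * ((riemannianFrame g).localData h f p).pairE (-1) (RiemannianTarget.secComp f X Y p))
        ∂(volumeMeasure h) = 0) ↔
      ∀ p, ((riemannianFrame g).localData h f p).tension = 0 := by
  set T := riemannianFrame g with hT
  have key : ∀ {X Y : ∀ p : M, TangentSpace 𝓘(ℝ, RSpace n) (f p)},
      IsSmoothAlong (W := CSpace m) f X → IsSmoothAlong (W := CSpace m) f Y → ∀ p,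
      a * (T.localData h f p).pairE 1 (RiemannianTarget.secComp f X Y p) +
        b * (T.localData h f p).pairE (-1) (RiemannianTarget.secComp f X Y p) =
      T.pairW h a b f X p + Complex.I * T.pairW h a b f Y p := by
    intro X Y hX hY p
    rw [pairE_secComp g hf hX hY, pairE_secComp g hf hX hY, TargetFrame.pairW, TargetFrame.pairW]
    ring
  have hiff := T.eulerLagrange_iff hh hf hb hab hτ fun c v χ _ => by
    simp only [hT, im_tensionForm_riemannian g hh hf]
    exact continuous_const
  rw [← hiff]
  constructor
  · intro H X hX
    -- The section X + iX multiplies the pairing by the nonzero constant 1 + i, which avoids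
    -- splitting the integral before integrability is known.
    have h1 := H X X hX hX
    have h2 : ∀ p, a * (T.localData h f p).pairE 1 (RiemannianTarget.secComp f X X p) +
        b * (T.localData h f p).pairE (-1) (RiemannianTarget.secComp f X X p) =
        (1 + Complex.I) * T.pairW h a b f X p := fun p => by rw [key hX hX]; ring
    simp only [h2] at h1
    rw [integral_const_mul] at h1
    refine (mul_eq_zero.1 h1).resolve_left fun h3 => ?_
    simpa using congrArg Complex.re h3
  · intro H X Y hX hY
    have ht := hiff.1 H
    -- Once the tension vanishes, the pairing coincides with the continuous divergence and is
    -- integrable, so the integral may be split.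
    have hc : ∀ {X : ∀ p : M, TangentSpace 𝓘(ℝ, RSpace n) (f p)},
        IsSmoothAlong (W := CSpace m) f X →
        Integrable (T.pairW h a b f X) (volumeMeasure h) := by
      intro X hX
      have h1 : T.pairW h a b f X = T.divW h a b f X := by
        funext p
        have h2 : T.tensionForm h f X p = 0 := by
          simp [TargetFrame.tensionForm, ht p, formG]
        rw [T.divW_eq hh hf hX, h2, mul_zero, add_zero]
      rw [h1]
      exact integrable_of_continuous h (T.continuous_divW hh hf hX a b)
    simp only [key hX hY]
    rw [integral_add (hc hX) ((hc hY).const_mul _), integral_const_mul, H X hX, H Y hY]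
    simp

theorem riemannian_tfae (hh : IsHermitian h) (hb : IsBalanced h) {f : M → N}
    (hf : ContMDiff 𝓘(ℝ, CSpace m) 𝓘(ℝ, RSpace n) ∞ f) :
    List.TFAE [RiemannianTarget.IsDbarHarmonic h g f, RiemannianTarget.DbarEulerLagrange h g f,
      RiemannianTarget.IsDelHarmonic h g f, RiemannianTarget.DelEulerLagrange h g f,
      RiemannianTarget.IsHarmonic h g f, RiemannianTarget.EulerLagrange h g f,
      RiemannianTarget.IsHermitianHarmonic h g f] := by
  set T := riemannianFrame g with hT
  -- Only real component vectors come from tangent vectors, so reality of the tension is essential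
  -- here.
  have hτ : ∀ p, ∃ v, T.κ v = (T.localData h f p).tension := fun p => by
    refine ⟨WithLp.toLp 2 fun i => ((T.localData h f p).tension i).re, ?_⟩
    funext i
    exact Complex.conj_eq_iff_re.1 (conj_tension_riemannian g hh hf p i)
  have hiff : RiemannianTarget.IsHermitianHarmonic h g f ↔
      ∀ p, (T.localData h f p).tension = 0 :=
    forall_congr' fun p => by
      rw [riemannianLocalData_eq, LocalData.hermitianHarmonicEq_iff]
  have hcrit : ∀ a b : ℝ, 0 < a + b →
      (IsCritical (W := CSpace m) (V := RSpace n) (T.energyW h a b) f ↔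
        RiemannianTarget.IsHermitianHarmonic h g f) := fun a b hab =>
    (T.isCritical_energyW_iff hh hf hb hab hτ).trans hiff.symm
  have hel := fun (a b : ℝ) (hab : 0 < a + b) =>
    (riemannian_eulerLagrange_iff g hh hb hf hab hτ).trans hiff.symm
  have e1 : RiemannianTarget.dbarEnergy h g = T.energyW h 1 0 := by
    funext f
    simp only [RiemannianTarget.dbarEnergy, TargetFrame.energyW, riemannianLocalData_eq,
      LocalData.dbarNormSq_eq, one_mul, zero_mul, add_zero, ← hT]
  have e2 : RiemannianTarget.delEnergy h g = T.energyW h 0 1 := by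
    funext f
    simp only [RiemannianTarget.delEnergy, TargetFrame.energyW, riemannianLocalData_eq,
      LocalData.delNormSq_eq, one_mul, zero_mul, zero_add, ← hT]
  have e3 : RiemannianTarget.energy h g = T.energyW h 1 1 := by
    funext f
    simp only [RiemannianTarget.energy, TargetFrame.energyW, riemannianLocalData_eq,
      LocalData.delNormSq_eq, LocalData.dbarNormSq_eq, one_mul, ← hT]
  have i1 := hcrit 1 0 (by norm_num)
  have i2 := hcrit 0 1 (by norm_num)
  have i3 := hcrit 1 1 (by norm_num)
  have j1 := hel 1 0 (by norm_num)
  have j2 := hel 0 1 (by norm_num)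
  have j3 := hel 1 1 (by norm_num)
  rw [← e1] at i1
  rw [← e2] at i2
  rw [← e3] at i3
  simp only [Complex.ofReal_one, Complex.ofReal_zero, one_mul, zero_mul,
    add_zero, zero_add, ← LocalData.dbarPair_eq, ← LocalData.delPair_eq,
    ← riemannianLocalData_eq] at j1 j2 j3
  tfae_have 1 ↔ 7 := i1
  tfae_have 2 ↔ 7 := j1
  tfae_have 3 ↔ 7 := i2
  tfae_have 4 ↔ 7 := j2
  tfae_have 5 ↔ 7 := i3
  tfae_have 6 ↔ 7 := j3
  tfae_finish

end RiemannianMaps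

end

end HarmonicMaps

theorem mainTheorem10
    {m : ℕ} {M : Type*} [TopologicalSpace M] [ChartedSpace (HarmonicMaps.CSpace m) M]
    [IsManifold 𝓘(ℂ, HarmonicMaps.CSpace m) ω M]
    [CompactSpace M] [T2Space M] [MeasurableSpace M] [BorelSpace M]
    (h : HarmonicMaps.RiemMetric (HarmonicMaps.CSpace m) M)
    (hherm : HarmonicMaps.IsHermitian h) (hbal : HarmonicMaps.IsBalanced h) :
    (∀ {n : ℕ} {N : Type*} [TopologicalSpace N] [ChartedSpace (HarmonicMaps.CSpace n) N]
        [IsManifold 𝓘(ℂ, HarmonicMaps.CSpace n) ω N] [T2Space N]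
        (g : HarmonicMaps.RiemMetric (HarmonicMaps.CSpace n) N), HarmonicMaps.IsKahler g →
        ∀ f : M → N, ContMDiff 𝓘(ℝ, HarmonicMaps.CSpace m) 𝓘(ℝ, HarmonicMaps.CSpace n) ∞ f →
        List.TFAE [
          HarmonicMaps.KahlerTarget.IsDbarHarmonic h g f,
          HarmonicMaps.KahlerTarget.DbarEulerLagrange h g f,
          HarmonicMaps.KahlerTarget.IsDelHarmonic h g f,
          HarmonicMaps.KahlerTarget.DelEulerLagrange h g f,
          HarmonicMaps.KahlerTarget.IsHarmonic h g f,
          HarmonicMaps.KahlerTarget.EulerLagrange h g f,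
          HarmonicMaps.KahlerTarget.IsHermitianHarmonic h g f]) ∧
    (∀ {n : ℕ} {N : Type*} [TopologicalSpace N] [ChartedSpace (HarmonicMaps.RSpace n) N]
        [IsManifold 𝓘(ℝ, HarmonicMaps.RSpace n) ∞ N] [T2Space N]
        (g : HarmonicMaps.RiemMetric (HarmonicMaps.RSpace n) N)
        (f : M → N), ContMDiff 𝓘(ℝ, HarmonicMaps.CSpace m) 𝓘(ℝ, HarmonicMaps.RSpace n) ∞ f →
        List.TFAE [
          HarmonicMaps.RiemannianTarget.IsDbarHarmonic h g f,
          HarmonicMaps.RiemannianTarget.DbarEulerLagrange h g f,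
          HarmonicMaps.RiemannianTarget.IsDelHarmonic h g f,
          HarmonicMaps.RiemannianTarget.DelEulerLagrange h g f,
          HarmonicMaps.RiemannianTarget.IsHarmonic h g f,
          HarmonicMaps.RiemannianTarget.EulerLagrange h g f,
          HarmonicMaps.RiemannianTarget.IsHermitianHarmonic h g f]) := by
  exact ⟨fun g hg f hf => HarmonicMaps.kahler_tfae hg hherm hbal hf,
    fun g f hf => HarmonicMaps.riemannian_tfae g hherm hbal hf⟩
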